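/- A \emph{pseudo-line} is a subset of the real projective plane $\mathbb{P}^2(\mathbb{R})$ that is sent onto a line by some homeomorphism of $\mathbb{P}^2(\mathbb{R})$. Let $n\ge 3$ be an integer with $n\equiv 2\pmod 6$, and let $\mathcal{A}=\{A_1,\dots,A_n\}$ be a simple projective arrangement of $n$ pseudo-lines, i.e. a set of $n$ pseudo-lines of $\mathbb{P}^2(\mathbb{R})$ such that any two of them intersect transversally (in some local topological chart they are the two coordinate axes) in exactly one point, which lies on no other pseudo-line of $\mathcal{A}$. The \emph{polygons} of $\mathcal{A}$ are the connected components of $\mathbb{P}^2(\mathbb{R})\setminus\bigcup_i A_i$; the \emph{segments} of $\mathcal{A}$ are the closures of the connected components of the sets $A_i\setminus\bigcup_{j\ne i}A_j$. A polygon is a \emph{triangle} (respectively a \emph{pentagon}) if it is delimited by exactly three (respectively five) segments, i.e. its boundary is the union of these segments. A segment is \emph{unused} if it is not an edge of (not contained in the boundary of) any triangle. Then the number $p_3(\mathcal{A})$ of triangles of $\mathcal{A}$ is finite and satisfies $$p_3(\mathcal{A})\le \frac{n(n-1)-5}{3}.$$ Furthermore, if equality holds, then $\mathcal{A}$ has exactly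 five unused segments, and these delimit a pentagon of $\mathcal{A}$. -/

import Mathlib

/-- The real projective plane `P²(ℝ)`. -/
abbrev RP2 : Type := Projectivization ℝ (Fin 3 → ℝ)

/-- The usual topology of `P²(ℝ)`: the quotient topology from `ℝ³ \ {0}`. -/
instance RP2.instTopologicalSpace : TopologicalSpace RP2 :=
  inferInstanceAs (TopologicalSpace (Quotient (projectivizationSetoid ℝ (Fin 3 → ℝ))))

/-- A (straight) line of `P²(ℝ)`: the points contained in a plane through `0` in `ℝ³`. -/
def IsProjLine (L : Set RP2) : Prop :=
  ∃ W : Submodule ℝ (Fin 3 → ℝ), Module.finrank ℝ W = 2 ∧ L = {p : RP2 | p.submodule ≤ W}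

/-- A pseudo-line: a subset that some homeomorphism of the plane sends onto a line. -/
def IsPseudoLine (L : Set RP2) : Prop :=
  ∃ h : RP2 ≃ₜ RP2, IsProjLine (h '' L)

/-- `A` and `B` intersect transversally at `p`: in some local topological chart of the plane
centred at `p`, they are the two coordinate axes. -/
def CrossAt (A B : Set RP2) (p : RP2) : Prop :=
  ∃ φ : OpenPartialHomeomorph RP2 (ℝ × ℝ), p ∈ φ.source ∧ φ p = (0, 0) ∧
    ∀ q ∈ φ.source, (q ∈ A ↔ (φ q).2 = 0) ∧ (q ∈ B ↔ (φ q).1 = 0)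

/-- `A 0, …, A (n - 1)` form a simple projective arrangement of `n` pseudo-lines: any two of the
curves intersect transversally, in exactly one point, which lies on no other curve.
(This forces the `A i` to be pairwise distinct, as a pseudo-line is infinite.) -/
structure IsSimpleArrangement {n : ℕ} (A : Fin n → Set RP2) : Prop where
  pseudoLine : ∀ i, IsPseudoLine (A i)
  cross : ∀ i j, i ≠ j → ∃ p, A i ∩ A j = {p} ∧ CrossAt (A i) (A j) p ∧
    ∀ k, k ≠ i → k ≠ j → p ∉ A k

namespace Arrangement

variable {n : ℕ}

/-- The part of the `i`-th pseudo-line that lies on no other pseudo-line. -/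
def openPart (A : Fin n → Set RP2) (i : Fin n) : Set RP2 :=
  A i \ ⋃ j ∈ {j : Fin n | j ≠ i}, A j

/-- The (closed) segments of the arrangement: the closures of the connected components of what
remains of a pseudo-line when its intersection points with the others are removed. -/
def segments (A : Fin n → Set RP2) : Set (Set RP2) :=
  {s | ∃ i, ∃ x ∈ openPart A i, s = closure (connectedComponentIn (openPart A i) x)}

/-- The polygons of the arrangement: the connected components of the complement of the union of
the pseudo-lines. -/
def polygons (A : Fin n → Set RP2) : Set (Set RP2) :=
  {P | ∃ x ∈ (⋃ i, A i)ᶜ, P = connectedComponentIn (⋃ i, A i)ᶜ x}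

/-- The segments in `S` delimit the polygon `P`: their union is the boundary of `P`. -/
def Delimits (S : Set (Set RP2)) (P : Set RP2) : Prop :=
  frontier P = ⋃₀ S

/-- `P` is a `k`-gon of the arrangement: a polygon delimited by exactly `k` segments. -/
def IsGon (A : Fin n → Set RP2) (k : ℕ) (P : Set RP2) : Prop :=
  P ∈ polygons A ∧ ∃ S ⊆ segments A, S.ncard = k ∧ S.Finite ∧ Delimits S P

/-- The triangles of the arrangement. -/
def triangles (A : Fin n → Set RP2) : Set (Set RP2) :=
  {P | IsGon A 3 P}

/-- `p₃`, the number of triangles. -/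
noncomputable def p₃ (A : Fin n → Set RP2) : ℕ :=
  (triangles A).ncard

/-- The unused segments: those that are not an edge of a triangle. -/
def unused (A : Fin n → Set RP2) : Set (Set RP2) :=
  {s | s ∈ segments A ∧ ¬ ∃ T ∈ triangles A, s ⊆ frontier T}

end Arrangement

/-! Counting. Each curve is cut into `n - 1` segments, and no segment borders two triangles
(`not_isTri_add`): the two edges leaving one of its ends along the crossing curve would both have to
end on the same third curve. Hence three times the number of triangles plus the number `u` of unused
segments is `n (n - 1)` (`count`), and `u ≡ 2 (mod 3)` when `n ≡ 2 (mod 6)`. At each end of an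
unused segment the crossing curve carries another unused segment, so `u ≠ 0` forces `u ≥ 3`
(`three_le_unused`), hence `u ≥ 5`. This is the bound.

Equality. Let `u = 5`. No curve carries two unused segments (`unused_unique`). Along consecutive
used segments the triangles alternate sides, and `n - 1` is odd, so the two neighbours of an unused
segment have their triangles on the same side. Consequently the face on the opposite side of the
unused segment is also bounded by the unused segments found at its two ends (`IsUnusedSide.next`),
and all five unused segments form a cycle along a single face `X`.

It remains to see that `X` has no other edge (`exists_pentagon`). Each of the five curves has a mod
2 side function, defined up to simultaneous changes across a reference curve. A quadratic form in
these five signs (`pentagonForm`) gives a function `Q` on faces that changes exactly across unused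
segments. It is 0 at `X` and 1 at every face with a used edge, so every edge of `X` is unused.

Topology. The combinatorial axioms of `SideSystem` are verified with a strip around each curve,
parametrized by its orientation double cover, and with charts at the crossings (`face_vertex`). The
side functions come from `RP2.exists_sign`: the complement of a pseudo-line is a plane, so maps from
it into the projective plane lift to the sphere, where a coordinate has a sign. -/

/-! ### Side systems: triangles, used and unused segments -/

/-- The combinatorics of a simple arrangement of `n` one-sided curves with `N` crossings each.
The integer `k` runs over the double cover of the `i`-th curve: `lab i k` is the curve crossed at
the `k`-th vertex, and `face i k` is the face on the positive side of the segment between the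
vertices `k` and `k + 1`, the other side of this segment being `face i (k + N)`. -/
structure SideSystem (n N : ℕ) (F : Type*) where
  /-- The curve crossed at a vertex. -/
  lab : Fin n → ℤ → Fin n
  /-- The face on the positive side of a segment. -/
  face : Fin n → ℤ → F
  lab_eq_iff : ∀ i k l, lab i k = lab i l ↔ (N : ℤ) ∣ k - l
  lab_ne : ∀ i k, lab i k ≠ i
  lab_surj : ∀ i j, j ≠ i → ∃ k, lab i k = j
  face_period : ∀ i k, face i (k + 2 * N) = face i k
  -- The four sectors at a vertex, read along both curves. The segment `b` of the crossing curve
  -- lies on the positive side of `i`, lifted so that its own positive side is the sector after the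
  -- vertex; `b - d` continues it across `i`. The vertex is the start of `b` if `d = 1` and its end
  -- if `d = -1`.
  vertex : ∀ i k, ∃ b d : ℤ,
    ((d = 1 ∧ lab (lab i k) b = i) ∨ (d = -1 ∧ lab (lab i k) (b + 1) = i)) ∧
    face (lab i k) b = face i k ∧ face (lab i k) (b + N) = face i (k - 1) ∧
    face (lab i k) (b - d) = face i (k + N) ∧ face (lab i k) (b - d + N) = face i (k - 1 + N)

namespace SideSystem

variable {n N : ℕ} {F : Type*} (S : SideSystem n N F)

/-- The segments adjacent to a face. -/
def edges (X : F) : Set (Fin n × ZMod N) :=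
  {e | ∃ k : ℤ, S.face e.1 k = X ∧ (k : ZMod N) = e.2}

/-- A face with three edges. -/
def IsTri (X : F) : Prop := (S.edges X).ncard = 3

/-- The segment `k` of the curve `i` is an edge of a face with three edges. -/
def Used (i : Fin n) (k : ℤ) : Prop := S.IsTri (S.face i k) ∨ S.IsTri (S.face i (k + N))

/-- The segments that are an edge of no face with three edges. -/
def unusedEdges : Set (Fin n × ZMod N) := {e | ¬ ∃ X, S.IsTri X ∧ e ∈ S.edges X}

lemma face_add_mul (i : Fin n) (k z : ℤ) : S.face i (k + z * (2 * N)) = S.face i k := by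
  induction z using Int.induction_on with
  | zero => simp
  | succ z ih => rw [← ih, ← S.face_period i (k + z * (2 * N))]; congr 1; ring
  | pred z ih =>
    rw [← ih, ← S.face_period i (k + (-(z : ℤ) - 1) * (2 * N))]; congr 1; ring

lemma face_add_add (i : Fin n) (k : ℤ) : S.face i (k + N + N) = S.face i k := by
  rw [← S.face_period i k]; congr 1; ring

/-- An even quotient is a whole number of turns of the double cover; an odd one exchanges the two
sides. -/
lemma face_of_dvd {i : Fin n} {k l : ℤ} (h : (N : ℤ) ∣ k - l) :
    S.face i k = S.face i l ∧ S.face i (k + N) = S.face i (l + N) ∨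
    S.face i k = S.face i (l + N) ∧ S.face i (k + N) = S.face i l := by
  obtain ⟨q, hq⟩ := h
  obtain ⟨z, hz | hz⟩ := Int.even_or_odd' q
  · left
    constructor
    · rw [← S.face_add_mul i l z]; congr 1; subst hz; linarith
    · rw [← S.face_add_mul i (l + N) z]; congr 1; subst hz; linarith
  · right
    constructor
    · rw [← S.face_add_mul i (l + N) z]; congr 1; subst hz; linarith
    · rw [← S.face_add_mul i l (z + 1)]; congr 1; subst hz; linarith

lemma cast_eq_iff {k l : ℤ} : (k : ZMod N) = (l : ZMod N) ↔ (N : ℤ) ∣ k - l := by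
  rw [eq_comm, ZMod.intCast_eq_intCast_iff_dvd_sub]

lemma mem_edges_iff {i : Fin n} {k : ℤ} {X : F} :
    (i, (k : ZMod N)) ∈ S.edges X ↔ S.face i k = X ∨ S.face i (k + N) = X := by
  constructor
  · rintro ⟨l, hl, hlk⟩
    rcases S.face_of_dvd (i := i) (cast_eq_iff.1 hlk) with h | h
    · left; rw [← h.1]; exact hl
    · right; rw [← h.1]; exact hl
  · rintro (h | h)
    · exact ⟨k, h, rfl⟩
    · exact ⟨k + N, h, by simp⟩

lemma used_congr {i : Fin n} {k l : ℤ} (h : (N : ℤ) ∣ k - l) : S.Used i k ↔ S.Used i l := by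
  unfold Used
  rcases S.face_of_dvd (i := i) h with h | h
  · rw [h.1, h.2]
  · rw [h.1, h.2, or_comm]

lemma mem_unusedEdges_iff {i : Fin n} {k : ℤ} :
    (i, (k : ZMod N)) ∈ S.unusedEdges ↔ ¬ S.Used i k := by
  unfold unusedEdges Used
  simp only [Set.mem_ofPred_eq, mem_edges_iff, not_iff_not]
  constructor
  · rintro ⟨X, hX, rfl | rfl⟩
    · exact Or.inl hX
    · exact Or.inr hX
  · rintro (h | h)
    · exact ⟨_, h, Or.inl rfl⟩
    · exact ⟨_, h, Or.inr rfl⟩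

lemma lab_congr {i : Fin n} {k l : ℤ} (h : (N : ℤ) ∣ k - l) : S.lab i k = S.lab i l :=
  (S.lab_eq_iff i k l).2 h

lemma lab_add (i : Fin n) (k : ℤ) : S.lab i (k + N) = S.lab i k := S.lab_congr (by simp)

lemma not_dvd_of_lt {N : ℕ} {a : ℤ} (h0 : a ≠ 0) (h1 : |a| < N) : ¬ (N : ℤ) ∣ a := fun h =>
  h0 (Int.eq_zero_of_abs_lt_dvd h h1)

/-- The edges of a triangle lie on three different curves. -/
lemma edges_of_isTri [NeZero N] (hN : 3 ≤ N) {i : Fin n} {k : ℤ} (h : S.IsTri (S.face i k)) :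
    ∃ b c : ℤ, S.edges (S.face i k) = {(i, (k : ZMod N)), (S.lab i k, (b : ZMod N)),
      (S.lab i (k + 1), (c : ZMod N))} := by
  obtain ⟨b, d, -, h1, -⟩ := S.vertex i k
  obtain ⟨c, d', -, -, h2, -⟩ := S.vertex i (k + 1)
  refine ⟨b, c, ?_⟩
  rw [add_sub_cancel_right] at h2
  have hne : S.lab i k ≠ S.lab i (k + 1) := by
    rw [Ne, S.lab_eq_iff]
    exact not_dvd_of_lt (by omega) (by rw [show k - (k + 1) = -1 by ring]; simp; omega)
  symm
  apply Set.eq_of_subset_of_ncard_le _ _ (Set.toFinite _)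
  · rintro e (rfl | rfl | rfl)
    · exact S.mem_edges_iff.2 (Or.inl rfl)
    · exact S.mem_edges_iff.2 (Or.inl h1)
    · exact S.mem_edges_iff.2 (Or.inr h2)
  · rw [show (S.edges (S.face i k)).ncard = 3 from h, Set.ncard_eq_toFinset_card']
    have h1 := S.lab_ne i k
    have h2 := S.lab_ne i (k + 1)
    simp [Finset.card_insert_of_notMem, Prod.ext_iff, hne, h1.symm, h2.symm]

lemma line_of_isTri [NeZero N] (hN : 3 ≤ N) {i j : Fin n} {k b : ℤ} (h : S.IsTri (S.face i k))
    (hj : S.face j b = S.face i k) : j = i ∨ j = S.lab i k ∨ j = S.lab i (k + 1) := by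
  obtain ⟨b', c', he⟩ := S.edges_of_isTri hN h
  have : (j, (b : ZMod N)) ∈ S.edges (S.face i k) := S.mem_edges_iff.2 (Or.inl hj)
  rw [he] at this
  rcases this with h | h | h <;> simp only [Prod.ext_iff, Set.mem_singleton_iff] at h
  · exact Or.inl h.1
  · exact Or.inr (Or.inl h.1)
  · exact Or.inr (Or.inr h.1)

/-- If the curve `j` bounds a triangle that has an edge on `i`, then the third curve of the
triangle crosses `j` at the other end of the edge on `j`. -/
lemma line_mem_of_isTri [NeZero N] (hN : 3 ≤ N) {i j : Fin n} {k b : ℤ}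
    (h : S.IsTri (S.face i k)) (hj : S.face j b = S.face i k) :
    (S.lab j b = i ∨ S.lab j b = S.lab i k ∨ S.lab j b = S.lab i (k + 1)) ∧
    (S.lab j (b + 1) = i ∨ S.lab j (b + 1) = S.lab i k ∨ S.lab j (b + 1) = S.lab i (k + 1)) := by
  constructor
  · obtain ⟨c, d, -, h1, -⟩ := S.vertex j b
    exact S.line_of_isTri hN h (h1.trans hj)
  · obtain ⟨c, d, -, -, h2, -⟩ := S.vertex j (b + 1)
    rw [add_sub_cancel_right] at h2
    exact S.line_of_isTri hN h (h2.trans hj)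

/-- The two sides of a segment are not both triangles. -/
lemma not_isTri_add [NeZero N] (hN : 3 ≤ N) {i : Fin n} {k : ℤ} (h : S.IsTri (S.face i k)) :
    ¬ S.IsTri (S.face i (k + N)) := by
  intro h'
  -- Both triangles lie on the curves `i`, `lab i k` and `j`. So the segments of `j` on the two
  -- sides of `i` both end on `lab i k`, at vertices of `j` two steps apart, which is impossible for
  -- `N ≥ 3`.
  obtain ⟨b, d, hd, h1, h2, h3, h4⟩ := S.vertex i (k + 1)
  set j := S.lab i (k + 1) with hj
  rw [add_sub_cancel_right] at h2 h4
  have e1 := S.line_mem_of_isTri hN h h2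
  have e2 := S.line_mem_of_isTri hN h' h4
  rw [show k + N + 1 = k + 1 + N by ring, show b - d + N + 1 = b - d + 1 + N by ring] at e2
  rw [show b + N + 1 = b + 1 + N by ring] at e1
  simp only [S.lab_add, ← hj] at e1 e2
  have key : ∀ p q : ℤ, |p - q| = 1 → S.lab j p = i →
      (S.lab j q = i ∨ S.lab j q = S.lab i k ∨ S.lab j q = j) → S.lab j q = S.lab i k := by
    rintro p q hpq hp (h | h | h)
    · rw [← hp, S.lab_eq_iff, ← Int.dvd_neg, neg_sub] at h
      exact absurd h (not_dvd_of_lt (by rintro h0; simp [h0] at hpq) (by rw [hpq]; omega))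
    · exact h
    · exact absurd h (S.lab_ne j q)
  rcases hd with ⟨rfl, hi⟩ | ⟨rfl, hi⟩
  · have f1 := key _ _ (by simp) hi e1.2
    have f2 := key _ _ (by simp) hi e2.1
    rw [← f2, S.lab_eq_iff] at f1
    exact not_dvd_of_lt (by omega) (by rw [show b + 1 - (b - 1) = 2 by ring]; simp; omega) f1
  · have f1 := key _ _ (by simp) hi e1.1
    have f2 := key _ _ (by rw [show b + 1 - (b - -1 + 1) = -1 by ring]; simp) hi e2.2
    rw [← f2, S.lab_eq_iff] at f1
    exact not_dvd_of_lt (by omega)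
      (by rw [show b - (b - -1 + 1) = -2 by ring]; simp; omega) f1

/-- The two faces are the two sides of one segment of the crossing curve. This makes triangles
alternate sides along used segments. -/
lemma not_isTri_succ [NeZero N] (hN : 3 ≤ N) {i : Fin n} {k : ℤ} (h : S.IsTri (S.face i k)) :
    ¬ S.IsTri (S.face i (k + 1)) := by
  obtain ⟨b, d, -, h1, h2, -⟩ := S.vertex i (k + 1)
  rw [add_sub_cancel_right] at h2
  rw [← h1]
  intro h'
  exact S.not_isTri_add hN h' (h2 ▸ h)

/-! ### Counting -/

lemma finite_isTri [NeZero N] : {X | S.IsTri X}.Finite := by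
  apply Set.Finite.subset (Set.finite_range (fun e : Fin n × ZMod N × Bool =>
    S.face e.1 ((e.2.1.cast : ℤ) + if e.2.2 then (N : ℤ) else 0)))
  intro X hX
  have : (S.edges X).Nonempty := by
    rw [Set.nonempty_iff_ne_empty]; intro h
    simp only [Set.mem_ofPred_eq, IsTri, h, Set.ncard_empty] at hX
    omega
  obtain ⟨⟨i, c⟩, k, hk, hc⟩ := this
  have h1 : (N : ℤ) ∣ k - (c.cast : ℤ) := by
    rw [← cast_eq_iff, hc]; simp
  rcases S.face_of_dvd (i := i) h1 with h | h
  · exact ⟨(i, c, false), by rw [← hk, h.1]; simp⟩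
  · exact ⟨(i, c, true), by rw [← hk, h.1]; simp⟩

lemma edges_disjoint [NeZero N] (hN : 3 ≤ N) {X Y : F} (hX : S.IsTri X) (hY : S.IsTri Y)
    (hXY : X ≠ Y) : Disjoint (S.edges X) (S.edges Y) := by
  rw [Set.disjoint_left]
  rintro ⟨i, c⟩ ⟨k, rfl, rfl⟩ h
  rcases S.mem_edges_iff.1 h with h | h
  · exact hXY h
  · exact S.not_isTri_add hN hX (h ▸ hY)

/-- Each of the `n * N` segments is an edge of at most one triangle, so the edge sets of the
triangles partition the used segments. -/
lemma count [NeZero N] (hN : 3 ≤ N) :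
    3 * {X | S.IsTri X}.ncard + S.unusedEdges.ncard = n * N := by
  classical
  have hfin := S.finite_isTri
  have hu : S.unusedEdges = (⋃ X ∈ hfin.toFinset, S.edges X)ᶜ := by
    ext e
    simp [unusedEdges]
  have hcard : (⋃ X ∈ hfin.toFinset, S.edges X).ncard = 3 * {X | S.IsTri X}.ncard := by
    have : (⋃ X ∈ hfin.toFinset, S.edges X) =
        ((hfin.toFinset.biUnion fun X => (Set.toFinite (S.edges X)).toFinset :
          Finset (Fin n × ZMod N)) : Set (Fin n × ZMod N)) := by
      ext e; simp
    rw [this, Set.ncard_coe_finset, Finset.card_biUnion, Set.ncard_eq_toFinset_card _ hfin,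
      Finset.sum_congr rfl (g := fun _ => 3), Finset.sum_const, smul_eq_mul, mul_comm]
    · intro X hX
      rw [← Set.ncard_eq_toFinset_card]
      exact (by simpa using hX : S.IsTri X)
    · intro X hX Y hY hXY
      rw [Function.onFun, ← Finset.disjoint_coe]
      simpa using S.edges_disjoint hN (by simpa using hX) (by simpa using hY) hXY
  rw [hu, ← hcard, Set.ncard_add_ncard_compl]
  simp [Nat.card_eq_fintype_card, ZMod.card]

/-- At a vertex, an unused segment is continued by an unused segment of the crossing curve. -/
lemma exists_unused_of_turn [NeZero N] (hN : 3 ≤ N) {i : Fin n} {k : ℤ}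
    (h : ¬ S.Used i k ∨ ¬ S.Used i (k - 1)) :
    ∃ c : ℤ, ¬ S.Used (S.lab i k) c := by
  obtain ⟨b, d, -, h1, h2, h3, h4⟩ := S.vertex i k
  have hb : S.Used (S.lab i k) b ↔ (S.IsTri (S.face i k) ∨ S.IsTri (S.face i (k - 1))) := by
    rw [Used, h1, h2]
  have hbd : S.Used (S.lab i k) (b - d) ↔
      (S.IsTri (S.face i (k + N)) ∨ S.IsTri (S.face i (k - 1 + N))) := by
    rw [Used, h3, h4]
  -- One of the two segments of `i` at the vertex is unused, so both segments of the crossing curve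
  -- could be used only through triangles facing each other across the other one.
  by_cases hu : S.Used (S.lab i k) b
  · refine ⟨b - d, ?_⟩
    rw [hbd]
    rw [hb] at hu
    unfold Used at h
    rcases hu with hu | hu
    · have := S.not_isTri_add hN hu
      tauto
    · have := S.not_isTri_add hN hu
      tauto
  · exact ⟨b, hu⟩

/-- The unused segments found at the two ends of a given one lie on two further, different curves.
-/
lemma three_le_unused [NeZero N] (hN : 3 ≤ N) (h : S.unusedEdges.Nonempty) :
    3 ≤ S.unusedEdges.ncard := by
  obtain ⟨⟨i, c⟩, hc⟩ := h
  obtain ⟨k, rfl⟩ := ZMod.intCast_surjective c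
  have hk := S.mem_unusedEdges_iff.1 hc
  obtain ⟨a, ha⟩ := S.exists_unused_of_turn hN (k := k) (Or.inl hk)
  obtain ⟨b, hb⟩ := S.exists_unused_of_turn hN (i := i) (k := k + 1) (Or.inr (by simpa using hk))
  have hne : S.lab i k ≠ S.lab i (k + 1) := by
    rw [Ne, S.lab_eq_iff]
    exact not_dvd_of_lt (by omega) (by rw [show k - (k + 1) = -1 by ring]; simp; omega)
  have h1 := S.lab_ne i k
  have h2 := S.lab_ne i (k + 1)
  have : ({(i, (k : ZMod N)), (S.lab i k, (a : ZMod N)), (S.lab i (k + 1), (b : ZMod N))} :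
      Set (Fin n × ZMod N)) ⊆ S.unusedEdges := by
    rintro e (rfl | rfl | rfl)
    · exact S.mem_unusedEdges_iff.2 hk
    · exact S.mem_unusedEdges_iff.2 ha
    · exact S.mem_unusedEdges_iff.2 hb
  refine le_trans ?_ (Set.ncard_le_ncard this (Set.toFinite _))
  rw [Set.ncard_eq_toFinset_card']
  simp [Finset.card_insert_of_notMem, Prod.ext_iff, hne, h1.symm, h2.symm]

end SideSystem

/-! ### Exactly five unused segments: how they are linked -/

namespace SideSystem

variable {n N : ℕ} {F : Type*} (S : SideSystem n N F)

lemma lab_ne_lab {i : Fin n} {k l : ℤ} (h : ¬ (N : ℤ) ∣ k - l) : S.lab i k ≠ S.lab i l := by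
  rwa [Ne, S.lab_eq_iff]

/-- Two consecutive unused segments leave no triangle in any of the four sectors at their common
vertex. -/
lemma exists_unused_pair {i : Fin n} {k : ℤ} (h : ¬ S.Used i k) (h' : ¬ S.Used i (k - 1)) :
    ∃ b d : ℤ, (d = 1 ∨ d = -1) ∧ ¬ S.Used (S.lab i k) b ∧ ¬ S.Used (S.lab i k) (b - d) := by
  obtain ⟨b, d, hd, h1, h2, h3, h4⟩ := S.vertex i k
  refine ⟨b, d, hd.imp And.left And.left, ?_, ?_⟩
  · rw [Used, h1, h2]; unfold Used at h h'; tauto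
  · rw [Used, h3, h4]; unfold Used at h h'; tauto

/-- If there are only five unused segments, then no curve contains two of them. -/
lemma unused_unique [NeZero N] (hN : 3 ≤ N) (h5 : S.unusedEdges.ncard = 5) {i : Fin n} {k l : ℤ}
    (hk : ¬ S.Used i k) (hl : ¬ S.Used i l) : (N : ℤ) ∣ k - l := by
  have six : ∀ T : Finset (Fin n × ZMod N), T.card = 6 → (∀ e ∈ T, e ∈ S.unusedEdges) → False := by
    intro T hT hs
    have := Set.ncard_le_ncard (s := (T : Set _)) (t := S.unusedEdges)
      (fun e he => hs e he) (Set.toFinite _)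
    rw [Set.ncard_coe_finset] at this
    omega
  have n1 : ∀ k : ℤ, ¬ (N : ℤ) ∣ k - (k + 1) := fun k =>
    not_dvd_of_lt (by omega) (by rw [show k - (k + 1) = -1 by ring]; simp; omega)
  have n2 : ∀ k : ℤ, ¬ (N : ℤ) ∣ k - (k + 2) := fun k =>
    not_dvd_of_lt (by omega) (by rw [show k - (k + 2) = -2 by ring]; simp; omega)
  -- Adjacent case: two unused segments on `i`, one at each outer end, and two on the curve through
  -- the middle vertex make six.
  have adj : ∀ k : ℤ, ¬ S.Used i k → ¬ S.Used i (k + 1) → False := by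
    intro k hk hl
    obtain ⟨a, ha⟩ := S.exists_unused_of_turn hN (Or.inl hk)
    obtain ⟨c, hc⟩ := S.exists_unused_of_turn hN (i := i) (k := k + 2)
      (Or.inr (by rwa [show k + 2 - 1 = k + 1 by ring]))
    obtain ⟨b, d, hd, hb, hbd⟩ := S.exists_unused_pair hl (by simpa using hk)
    have e1 := S.lab_ne_lab (i := i) (n1 k)
    have e2 := S.lab_ne_lab (i := i) (n2 k)
    have e3 := S.lab_ne_lab (i := i) (n1 (k + 1))
    rw [show k + 1 + 1 = k + 2 by ring] at e3
    have f1 := S.lab_ne i k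
    have f2 := S.lab_ne i (k + 1)
    have f3 := S.lab_ne i (k + 2)
    have g1 : (k : ZMod N) ≠ ((k + 1 : ℤ) : ZMod N) := fun h => n1 k (cast_eq_iff.1 h)
    have g2 : (b : ZMod N) ≠ ((b - d : ℤ) : ZMod N) := fun h => by
      have := cast_eq_iff.1 h
      rw [sub_sub_cancel] at this
      refine not_dvd_of_lt ?_ ?_ this <;> rcases hd with rfl | rfl <;> simp <;> omega
    apply six {(i, (k : ZMod N)), (i, ((k + 1 : ℤ) : ZMod N)), (S.lab i k, (a : ZMod N)),
      (S.lab i (k + 2), (c : ZMod N)), (S.lab i (k + 1), (b : ZMod N)),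
      (S.lab i (k + 1), ((b - d : ℤ) : ZMod N))}
    · simp only [Finset.card_insert_of_notMem, Prod.ext_iff, e1, e2, e3.symm, f1.symm,
        f2.symm, f3.symm, g1, g2, Finset.mem_insert, Finset.mem_singleton, false_and, and_false,
        or_self, not_false_eq_true, Finset.card_singleton]
    · intro e he
      simp only [Finset.mem_insert, Finset.mem_singleton] at he
      rcases he with rfl | rfl | rfl | rfl | rfl | rfl <;> rw [mem_unusedEdges_iff] <;> assumption
  -- Non-adjacent case: the four ends lie on four different curves, each with an unused segment,
  -- which again makes six.
  by_contra hkl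
  have h1 : ¬ (N : ℤ) ∣ k + 1 - l := fun h => adj k hk <| by
    rwa [S.used_congr h]
  have h2 : ¬ (N : ℤ) ∣ k - (l + 1) := fun h => adj l hl <| by
    rwa [← S.used_congr h]
  obtain ⟨a, ha⟩ := S.exists_unused_of_turn hN (Or.inl hk)
  obtain ⟨b, hb⟩ := S.exists_unused_of_turn hN (Or.inl hl)
  obtain ⟨c, hc⟩ := S.exists_unused_of_turn hN (i := i) (k := k + 1) (Or.inr (by simpa using hk))
  obtain ⟨d, hd⟩ := S.exists_unused_of_turn hN (i := i) (k := l + 1) (Or.inr (by simpa using hl))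
  have e1 := S.lab_ne_lab (i := i) (n1 k)
  have e2 := S.lab_ne_lab (i := i) hkl
  have e3 := S.lab_ne_lab (i := i) h2
  have e4 := S.lab_ne_lab (i := i) h1
  have e5 := S.lab_ne_lab (i := i) (k := k + 1) (l := l + 1) (by simpa using hkl)
  have e6 := S.lab_ne_lab (i := i) (n1 l)
  have f1 := S.lab_ne i k
  have f2 := S.lab_ne i (k + 1)
  have f3 := S.lab_ne i l
  have f4 := S.lab_ne i (l + 1)
  have g1 : (k : ZMod N) ≠ (l : ZMod N) := fun h => hkl (cast_eq_iff.1 h)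
  apply six {(i, (k : ZMod N)), (i, (l : ZMod N)), (S.lab i k, (a : ZMod N)),
    (S.lab i (k + 1), (c : ZMod N)), (S.lab i l, (b : ZMod N)), (S.lab i (l + 1), (d : ZMod N))}
  · simp only [Finset.card_insert_of_notMem, Prod.ext_iff, e1, e2, e3, e4, e5, e6, f1.symm,
      f2.symm, f3.symm, f4.symm, g1, Finset.mem_insert, Finset.mem_singleton, false_and, and_false,
      or_self, not_false_eq_true, Finset.card_singleton]
  · intro e he
    simp only [Finset.mem_insert, Finset.mem_singleton] at he
    rcases he with rfl | rfl | rfl | rfl | rfl | rfl <;> rw [mem_unusedEdges_iff] <;> assumption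

/-- The segment `k` of `i` is unused, and the triangles at its two ends are on the far side of
`face i k`. -/
structure IsUnusedSide (i : Fin n) (k : ℤ) : Prop where
  unused : ¬ S.Used i k
  right : S.IsTri (S.face i (k + 1 + N))
  left : S.IsTri (S.face i (k - 1 + N))

/-- Triangles alternate sides along a curve; as the number of segments of a curve is odd, the two
neighbours of the only unused segment of a curve bound triangles on the same side. -/
lemma exists_isUnusedSide [NeZero N] (hN : 3 ≤ N) (hodd : Odd N) {i : Fin n} {k : ℤ}
    (hk : ¬ S.Used i k) (huniq : ∀ l, ¬ S.Used i l → (N : ℤ) ∣ l - k) :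
    ∃ l, S.IsUnusedSide i l := by
  have main : ∀ l : ℤ, (N : ℤ) ∣ l - k → S.IsTri (S.face i (l + 1 + N)) → S.IsUnusedSide i l := by
    intro l hl ht
    -- The triangle changes side at each of the used segments `l + 1, …, l + N - 1`; the side is
    -- recorded by the multiple of `N`. Since `N - 1` is even, the last one, which is the left
    -- neighbour of `l`, has its triangle on the far side too.
    have step : ∀ r : ℕ, r + 2 ≤ N →
        S.IsTri (S.face i (l + (r + 1 : ℕ) + (r + 1 : ℕ) * N)) := by
      intro r
      induction r with
      | zero => intro _; simpa using ht
      | succ r ih =>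
        intro hr
        have h1 := ih (by omega)
        have h2 := S.not_isTri_succ hN h1
        have h3 : S.Used i (l + (r + 1 : ℕ) + (r + 1 : ℕ) * N + 1) := by
          by_contra hu
          have h4 : (N : ℤ) ∣ (r + 2 : ℕ) := by
            obtain ⟨x, hx⟩ := hl
            obtain ⟨y, hy⟩ := huniq _ hu
            refine ⟨y - x - (r + 1), ?_⟩
            push_cast at hy ⊢
            linear_combination hy - hx
          have := Nat.le_of_dvd (by omega) (Int.natCast_dvd_natCast.1 h4)
          omega
        rcases h3 with h3 | h3
        · exact absurd h3 h2
        · convert h3 using 2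
          push_cast
          ring
    refine ⟨by rwa [S.used_congr hl], ht, ?_⟩
    obtain ⟨m, hm⟩ := hodd
    have h := step (N - 2) (by omega)
    rw [show N - 2 + 1 = 2 * m by omega] at h
    rw [← S.face_add_mul i (l - 1 + N) m]
    convert h using 2
    rw [hm]; push_cast; ring
  have h1 : S.Used i (k + 1) := by
    by_contra hu
    have := huniq _ hu
    rw [add_sub_cancel_left] at this
    exact not_dvd_of_lt (by omega) (by simp; omega) this
  -- The lift `k` or `k + N` is chosen so that the triangle at the right neighbour is on the far
  -- side.
  rcases h1 with h1 | h1
  · refine ⟨k + N, main _ (by simp) ?_⟩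
    rwa [show k + N + 1 + N = k + 1 + N + N by ring, S.face_add_add]
  · exact ⟨k, main _ (by simp) h1⟩

variable {S} in
/-- The face on the unused side of an unused segment is also on the unused side of the next
unused segments. -/
lemma IsUnusedSide.next [NeZero N] (hN : 3 ≤ N)
    (huniq : ∀ i k l, ¬ S.Used i k → ¬ S.Used i l → (N : ℤ) ∣ k - l) {κ : Fin n → ℤ}
    (hκ : ∀ i k, ¬ S.Used i k → S.IsUnusedSide i (κ i)) {i : Fin n} (h : S.IsUnusedSide i (κ i))
    {j : Fin n} (hj : j = S.lab i (κ i) ∨ j = S.lab i (κ i + 1)) :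
    S.IsUnusedSide j (κ j) ∧ S.face j (κ j) = S.face i (κ i) ∧
      (i = S.lab j (κ j) ∨ i = S.lab j (κ j + 1)) := by
  have u1 : ¬ S.IsTri (S.face i (κ i)) := fun h' => h.unused (Or.inl h')
  have concl : ∀ b d : ℤ, ((d = 1 ∧ S.lab j b = i) ∨ (d = -1 ∧ S.lab j (b + 1) = i)) →
      ¬ S.Used j b → S.IsTri (S.face j (b - d + N)) → S.face j b = S.face i (κ i) →
      S.IsUnusedSide j (κ j) ∧ S.face j (κ j) = S.face i (κ i) ∧
      (i = S.lab j (κ j) ∨ i = S.lab j (κ j + 1)) := by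
    intro b d hd hu ht hf
    have hn := hκ j b hu
    have hdvd := huniq j _ _ hn.unused hu
    refine ⟨hn, ?_, ?_⟩
    · rw [← hf]
      obtain ⟨q, hq⟩ := hdvd
      obtain ⟨z, hz | hz⟩ := Int.even_or_odd' q
      · rw [← S.face_add_mul j b z]; congr 1; subst hz; linarith
      -- An odd quotient would put triangles on both sides of the neighbouring segment `b - d`.
      · exfalso
        have h1 : S.IsTri (S.face j (κ j - d + N)) := by
          rcases hd with ⟨rfl, -⟩ | ⟨rfl, -⟩
          · exact hn.left
          · rw [sub_neg_eq_add]; exact hn.right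
        have e : S.face j (κ j - d + N) = S.face j (b - d) := by
          rw [← S.face_add_mul j (b - d) (z + 1)]; congr 1; subst hz; linarith
        rw [e] at h1
        exact S.not_isTri_add hN h1 ht
    · have e1 := S.lab_congr (i := j) hdvd
      have e2 := S.lab_congr (i := j) (k := κ j + 1) (l := b + 1) (by simpa using hdvd)
      rw [e1, e2]
      exact hd.imp (fun h => h.2.symm) (fun h => h.2.symm)
  -- The crossing segment separates the common face, not a triangle, from a face that lies opposite
  -- a triangle across a segment of `i`, hence is not a triangle either. So it is unused.
  rcases hj with rfl | rfl
  · obtain ⟨b, d, hd, h1, h2, h3, h4⟩ := S.vertex i (κ i)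
    refine concl b d hd ?_ (h4 ▸ h.left) h1
    rw [Used, h1, h2]
    rintro (h' | h')
    · exact u1 h'
    · exact S.not_isTri_add hN h' h.left
  · obtain ⟨b, d, hd, h1, h2, h3, h4⟩ := S.vertex i (κ i + 1)
    rw [add_sub_cancel_right] at h2 h4
    -- At the right end the common face precedes the vertex, so it is on the positive side of the
    -- lift `b + N`.
    refine concl (b + N) d ?_ ?_ ?_ h2
    · rwa [show b + N + 1 = b + 1 + N by ring, S.lab_add, S.lab_add]
    · rw [S.used_congr (l := b) (by simp), Used, h1, h2]
      rintro (h' | h')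
      · exact S.not_isTri_add hN h' h.right
      · exact u1 h'
    · rw [show b + N - d + N = b - d + N + N by ring, S.face_add_add, h3]
      exact h.right

end SideSystem

/-! ### Two-regular graphs on five vertices -/

/-- In a `2`-regular graph on five vertices, a nonempty set closed under neighbours is everything. -/
lemma eq_of_closed_of_twoRegular {V : Type*} [Finite V] {U : Set V} (hU : U.ncard = 5)
    {p q : V → V} (hpq : ∀ i ∈ U, p i ≠ q i) (hpi : ∀ i ∈ U, p i ≠ i) (hqi : ∀ i ∈ U, q i ≠ i)
    (hp : ∀ i ∈ U, p i ∈ U ∧ (i = p (p i) ∨ i = q (p i)))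
    (hq : ∀ i ∈ U, q i ∈ U ∧ (i = p (q i) ∨ i = q (q i))) {C : Set V} (hCU : C ⊆ U)
    (hne : C.Nonempty) (hC : ∀ i ∈ C, p i ∈ C ∧ q i ∈ C) : C = U := by
  -- A closed part contains a vertex with its two neighbours. By symmetry the complement is closed
  -- as well, and `3 + 3 > 5`.
  have three : ∀ D ⊆ U, D.Nonempty → (∀ i ∈ D, p i ∈ D ∧ q i ∈ D) → 3 ≤ D.ncard := by
    classical
    rintro D hD ⟨i, hi⟩ hcl
    have hsub : (({i, p i, q i} : Finset V) : Set V) ⊆ D := by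
      intro x hx
      simp only [Finset.coe_insert, Finset.coe_singleton, Set.mem_insert_iff,
        Set.mem_singleton_iff] at hx
      rcases hx with rfl | rfl | rfl
      exacts [hi, (hcl i hi).1, (hcl i hi).2]
    have := Set.ncard_le_ncard hsub (Set.toFinite _)
    rw [Set.ncard_coe_finset] at this
    simpa [Finset.card_insert_of_notMem, (hpi i (hD hi)).symm, (hqi i (hD hi)).symm,
      hpq i (hD hi)] using this
  by_contra hCne
  have hne' : (U \ C).Nonempty := by
    rw [Set.sdiff_nonempty]
    exact fun h => hCne (hCU.antisymm h)
  have h1 := three C hCU hne hC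
  have h2 := three (U \ C) Set.sdiff_subset hne' (by
    rintro i ⟨hi, hiC⟩
    refine ⟨⟨(hp i hi).1, fun h => hiC ?_⟩, ⟨(hq i hi).1, fun h => hiC ?_⟩⟩
    · rcases (hp i hi).2 with h' | h' <;> rw [h']
      exacts [(hC _ h).1, (hC _ h).2]
    · rcases (hq i hi).2 with h' | h' <;> rw [h']
      exacts [(hC _ h).1, (hC _ h).2])
  have := Set.ncard_sdiff_add_ncard_of_subset hCU (Set.toFinite _)
  omega

/-- A `2`-regular graph on five vertices is a cycle. -/
lemma exists_pentagon_of_twoRegular {V : Type*} [Finite V] {U : Set V} (hU : U.ncard = 5)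
    {p q : V → V} (hpq : ∀ i ∈ U, p i ≠ q i) (hpi : ∀ i ∈ U, p i ≠ i) (hqi : ∀ i ∈ U, q i ≠ i)
    (hp : ∀ i ∈ U, p i ∈ U ∧ (i = p (p i) ∨ i = q (p i)))
    (hq : ∀ i ∈ U, q i ∈ U ∧ (i = p (q i) ∨ i = q (q i))) :
    ∃ c : Fin 5 → V, Function.Injective c ∧ Set.range c = U ∧
      ∀ x, (p (c x) = c (x - 1) ∧ q (c x) = c (x + 1)) ∨
        (p (c x) = c (x + 1) ∧ q (c x) = c (x - 1)) := by
  classical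
  -- The path `e, a, b` is prolonged by `d` and `c` at its two ends; closing up too early would
  -- produce a closed set of at most four vertices.
  have closed : ∀ D : Finset V, D.Nonempty → D.card ≤ 4 → ↑D ⊆ U →
      (∀ i ∈ D, p i ∈ D ∧ q i ∈ D) → False := by
    intro D hD h4 hDU hcl
    have := eq_of_closed_of_twoRegular hU hpq hpi hqi hp hq hDU (by simpa using hD)
      (by simpa using hcl)
    rw [← this, Set.ncard_coe_finset] at hU
    omega
  obtain ⟨a, ha⟩ : U.Nonempty := by
    rw [Set.nonempty_iff_ne_empty]; rintro rfl; simp at hU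
  obtain ⟨R, hR⟩ : ∃ R : V → V → Prop, ∀ i j, R i j ↔ j = p i ∨ j = q i := ⟨_, fun _ _ => Iff.rfl⟩
  have other : ∀ u v, v ∈ U → R v u → ∃ w ∈ U, w ≠ u ∧ w ≠ v ∧ ∀ j, R v j ↔ j = u ∨ j = w := by
    intro u v hv h
    rcases (hR _ _).1 h with rfl | rfl
    · exact ⟨q v, (hq v hv).1, (hpq v hv).symm, hqi v hv, fun j => hR _ _⟩
    · exact ⟨p v, (hp v hv).1, hpq v hv, hpi v hv, fun j => (hR _ _).trans or_comm⟩
  have sym : ∀ u v, u ∈ U → R u v → R v u := by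
    intro u v hu h
    rw [hR] at h ⊢
    rcases h with rfl | rfl
    · exact (hp u hu).2
    · exact (hq u hu).2
  have closed' : ∀ D : Finset V, D.Nonempty → D.card ≤ 4 → ↑D ⊆ U →
      (∀ i ∈ D, ∀ j, R i j → j ∈ D) → False := fun D h1 h2 h3 h4 => closed D h1 h2 h3 fun i hi =>
    ⟨h4 i hi _ ((hR _ _).2 (Or.inl rfl)), h4 i hi _ ((hR _ _).2 (Or.inr rfl))⟩
  have hmem : ∀ u v, u ∈ U → R u v → v ∈ U := by
    intro u v hu h
    rcases (hR _ _).1 h with rfl | rfl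
    exacts [(hp u hu).1, (hq u hu).1]
  obtain ⟨b, hab, hba⟩ : ∃ b, R a b ∧ b ≠ a := ⟨q a, (hR _ _).2 (Or.inr rfl), hqi a ha⟩
  obtain ⟨e, he, heb, hea, haR⟩ := other b a ha hab
  have hb := hmem a b ha hab
  obtain ⟨c, hc, hca, hcb, hbR⟩ := other a b hb (sym a b ha hab)
  obtain ⟨d, hd, hda, hde, heR⟩ := other a e he (sym a e ha ((haR e).2 (Or.inr rfl)))
  have hcR := sym b c hb ((hbR c).2 (Or.inr rfl))
  have hdR := sym e d he ((heR d).2 (Or.inr rfl))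
  have hce : c ≠ e := by
    rintro rfl
    have h2 : b = d := ((heR b).1 hcR).resolve_left hba
    apply closed' {a, b, c} (by simp) (le_trans Finset.card_le_three (by omega))
    · intro x hx
      simp only [Finset.coe_insert, Finset.coe_singleton, Set.mem_insert_iff,
        Set.mem_singleton_iff] at hx
      rcases hx with rfl | rfl | rfl <;> assumption
    · intro x hx j hj
      simp only [Finset.mem_insert, Finset.mem_singleton] at hx ⊢
      rcases hx with rfl | rfl | rfl
      · have := (haR j).1 hj; tauto
      · have := (hbR j).1 hj; tauto
      · have := (heR j).1 hj; rw [← h2] at this; tauto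
  have hdb : d ≠ b := by
    rintro rfl
    exact (((hbR e).1 hdR).resolve_left hea) |> fun h => hce h.symm
  have hcd : c ≠ d := by
    rintro rfl
    obtain ⟨w, -, -, -, hw⟩ := other b c hc hcR
    have hwe : e = w := ((hw e).1 hdR).resolve_left heb
    apply closed' {a, b, c, e} (by simp) Finset.card_le_four
    · intro x hx
      simp only [Finset.coe_insert, Finset.coe_singleton, Set.mem_insert_iff,
        Set.mem_singleton_iff] at hx
      rcases hx with rfl | rfl | rfl | rfl <;> assumption
    · intro x hx j hj
      simp only [Finset.mem_insert, Finset.mem_singleton] at hx ⊢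
      rcases hx with rfl | rfl | rfl | rfl
      · have := (haR j).1 hj; tauto
      · have := (hbR j).1 hj; tauto
      · have := (hw j).1 hj; rw [← hwe] at this; tauto
      · have := (heR j).1 hj; tauto
  have hnd : [a, b, c, d, e].Nodup := by
    simp only [List.nodup_cons, List.mem_cons, List.not_mem_nil, or_false, not_or,
      not_false_eq_true, List.nodup_nil, and_true]
    exact ⟨⟨hba.symm, hca.symm, hda.symm, hea.symm⟩, ⟨hcb.symm, hdb.symm, heb.symm⟩,
      ⟨hcd, hce⟩, hde⟩
  have hinj : Function.Injective ![a, b, c, d, e] := List.nodup_ofFn.1 (by simpa using hnd)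
  have hrange : Set.range ![a, b, c, d, e] = U := by
    apply Set.eq_of_subset_of_ncard_le _ _ (Set.toFinite _)
    · rintro _ ⟨x, rfl⟩
      fin_cases x <;> assumption
    · rw [hU, ← Set.image_univ, Set.ncard_image_of_injective _ hinj]
      simp
  obtain ⟨x, hx, hxb, hxc, hcx⟩ := other b c hc hcR
  have hxR := sym c x hc ((hcx x).2 (Or.inr rfl))
  have hxd : x = d := by
    rw [← hrange] at hx
    obtain ⟨y, hy⟩ := hx
    fin_cases y
    · have hy : a = x := hy
      rw [← hy, haR] at hxR
      tauto
    · exact absurd hy.symm hxb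
    · exact absurd hy.symm hxc
    · exact hy.symm
    · have hy : e = x := hy
      rw [← hy, heR] at hxR
      tauto
  subst hxd
  obtain ⟨y, -, -, -, hy⟩ := other c x hd hxR
  have hye : e = y := ((hy e).1 hdR).resolve_left hce.symm
  subst hye
  have fin : ∀ v ∈ U, ∀ s t, (∀ j, R v j ↔ j = s ∨ j = t) →
      (p v = s ∧ q v = t) ∨ (p v = t ∧ q v = s) := by
    intro v hv s t h
    have h1 := (h (p v)).1 ((hR _ _).2 (Or.inl rfl))
    have h2 := (h (q v)).1 ((hR _ _).2 (Or.inr rfl))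
    rcases h1 with h1 | h1 <;> rcases h2 with h2 | h2
    · exact absurd (h1.trans h2.symm) (hpq v hv)
    · exact Or.inl ⟨h1, h2⟩
    · exact Or.inr ⟨h1, h2⟩
    · exact absurd (h1.trans h2.symm) (hpq v hv)
  refine ⟨![a, b, c, x, e], hinj, hrange, ?_⟩
  intro y
  fin_cases y
  · exact (fin a ha b e haR).symm
  · exact fin b hb a c hbR
  · exact fin c hc b x hcx
  · exact fin x hd c e hy
  · exact (fin e he a x heR).symm

/-! ### The quadratic form of the pentagon -/

/-- A quadratic function on `𝔽₂⁵` that is invariant under the addition of `(1, 1, 1, 1, 1)`. -/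
def pentagonForm (g : Fin 5 → ZMod 2) : ZMod 2 := ∑ x, (g x + g x * g (x + 1))

lemma pentagonForm_eq (g : Fin 5 → ZMod 2) : pentagonForm g = g 0 + g 0 * g 1 + (g 1 + g 1 * g 2) +
    (g 2 + g 2 * g 3) + (g 3 + g 3 * g 4) + (g 4 + g 4 * g 0) := by
  simp only [pentagonForm, Fin.sum_univ_five]
  rfl

/-- For `c = 1` the linear and the quadratic part each change by five modulo 2. The form thus
ignores the simultaneous change of all signs across the reference curve. -/
lemma pentagonForm_add_const (g : Fin 5 → ZMod 2) (c : ZMod 2) :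
    pentagonForm (fun x => g x + c) = pentagonForm g := by
  simp only [pentagonForm_eq]
  have h : ∀ c a0 a1 a2 a3 a4 : ZMod 2, a0 + c + (a0 + c) * (a1 + c) +
      (a1 + c + (a1 + c) * (a2 + c)) + (a2 + c + (a2 + c) * (a3 + c)) +
      (a3 + c + (a3 + c) * (a4 + c)) + (a4 + c + (a4 + c) * (a0 + c)) =
      a0 + a0 * a1 + (a1 + a1 * a2) + (a2 + a2 * a3) + (a3 + a3 * a4) + (a4 + a4 * a0) := by
    decide
  exact h _ _ _ _ _ _

/-- The effect of crossing the curve `y`: it depends only on the signs of the two neighbours of `y`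
in the cycle. -/
lemma pentagonForm_add_single (g : Fin 5 → ZMod 2) (y : Fin 5) :
    pentagonForm (fun x => g x + if y = x then 1 else 0) =
      pentagonForm g + 1 + (g (y - 1) + g (y + 1)) := by
  simp only [pentagonForm_eq]
  have h : ∀ u a b : ZMod 2, u + 1 + (a + b) = u + (1 + a + b) := by decide
  rw [h]
  fin_cases y
  · show _ = _ + (1 + g 4 + g 1)
    simp; ring
  · show _ = _ + (1 + g 0 + g 2)
    simp; ring
  · show _ = _ + (1 + g 1 + g 3)
    simp; ring
  · show _ = _ + (1 + g 2 + g 4)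
    simp; ring
  · show _ = _ + (1 + g 3 + g 0)
    simp; ring

/-! ### Side functions and the pentagonal face -/

namespace SideSystem

variable {n N : ℕ} {F : Type*} (S : SideSystem n N F)

/-- Any two of the curves separate the faces: there is a function to `ZMod 2` that can only change
across these two curves, and changes across one of them. -/
def Separating : Prop := ∀ o i : Fin n, o ≠ i → ∃ s : F → ZMod 2,
  (∀ m k, m ≠ o → m ≠ i → s (S.face m (k + N)) = s (S.face m k)) ∧
  ∀ k, s (S.face i (k + N)) = s (S.face i k) + 1

lemma zmod_two_add_self (a : ZMod 2) : a + a = 0 := CharTwo.add_self_eq_zero a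

/-- Relatively to a curve `o`, the curves have sign functions on the faces: up to simultaneous
changes across `o`, each of them changes exactly across the given curve. -/
lemma exists_signs (hS : S.Separating) (o : Fin n) : ∃ s : Fin n → F → ZMod 2, ∀ i m k,
    s i (S.face m (k + N)) =
      s i (S.face m k) + ((if m = i then 1 else 0) + if m = o then 1 else 0) := by
  have key : ∀ i, ∃ s : F → ZMod 2, ∀ m k, s (S.face m (k + N)) =
      s (S.face m k) + ((if m = i then 1 else 0) + if m = o then 1 else 0) := by
    intro i
    by_cases hi : i = o
    · subst hi
      exact ⟨fun _ => 0, fun m k => by split_ifs <;> simp [zmod_two_add_self]⟩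
    obtain ⟨s, hs, hsi⟩ := hS o i (Ne.symm hi)
    refine ⟨s, ?_⟩
    have hdiff : ∀ j, j ≠ o → ∀ k l, s (S.face j (k + N)) + s (S.face j k) =
        s (S.face j (l + N)) + s (S.face j l) := by
      intro j hj k l
      by_cases hji : j = i
      · subst hji
        rw [hsi, hsi, add_right_comm, zmod_two_add_self, add_right_comm, zmod_two_add_self]
      · rw [hs j k hj hji, hs j l hj hji, zmod_two_add_self, zmod_two_add_self]
    -- Going around a vertex of `o`: the jump across the crossing curve is the same on its two
    -- segments, so the jump across `o` is the same before and after the vertex.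
    have hJ : ∀ k, s (S.face o (k - 1 + N)) + s (S.face o (k - 1)) =
        s (S.face o (k + N)) + s (S.face o k) := by
      intro k
      obtain ⟨b, d, -, h1, h2, h3, h4⟩ := S.vertex o k
      have := hdiff _ (S.lab_ne o k) b (b - d)
      rw [h1, h2, h3, h4] at this
      generalize s (S.face o (k - 1 + N)) = x at *
      generalize s (S.face o (k - 1)) = y at *
      generalize s (S.face o (k + N)) = z at *
      generalize s (S.face o k) = w at *
      revert x y z w; decide
    have hJ' : ∀ k, s (S.face o (k + N)) + s (S.face o k) =
        s (S.face o (0 + N)) + s (S.face o 0) := by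
      intro k
      induction k using Int.induction_on with
      | zero => rfl
      | succ k ih => rw [← ih, ← hJ, add_sub_cancel_right]
      | pred k ih => rw [← ih, hJ]
    -- One-sidedness of `i`: if only `i` changed `s`, walking along `i` from segment 0 to segment
    -- `N` would preserve `s` but end on the other side of the starting segment.
    have h1 : s (S.face o (0 + N)) + s (S.face o 0) = 1 := by
      by_contra h
      have h0 : s (S.face o (0 + N)) + s (S.face o 0) = 0 := by
        generalize s (S.face o (0 + N)) + s (S.face o 0) = x at h
        revert x; decide
      have hconst : ∀ k, s (S.face i k) = s (S.face i (k - 1)) := by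
        intro k
        obtain ⟨b, d, -, h1, h2, -⟩ := S.vertex i k
        rw [← h1, ← h2]
        by_cases hj : S.lab i k = o
        · have := (hJ' b).trans h0
          rw [hj]
          generalize s (S.face o (b + N)) = x at *
          generalize s (S.face o b) = y at *
          revert x y; decide
        · rw [hs _ _ hj (S.lab_ne i k)]
      have hconst' : ∀ r : ℕ, s (S.face i (0 + r)) = s (S.face i 0) := by
        intro r
        induction r with
        | zero => simp
        | succ r ih => rw [← ih, hconst]; push_cast; congr 2; ring
      have := hsi 0
      rw [hconst'] at this
      clear hconst hconst'
      generalize s (S.face i 0) = x at this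
      revert x; decide
    intro m k
    by_cases hmo : m = o
    · subst hmo
      have := (hJ' k).trans h1
      rw [if_neg (Ne.symm hi), if_pos rfl]
      generalize s (S.face m (k + N)) = x at *
      generalize s (S.face m k) = y at *
      revert x y; decide
    · by_cases hmi : m = i
      · subst hmi; simp [hsi, hmo]
      · simp [hs m k hmo hmi, hmo, hmi]
  choose s hs using key
  exact ⟨s, hs⟩

/-- If there are exactly five unused segments, they are the edges of a face. -/
theorem exists_pentagon [NeZero N] (hN : 3 ≤ N) (hodd : Odd N) (hS : S.Separating)
    (h5 : S.unusedEdges.ncard = 5) : ∃ i k, S.edges (S.face i k) = S.unusedEdges := by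
  classical
  have huniq : ∀ i k l, ¬ S.Used i k → ¬ S.Used i l → (N : ℤ) ∣ k - l :=
    fun i k l => S.unused_unique hN h5
  have hex : ∀ i, ∃ k, (∃ l, ¬ S.Used i l) → S.IsUnusedSide i k := by
    intro i
    by_cases h : ∃ l, ¬ S.Used i l
    · obtain ⟨l, hl⟩ := h
      obtain ⟨k, hk⟩ := S.exists_isUnusedSide hN hodd hl (fun m hm => huniq i m l hm hl)
      exact ⟨k, fun _ => hk⟩
    · exact ⟨0, fun h' => absurd h' h⟩
  choose κ hκ' using hex
  have hκ : ∀ i k, ¬ S.Used i k → S.IsUnusedSide i (κ i) := fun i k hk => hκ' i ⟨k, hk⟩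
  have hnext := fun i (hi : S.IsUnusedSide i (κ i)) j hj =>
    IsUnusedSide.next (j := j) hN huniq hκ hi hj
  set U : Set (Fin n) := {i | S.IsUnusedSide i (κ i)} with hUdef
  have hUe : S.unusedEdges = (fun i => (i, ((κ i : ℤ) : ZMod N))) '' U := by
    ext ⟨i, c⟩
    obtain ⟨k, rfl⟩ := ZMod.intCast_surjective c
    rw [mem_unusedEdges_iff]
    constructor
    · intro h
      refine ⟨i, hκ i k h, ?_⟩
      rw [Prod.mk.injEq, cast_eq_iff]
      exact ⟨rfl, huniq i _ _ (hκ i k h).unused h⟩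
    · rintro ⟨j, hj, h⟩
      rw [Prod.mk.injEq, cast_eq_iff] at h
      obtain ⟨rfl, h⟩ := h
      rw [← S.used_congr h]
      exact hj.unused
  have hU5 : U.ncard = 5 := by
    rw [← h5, hUe, Set.ncard_image_of_injective]
    intro i j h
    exact (Prod.ext_iff.1 h).1
  have n1 : ∀ k : ℤ, ¬ (N : ℤ) ∣ k - (k + 1) := fun k =>
    not_dvd_of_lt (by omega) (by rw [show k - (k + 1) = -1 by ring]; simp; omega)
  have hpq : ∀ i ∈ U, S.lab i (κ i) ≠ S.lab i (κ i + 1) := fun i _ => S.lab_ne_lab (n1 _)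
  have hpi : ∀ i ∈ U, S.lab i (κ i) ≠ i := fun i _ => S.lab_ne _ _
  have hqi : ∀ i ∈ U, S.lab i (κ i + 1) ≠ i := fun i _ => S.lab_ne _ _
  have hp := fun i (hi : i ∈ U) => hnext i hi _ (Or.inl rfl)
  have hq := fun i (hi : i ∈ U) => hnext i hi _ (Or.inr rfl)
  have hp' : ∀ i ∈ U, S.lab i (κ i) ∈ U ∧ _ := fun i hi => ⟨(hp i hi).1, (hp i hi).2.2⟩
  have hq' : ∀ i ∈ U, S.lab i (κ i + 1) ∈ U ∧ _ := fun i hi => ⟨(hq i hi).1, (hq i hi).2.2⟩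
  obtain ⟨i₀, hi₀⟩ : U.Nonempty := by
    rw [Set.nonempty_iff_ne_empty]; intro h; simp [h] at hU5
  obtain ⟨X, hX⟩ : ∃ X, X = S.face i₀ (κ i₀) := ⟨_, rfl⟩
  -- The curves of `U` whose unused segment borders `X` are closed under neighbours, hence are all
  -- of `U`.
  have hface : ∀ i ∈ U, S.face i (κ i) = X := by
    have : {i ∈ U | S.face i (κ i) = X} = U := by
      refine eq_of_closed_of_twoRegular (p := fun i => S.lab i (κ i))
        (q := fun i => S.lab i (κ i + 1)) hU5 hpq hpi hqi hp' hq' (Set.sep_subset _ _)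
        ⟨i₀, hi₀, hX.symm⟩ ?_
      rintro i ⟨hi, hiX⟩
      exact ⟨⟨(hp i hi).1, (hp i hi).2.1.trans hiX⟩, ⟨(hq i hi).1, (hq i hi).2.1.trans hiX⟩⟩
    intro i hi
    rw [← this] at hi
    exact hi.2
  obtain ⟨c, hcinj, hcr, hcn⟩ := exists_pentagon_of_twoRegular (p := fun i => S.lab i (κ i))
    (q := fun i => S.lab i (κ i + 1)) hU5 hpq hpi hqi hp' hq'
  obtain ⟨s, hs⟩ := S.exists_signs hS i₀
  -- The signs relative to `i₀`, normalized to vanish at `X`.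
  obtain ⟨g, hg⟩ : ∃ g : Fin n → F → ZMod 2, ∀ i Y, g i Y = s i Y + s i X := ⟨_, fun _ _ => rfl⟩
  have hgX : ∀ i, g i X = 0 := fun i => by rw [hg, zmod_two_add_self]
  have hgj : ∀ i m k, g i (S.face m (k + N)) =
      g i (S.face m k) + ((if m = i then 1 else 0) + if m = i₀ then 1 else 0) := by
    intro i m k
    rw [hg, hg, hs]; ring
  obtain ⟨Q, hQ⟩ : ∃ Q : F → ZMod 2, ∀ Y, Q Y = pentagonForm (fun x => g (c x) Y) :=
    ⟨_, fun _ => rfl⟩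
  have hQX : Q X = 0 := by
    rw [hQ]; simp [hgX, pentagonForm]
  have g2 : ∀ m k, m ∈ U → g (S.lab m (κ m)) (S.face m (k + N)) +
      g (S.lab m (κ m + 1)) (S.face m (k + N)) =
      g (S.lab m (κ m)) (S.face m k) + g (S.lab m (κ m + 1)) (S.face m k) := by
    intro m k hm
    rw [hgj, hgj, if_neg (hpi m hm).symm, if_neg (hqi m hm).symm]
    generalize (if m = i₀ then (1 : ZMod 2) else 0) = z
    generalize g (S.lab m (κ m)) (S.face m k) = x
    generalize g (S.lab m (κ m + 1)) (S.face m k) = y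
    revert x y z; decide
  -- the sign of the two neighbours of `m ∈ U` along `m`
  have hδ : ∀ m ∈ U, ∀ r : ℕ, r + 1 < N → g (S.lab m (κ m)) (S.face m (κ m + 1 + r)) +
      g (S.lab m (κ m + 1)) (S.face m (κ m + 1 + r)) = 1 := by
    intro m hm r
    -- Along `m`, the sum of the two neighbours' signs changes only at the crossings with these
    -- neighbours, the two ends of the unused segment. It is 0 on that segment, where the face is
    -- `X`, hence 1 on the rest of `m`.
    have step : ∀ k, g (S.lab m (κ m)) (S.face m (k - 1)) +
      g (S.lab m (κ m + 1)) (S.face m (k - 1)) = g (S.lab m (κ m)) (S.face m k) +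
      g (S.lab m (κ m + 1)) (S.face m k) + ((if S.lab m k = S.lab m (κ m) then 1 else 0) +
        if S.lab m k = S.lab m (κ m + 1) then 1 else 0) := by
      intro k
      obtain ⟨b, d, -, h1, h2, -⟩ := S.vertex m k
      rw [← h1, ← h2, hgj, hgj]
      generalize (if S.lab m k = i₀ then (1 : ZMod 2) else 0) = z
      generalize (if S.lab m k = S.lab m (κ m) then (1 : ZMod 2) else 0) = u
      generalize (if S.lab m k = S.lab m (κ m + 1) then (1 : ZMod 2) else 0) = v
      generalize g (S.lab m (κ m)) _ = x
      generalize g (S.lab m (κ m + 1)) _ = y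
      revert x y z u v; decide
    induction r with
    | zero =>
      intro _
      have := step (κ m + 1)
      rw [add_sub_cancel_right, hface m hm, hgX, hgX, if_neg (hpq m hm).symm, if_pos rfl] at this
      simp only [Nat.cast_zero, add_zero]
      generalize g (S.lab m (κ m)) _ = x at *
      generalize g (S.lab m (κ m + 1)) _ = y at *
      revert x y; decide
    | succ r ih =>
      intro hr
      rw [← ih (by omega)]
      have := step (κ m + 1 + (r + 1 : ℕ))
      rw [if_neg (S.lab_ne_lab (not_dvd_of_lt (by push_cast; omega)
        (by push_cast; rw [abs_lt]; omega))), if_neg (S.lab_ne_lab (not_dvd_of_lt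
        (by push_cast; omega) (by push_cast; rw [abs_lt]; omega))), add_zero, add_zero] at this
      rw [← this]
      congr <;> push_cast <;> ring
  have hδ' : ∀ m ∈ U, ∀ k, g (S.lab m (κ m)) (S.face m k) +
      g (S.lab m (κ m + 1)) (S.face m k) = if S.Used m k then 1 else 0 := by
    intro m hm k
    have hU : ∀ l : ℤ, S.Used m l ↔ ¬ (N : ℤ) ∣ l - κ m := by
      intro l
      constructor
      · intro h h'
        rw [S.used_congr h'] at h
        exact hm.unused h
      · intro h
        by_contra hu
        exact h (huniq m _ _ hu hm.unused)
    have per : ∀ l l', (N : ℤ) ∣ l - l' → g (S.lab m (κ m)) (S.face m l) +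
      g (S.lab m (κ m + 1)) (S.face m l) = g (S.lab m (κ m)) (S.face m l') +
      g (S.lab m (κ m + 1)) (S.face m l') := by
      intro l l' h
      rcases S.face_of_dvd (i := m) h with h | h
      · rw [h.1]
      · rw [h.1, g2 m l' hm]
    split_ifs with h
    · rw [hU] at h
      have hNpos : (0 : ℤ) < N := by omega
      have hr0 := Int.emod_nonneg (k - κ m) hNpos.ne'
      have hr1 := Int.emod_lt_of_pos (k - κ m) hNpos
      have hr2 : (k - κ m) % N ≠ 0 := fun h' => h (Int.dvd_of_emod_eq_zero h')
      rw [← hδ m hm ((k - κ m) % N - 1).toNat (by omega)]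
      apply per
      rw [Int.toNat_of_nonneg (by omega)]
      rw [show k - (κ m + 1 + ((k - κ m) % N - 1)) = (k - κ m) - (k - κ m) % N by ring]
      exact Int.dvd_self_sub_emod
    · rw [hU, not_not] at h
      rw [per k (κ m) h, hface m hm, hgX, hgX, add_zero]
  -- Across `m ∈ U` the form changes by one plus the sum computed in `hδ'`, up to a constant added
  -- to all signs; across any other curve only such a constant occurs.
  have hQj : ∀ m k, Q (S.face m (k + N)) = Q (S.face m k) + if S.Used m k then 0 else 1 := by
    intro m k
    simp only [hQ, hgj]
    by_cases hm : m ∈ U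
    · obtain ⟨x, rfl⟩ : m ∈ Set.range c := hcr ▸ hm
      simp_rw [← add_assoc]
      rw [pentagonForm_add_const]
      simp only [hcinj.eq_iff]
      rw [pentagonForm_add_single (fun y => g (c y) (S.face (c x) k))]
      have h1 := hδ' (c x) hm k
      have h2 : g (c (x - 1)) (S.face (c x) k) + g (c (x + 1)) (S.face (c x) k) =
          if S.Used (c x) k then 1 else 0 := by
        rw [← h1]
        rcases hcn x with h | h
        · rw [← h.1, ← h.2]
        · rw [← h.1, ← h.2, add_comm]
      rw [h2]
      split_ifs
      · rw [add_assoc, zmod_two_add_self]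
      · ring
    · have hne : ∀ x, m ≠ c x := by
        rintro x rfl
        exact hm (hcr ▸ ⟨x, rfl⟩)
      have hu : S.Used m k := by
        by_contra hu
        exact hm (hκ m k hu)
      simp only [hne, if_false, zero_add, hu, if_true, add_zero]
      exact pentagonForm_add_const _ _
  -- An unused segment ends on its neighbours in `U`, and there at an end of their own unused
  -- segments. So passing any other vertex along a curve leaves `Q` unchanged.
  have hbranch : ∀ m k (b d : ℤ), ((d = 1 ∧ S.lab (S.lab m k) b = m) ∨
      (d = -1 ∧ S.lab (S.lab m k) (b + 1) = m)) → ¬ S.Used (S.lab m k) b →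
      m ∈ U ∧ ((N : ℤ) ∣ k - κ m ∨ (N : ℤ) ∣ k - (κ m + 1)) := by
    intro m k b d hd hu
    have hj := hκ _ _ hu
    have hdvd := huniq _ _ _ hu hj.unused
    have hm := hnext _ hj m <| by
      rcases hd with hd | hd
      · exact Or.inl (hd.2.symm.trans (S.lab_congr hdvd))
      · exact Or.inr (hd.2.symm.trans (S.lab_congr (by rwa [add_sub_add_right_eq_sub])))
    refine ⟨hm.1, ?_⟩
    exact hm.2.2.imp (S.lab_eq_iff _ _ _).1 (S.lab_eq_iff _ _ _).1
  have hstep : ∀ m k, (m ∈ U → ¬ (N : ℤ) ∣ k - κ m ∧ ¬ (N : ℤ) ∣ k - (κ m + 1)) →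
      Q (S.face m (k - 1)) = Q (S.face m k) := by
    intro m k hmk
    obtain ⟨b, d, hd, h1, h2, -⟩ := S.vertex m k
    rw [← h1, ← h2, hQj, if_pos, add_zero]
    by_contra hu
    have hm := hbranch m k b d hd hu
    have := hmk hm.1
    tauto
  -- Just past the end of the unused segment of `m`, the unused segment of the neighbour is crossed
  -- and `Q` goes from 0 at `X` to 1. No further change occurs before the other end.
  have hQr : ∀ m ∈ U, ∀ r : ℕ, r + 1 < N → Q (S.face m (κ m + 1 + r)) = 1 := by
    intro m hm r
    induction r with
    | zero =>
      intro _
      obtain ⟨b, d, hd, h1, h2, -⟩ := S.vertex m (κ m + 1)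
      rw [add_sub_cancel_right] at h2
      have hu : ¬ S.Used (S.lab m (κ m + 1)) b := by
        rw [Used, h1, h2]
        rintro (h | h)
        · exact S.not_isTri_add hN h hm.right
        · exact hm.unused (Or.inl h)
      have := hQj (S.lab m (κ m + 1)) b
      rw [h1, h2, hface m hm, hQX, if_neg hu] at this
      rw [Nat.cast_zero, add_zero]
      generalize Q (S.face m (κ m + 1)) = x at this
      revert x; decide
    | succ r ih =>
      intro hr
      rw [← ih (by omega), ← hstep m (κ m + 1 + (r + 1 : ℕ))]
      · congr 2; push_cast; ring
      · intro _
        constructor <;> exact not_dvd_of_lt (by push_cast; omega) (by push_cast; rw [abs_lt]; omega)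
  have hQU : ∀ m ∈ U, ∀ k, S.Used m k → Q (S.face m k) = 1 := by
    intro m hm k hk
    have hNpos : (0 : ℤ) < N := by omega
    have hr0 := Int.emod_nonneg (k - κ m) hNpos.ne'
    have hr1 := Int.emod_lt_of_pos (k - κ m) hNpos
    have hr2 : (k - κ m) % N ≠ 0 := fun h' => hm.unused
      ((S.used_congr (Int.dvd_of_emod_eq_zero h')).1 hk)
    have h1 := hQr m hm ((k - κ m) % N - 1).toNat (by omega)
    rw [Int.toNat_of_nonneg (by omega)] at h1
    have hdvd : (N : ℤ) ∣ k - (κ m + 1 + ((k - κ m) % N - 1)) := by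
      rw [show k - (κ m + 1 + ((k - κ m) % N - 1)) = (k - κ m) - (k - κ m) % N by ring]
      exact Int.dvd_self_sub_emod
    rcases S.face_of_dvd (i := m) hdvd with h | h
    · rw [h.1, h1]
    · rw [h.1, hQj, h1, if_pos ((S.used_congr hdvd).1 hk), add_zero]
  -- A curve outside `U` shares, at its crossing with `i₀`, a face with a used segment of `i₀`, and
  -- `Q` is constant along it.
  have hQ1 : ∀ m k, S.Used m k → Q (S.face m k) = 1 := by
    intro m k hk
    by_cases hm : m ∈ U
    · exact hQU m hm k hk
    have hmi : i₀ ≠ m := by rintro rfl; exact hm hi₀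
    obtain ⟨k₀, hk₀⟩ := S.lab_surj m i₀ hmi
    have h0 : Q (S.face m k₀) = 1 := by
      obtain ⟨b, d, hd, h1, -⟩ := S.vertex m k₀
      have hu : S.Used (S.lab m k₀) b := by
        by_contra hu
        exact hm (hbranch m k₀ b d hd hu).1
      rw [← h1]
      exact hQU _ (hk₀ ▸ hi₀) _ hu
    have hall : ∀ r : ℤ, Q (S.face m (k₀ + r)) = 1 := by
      intro r
      induction r using Int.induction_on with
      | zero => simpa using h0
      | succ r ih =>
        rw [← ih, ← hstep m _ (fun h => absurd h hm), ← add_assoc, add_sub_cancel_right]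
      | pred r ih =>
        rw [← ih, ← hstep m (k₀ + -(r : ℤ)) (fun h => absurd h hm), add_sub_assoc]
    have := hall (k - k₀)
    rwa [add_sub_cancel] at this
  -- A used edge of `X` would give `Q X = 1`.
  refine ⟨i₀, κ i₀, ?_⟩
  rw [← hX]
  ext ⟨m, a⟩
  obtain ⟨k, rfl⟩ := ZMod.intCast_surjective a
  rw [mem_unusedEdges_iff, mem_edges_iff]
  constructor
  · rintro (h | h) hu
    · have := hQ1 m k hu
      rw [h, hQX] at this
      exact absurd this (by decide)
    · have := hQ1 m (k + N) ((S.used_congr (by simp)).2 hu)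
      rw [h, hQX] at this
      exact absurd this (by decide)
  · intro hu
    have hm := hκ m k hu
    rcases S.face_of_dvd (i := m) (huniq m _ _ hu hm.unused) with h | h
    · left; rw [h.1]; exact hface m hm
    · right; rw [h.2]; exact hface m hm

end SideSystem

/-! ### Topology of the projective plane -/

section

open Topology Filter

namespace RP2

/-- The point of the projective plane with given homogeneous coordinates. -/
noncomputable def pt (v : Fin 3 → ℝ) : RP2 :=
  if h : v ≠ 0 then Projectivization.mk ℝ v h else Projectivization.mk ℝ (fun _ => 1)
    (fun h => one_ne_zero (congrFun h 0))

lemma pt_of_ne {v : Fin 3 → ℝ} (h : v ≠ 0) : pt v = Projectivization.mk ℝ v h := dif_pos h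

lemma exists_pt (p : RP2) : ∃ v, v ≠ 0 ∧ pt v = p :=
  ⟨p.rep, p.rep_nonzero, by rw [pt_of_ne p.rep_nonzero]; exact p.mk_rep⟩

lemma pt_eq_iff {v w : Fin 3 → ℝ} (hv : v ≠ 0) (hw : w ≠ 0) :
    pt v = pt w ↔ ∃ c : ℝ, c ≠ 0 ∧ v = c • w := by
  rw [pt_of_ne hv, pt_of_ne hw, Projectivization.mk_eq_mk_iff']
  constructor
  · rintro ⟨c, hc⟩
    refine ⟨c, ?_, hc.symm⟩
    rintro rfl
    exact hv (by rw [← hc, zero_smul])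
  · rintro ⟨c, -, hc⟩
    exact ⟨c, hc.symm⟩

lemma pt_smul {c : ℝ} (hc : c ≠ 0) (v : Fin 3 → ℝ) : pt (c • v) = pt v := by
  by_cases hv : v = 0
  · simp [hv]
  · exact (pt_eq_iff (smul_ne_zero hc hv) hv).2 ⟨c, hc, rfl⟩

lemma isQuotientMap_mk : IsQuotientMap
    (fun v : {v : Fin 3 → ℝ // v ≠ 0} => (Projectivization.mk ℝ v.1 v.2 : RP2)) :=
  isQuotientMap_quotient_mk'

lemma isOpen_ne_zero : IsOpen {v : Fin 3 → ℝ | v ≠ 0} := isOpen_ne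

lemma continuousAt_pt {v : Fin 3 → ℝ} (hv : v ≠ 0) : ContinuousAt pt v := by
  have h1 : ContinuousOn pt {v : Fin 3 → ℝ | v ≠ 0} := by
    rw [continuousOn_iff_continuous_domRestrict]
    have : Set.domRestrict {v : Fin 3 → ℝ | v ≠ 0} pt =
        fun v => (Projectivization.mk ℝ v.1 v.2 : RP2) := by
      ext v
      exact pt_of_ne v.2
    rw [this]
    exact isQuotientMap_mk.continuous
  exact h1.continuousAt (isOpen_ne_zero.mem_nhds hv)

lemma isOpen_image_pt {U : Set (Fin 3 → ℝ)} (hU : IsOpen U) (h0 : ∀ v ∈ U, v ≠ 0) :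
    IsOpen (pt '' U) := by
  rw [← isQuotientMap_mk.isOpen_preimage]
  have : (fun v : {v : Fin 3 → ℝ // v ≠ 0} => (Projectivization.mk ℝ v.1 v.2 : RP2)) ⁻¹' (pt '' U) =
      Subtype.val ⁻¹' ⋃ c ∈ {c : ℝ | c ≠ 0}, (fun v : Fin 3 → ℝ => c • v) ⁻¹' U := by
    ext ⟨v, hv⟩
    simp only [Set.mem_preimage, Set.mem_image, Set.mem_iUnion, exists_prop]
    constructor
    · rintro ⟨w, hw, h⟩
      rw [← pt_of_ne hv, pt_eq_iff (h0 w hw) hv] at h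
      obtain ⟨c, hc, rfl⟩ := h
      exact ⟨c, hc, hw⟩
    · rintro ⟨c, hc, h⟩
      exact ⟨c • v, h, by rw [pt_smul hc, pt_of_ne hv]⟩
  rw [this]
  exact (isOpen_biUnion fun c _ => hU.preimage (continuous_const_smul c)).preimage
    continuous_subtype_val

lemma map_pt_nhds {v : Fin 3 → ℝ} (hv : v ≠ 0) : map pt (𝓝 v) = 𝓝 (pt v) := by
  apply le_antisymm (continuousAt_pt hv)
  intro s hs
  rw [mem_map, mem_nhds_iff] at hs
  obtain ⟨t, hts, hto, hvt⟩ := hs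
  refine mem_of_superset ((isOpen_image_pt (hto.inter isOpen_ne_zero) fun v h => h.2).mem_nhds
    ⟨v, ⟨hvt, hv⟩, rfl⟩) ?_
  rintro _ ⟨w, hw, rfl⟩
  exact hts hw.1

lemma continuous_of_comp_pt {Y : Type*} [TopologicalSpace Y] {f : RP2 → Y}
    (h : ∀ v, v ≠ 0 → ContinuousAt (fun w => f (pt w)) v) : Continuous f := by
  rw [continuous_iff_continuousAt]
  intro p
  obtain ⟨v, hv, rfl⟩ := exists_pt p
  have := h v hv
  rw [ContinuousAt, ← map_pt_nhds hv]
  exact this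

instance instLocallyConnectedSpace : LocallyConnectedSpace RP2 := by
  have : LocallyConnectedSpace {v : Fin 3 → ℝ // v ≠ 0} := isOpen_ne_zero.locallyConnectedSpace
  exact isQuotientMap_mk.isCoinducing.locallyConnectedSpace

lemma pt_rep (p : RP2) : pt p.rep = p := by
  rw [pt_of_ne p.rep_nonzero]; exact p.mk_rep

lemma exists_rep_pt {v : Fin 3 → ℝ} (hv : v ≠ 0) : ∃ c : ℝ, c ≠ 0 ∧ (pt v).rep = c • v :=
  (pt_eq_iff (pt v).rep_nonzero hv).1 (pt_rep _)

/-- The Veronese embedding. -/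
noncomputable def veronese (p : RP2) : Fin 3 → Fin 3 → ℝ :=
  fun i j => p.rep i * p.rep j / ∑ k, p.rep k ^ 2

lemma sum_sq_pos {v : Fin 3 → ℝ} (hv : v ≠ 0) : 0 < ∑ k, v k ^ 2 := by
  obtain ⟨k, hk⟩ := Function.ne_iff.1 hv
  exact Finset.sum_pos' (fun _ _ => sq_nonneg _) ⟨k, Finset.mem_univ _, by
    have : v k ≠ 0 := hk
    positivity⟩

lemma veronese_pt {v : Fin 3 → ℝ} (hv : v ≠ 0) :
    veronese (pt v) = fun i j => v i * v j / ∑ k, v k ^ 2 := by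
  obtain ⟨c, hc, h⟩ := exists_rep_pt hv
  ext i j
  have := (sum_sq_pos hv).ne'
  simp only [veronese, h, Pi.smul_apply, smul_eq_mul, mul_pow, ← Finset.mul_sum]
  field_simp

/-- The Veronese map is continuous and injective: a nonzero column of the matrix `v i * v j`
recovers `v` up to a scalar. -/
instance instT2Space : T2Space RP2 := by
  refine T2Space.of_injective_continuous (f := veronese) ?_ ?_
  · intro p q h
    obtain ⟨v, hv, rfl⟩ := exists_pt p
    obtain ⟨w, hw, rfl⟩ := exists_pt q
    rw [veronese_pt hv, veronese_pt hw] at h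
    have h' : ∀ i j, v i * v j / ∑ k, v k ^ 2 = w i * w j / ∑ k, w k ^ 2 := fun i j =>
      congrFun (congrFun h i) j
    obtain ⟨j, hj⟩ := Function.ne_iff.1 hw
    have hj : w j ≠ 0 := hj
    have hsv := (sum_sq_pos hv).ne'
    have hsw := (sum_sq_pos hw).ne'
    simp only [div_eq_div_iff hsv hsw] at h'
    have hvj : v j ≠ 0 := by
      intro h0
      have := h' j j
      rw [h0] at this
      simp [hj, hsv] at this
    rw [pt_eq_iff hv hw]
    refine ⟨w j * (∑ k, v k ^ 2) / (v j * ∑ k, w k ^ 2), by positivity, ?_⟩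
    ext i
    have := h' i j
    simp only [Pi.smul_apply, smul_eq_mul]
    field_simp
    linarith
  · apply continuous_of_comp_pt
    intro v hv
    have : ∀ᶠ w in 𝓝 v, (fun i j => w i * w j / ∑ k, w k ^ 2) = veronese (pt w) := by
      filter_upwards [isOpen_ne_zero.mem_nhds hv] with w hw
      rw [veronese_pt hw]
    refine ContinuousAt.congr ?_ this
    refine continuousAt_pi.2 fun i => continuousAt_pi.2 fun j => ?_
    exact ContinuousAt.div (by fun_prop)
      (continuous_finsetSum _ fun k _ => by fun_prop).continuousAt (sum_sq_pos hv).ne'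

/-- The action of a linear automorphism on the projective plane. -/
noncomputable def linearMap (L : (Fin 3 → ℝ) ≃ₗ[ℝ] (Fin 3 → ℝ)) (p : RP2) : RP2 := pt (L p.rep)

lemma linearMap_pt (L : (Fin 3 → ℝ) ≃ₗ[ℝ] (Fin 3 → ℝ)) {v : Fin 3 → ℝ} (hv : v ≠ 0) :
    linearMap L (pt v) = pt (L v) := by
  obtain ⟨c, hc, h⟩ := exists_rep_pt hv
  rw [linearMap, h, map_smul, pt_smul hc]

lemma continuous_linearMap (L : (Fin 3 → ℝ) ≃ₗ[ℝ] (Fin 3 → ℝ)) : Continuous (linearMap L) := by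
  apply continuous_of_comp_pt
  intro v hv
  have hL : Continuous L := L.toLinearMap.continuous_of_finiteDimensional
  refine ContinuousAt.congr (f := fun w => pt (L w)) ?_ ?_
  · exact ContinuousAt.comp (continuousAt_pt (by simpa using hv)) hL.continuousAt
  · filter_upwards [isOpen_ne_zero.mem_nhds hv] with w hw
    rw [linearMap_pt L hw]

/-- A linear automorphism acts on the projective plane by a homeomorphism. -/
noncomputable def linearHomeo (L : (Fin 3 → ℝ) ≃ₗ[ℝ] (Fin 3 → ℝ)) : RP2 ≃ₜ RP2 where
  toFun := linearMap L
  invFun := linearMap L.symm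
  left_inv p := by
    rw [linearMap.eq_def L, linearMap_pt _ (by simpa using p.rep_nonzero), L.symm_apply_apply,
      pt_rep]
  right_inv p := by
    rw [linearMap.eq_def L.symm, linearMap_pt _ (by simpa using p.rep_nonzero),
      L.apply_symm_apply, pt_rep]
  continuous_toFun := continuous_linearMap L
  continuous_invFun := continuous_linearMap L.symm

/-- With `W` the kernel of `f` and `f y ≠ 0`, the first coordinate in a basis made of `y` and a
basis of `W` is `f / f y`. -/
lemma exists_linearEquiv_of_finrank_eq_two (W : Submodule ℝ (Fin 3 → ℝ))
    (hW : Module.finrank ℝ W = 2) :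
    ∃ L : (Fin 3 → ℝ) ≃ₗ[ℝ] (Fin 3 → ℝ), ∀ v, v ∈ W ↔ L v 0 = 0 := by
  have hlt : W < ⊤ := by
    rw [lt_top_iff_ne_top]
    rintro rfl
    simp at hW
  obtain ⟨f, hf, hWf⟩ := W.exists_le_ker_of_lt_top hlt
  have hker : W = LinearMap.ker f := by
    apply Submodule.eq_of_le_of_finrank_le hWf
    rw [hW]
    have h1 := f.finrank_range_add_finrank_ker
    have h2 : 0 < Module.finrank ℝ (LinearMap.range f) := by
      rw [Module.finrank_pos_iff, Submodule.nontrivial_iff_ne_bot, Ne, LinearMap.range_eq_bot]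
      exact hf
    simp only [Module.finrank_fintype_fun_eq_card, Fintype.card_fin] at h1
    omega
  obtain ⟨y, hy⟩ : ∃ y, f y ≠ 0 := by
    by_contra! h
    exact hf (LinearMap.ext h)
  let b := Module.Basis.mkFinCons y (Module.finBasisOfFinrankEq ℝ W hW)
    (fun c x hx h => by
      have h3 := congrArg f h
      rw [hker, LinearMap.mem_ker] at hx
      simpa [hx, hy] using h3)
    (fun z => ⟨-(f z / f y), by rw [hker, LinearMap.mem_ker]; simp [hy]⟩)
  refine ⟨b.equivFun, fun v => ?_⟩
  have hv : f v = b.equivFun v 0 * f y := by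
    conv_lhs => rw [← b.sum_equivFun v]
    have h1 : ∀ w : W, f w = 0 := fun w => hWf w.2
    rw [map_sum, Fin.sum_univ_succ]
    simp [b, h1]
  rw [hker, LinearMap.mem_ker, hv]
  simp [hy]

end RP2

/-- A pseudo-line is the image of the line at infinity under some homeomorphism. -/
lemma IsPseudoLine.exists_homeo {A : Set RP2} (hA : IsPseudoLine A) :
    ∃ h : RP2 ≃ₜ RP2, ∀ v, v ≠ 0 → (h.symm (RP2.pt v) ∈ A ↔ v 0 = 0) := by
  obtain ⟨h, W, hW, hL⟩ := hA
  obtain ⟨L, hL'⟩ := RP2.exists_linearEquiv_of_finrank_eq_two W hW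
  refine ⟨h.trans (RP2.linearHomeo L), fun v hv => ?_⟩
  have h1 : (h.trans (RP2.linearHomeo L)).symm (RP2.pt v) = h.symm (RP2.pt (L.symm v)) := by
    rw [← RP2.linearMap_pt _ hv]
    rfl
  have hv' : L.symm v ≠ 0 := by simpa using hv
  rw [h1]
  have h2 : h.symm (RP2.pt (L.symm v)) ∈ A ↔ RP2.pt (L.symm v) ∈ h '' A := by
    rw [h.image_eq_preimage_symm]; rfl
  rw [h2, hL, Set.mem_ofPred_eq, RP2.pt_of_ne hv', Projectivization.submodule_mk,
    Submodule.span_singleton_le_iff_mem, hL', L.apply_symm_apply]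

end

/-! ### Strips around pseudo-lines -/

section

open Topology Filter

/-- A parametrization of a neighbourhood of the curve `A` by its orientation double cover: the
curve is `t = 0`, and `(θ + π, t)` and `(θ, -t)` are the same point. -/
structure IsStripParam (A : Set RP2) (Φ : ℝ × ℝ → RP2) : Prop where
  continuous : Continuous Φ
  isOpenMap : IsOpenMap Φ
  mem_iff : ∀ θ t, Φ (θ, t) ∈ A ↔ t = 0
  shift : ∀ θ t, Φ (θ + Real.pi, t) = Φ (θ, -t)
  eq_iff : ∀ θ θ', Φ (θ, 0) = Φ (θ', 0) ↔ ∃ k : ℤ, θ' = θ + k * Real.pi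
  surj : ∀ p ∈ A, ∃ θ, Φ (θ, 0) = p

namespace RP2

/-- Homogeneous coordinates around the line at infinity. -/
noncomputable def stripVec (q : ℝ × ℝ) : Fin 3 → ℝ := ![q.2, Real.cos q.1, Real.sin q.1]

lemma stripVec_ne_zero (q : ℝ × ℝ) : stripVec q ≠ 0 := by
  intro h
  have h1 : Real.cos q.1 = 0 := congrFun h 1
  have h2 : Real.sin q.1 = 0 := congrFun h 2
  have := Real.sin_sq_add_cos_sq q.1
  simp [h1, h2] at this

lemma continuous_stripVec : Continuous stripVec := by
  unfold stripVec
  refine continuous_pi fun i => ?_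
  fin_cases i
  · exact continuous_snd
  · exact Real.continuous_cos.comp continuous_fst
  · exact Real.continuous_sin.comp continuous_fst

lemma continuous_pt_stripVec : Continuous fun q => pt (stripVec q) :=
  continuous_iff_continuousAt.2 fun q =>
    ContinuousAt.comp (continuousAt_pt (stripVec_ne_zero q)) continuous_stripVec.continuousAt

/-- In coordinates rotated by `θ`, a vector near `stripVec (θ, t)` is a multiple of the strip vector
with angle `θ + arctan (v / u)`. This gives a continuous local section `ρ`, and a map with local
sections is open. -/
lemma isOpenMap_pt_stripVec : IsOpenMap fun q => pt (stripVec q) := by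
  apply IsOpenMap.of_nhds_le
  rintro ⟨θ, t⟩
  rw [← map_pt_nhds (stripVec_ne_zero _)]
  set u : (Fin 3 → ℝ) → ℝ := fun w => w 1 * Real.cos θ + w 2 * Real.sin θ with hu
  set v : (Fin 3 → ℝ) → ℝ := fun w => w 2 * Real.cos θ - w 1 * Real.sin θ with hv
  set ρ : (Fin 3 → ℝ) → ℝ × ℝ := fun w =>
    (θ + Real.arctan (v w / u w), w 0 / u w * Real.cos (Real.arctan (v w / u w))) with hρ
  have hu1 : u (stripVec (θ, t)) = 1 := by
    have := Real.cos_sq_add_sin_sq θ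
    simp only [hu, stripVec, Matrix.cons_val]
    linarith
  have hv0 : v (stripVec (θ, t)) = 0 := by
    simp only [hv, stripVec, Matrix.cons_val]
    ring
  have hρ0 : ρ (stripVec (θ, t)) = (θ, t) := by
    simp only [hρ, hu1, hv0]
    simp [stripVec]
  have hcu : Continuous u := by fun_prop
  have hcv : Continuous v := by fun_prop
  have hcρ : ContinuousAt ρ (stripVec (θ, t)) := by
    have h1 : ContinuousAt (fun w => v w / u w) (stripVec (θ, t)) :=
      hcv.continuousAt.div hcu.continuousAt (by rw [hu1]; exact one_ne_zero)
    have h2 : ContinuousAt (fun w : Fin 3 → ℝ => w 0 / u w) (stripVec (θ, t)) :=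
      (continuous_apply 0).continuousAt.div hcu.continuousAt (by rw [hu1]; exact one_ne_zero)
    have h3 := Real.continuous_arctan.continuousAt.comp h1
    exact (continuousAt_const.add h3).prodMk
      (h2.mul (Real.continuous_cos.continuousAt.comp h3))
  have hpos : ∀ᶠ w in 𝓝 (stripVec (θ, t)), 0 < u w :=
    hcu.continuousAt.eventually (lt_mem_nhds (by rw [hu1]; exact one_pos))
  have hev : ∀ᶠ w in 𝓝 (stripVec (θ, t)), pt w = pt (stripVec (ρ w)) := by
    filter_upwards [hpos] with w hw
    have hcos := Real.cos_arctan_pos (v w / u w)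
    have hsin : Real.sin (Real.arctan (v w / u w)) =
        v w / u w * Real.cos (Real.arctan (v w / u w)) := by
      rw [← Real.tan_mul_cos hcos.ne', Real.tan_arctan]
    have hw' : w = (u w / Real.cos (Real.arctan (v w / u w))) • stripVec (ρ w) := by
      have hcs := Real.cos_sq_add_sin_sq θ
      ext i
      simp only [hρ, stripVec, Real.cos_add, Real.sin_add, hsin]
      set C := Real.cos (Real.arctan (v w / u w))
      fin_cases i
      · simp; field_simp
      · simp only [Fin.mk_one, Pi.smul_apply, Matrix.cons_val, smul_eq_mul]
        field_simp
        simp only [hu, hv]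
        linear_combination (-w 1) * hcs
      · simp only [Fin.reduceFinMk, Pi.smul_apply, Matrix.cons_val, smul_eq_mul]
        field_simp
        simp only [hu, hv]
        linear_combination (-w 2) * hcs
    conv_lhs => rw [hw']
    rw [pt_smul (by positivity)]
  rw [Filter.map_congr hev]
  have h4 : Filter.map ρ (𝓝 (stripVec (θ, t))) ≤ 𝓝 (θ, t) := by
    have := hcρ.tendsto
    rwa [hρ0] at this
  have h5 := Filter.map_mono (m := fun q => pt (stripVec q)) h4
  rwa [Filter.map_map] at h5

lemma pt_stripVec_add_pi (θ t : ℝ) : pt (stripVec (θ + Real.pi, t)) = pt (stripVec (θ, -t)) := by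
  rw [← pt_smul (c := -1) (by norm_num) (stripVec (θ + Real.pi, t))]
  congr 1
  ext i
  fin_cases i <;> simp [stripVec]

lemma pt_stripVec_eq_iff (θ θ' : ℝ) : pt (stripVec (θ, 0)) = pt (stripVec (θ', 0)) ↔
    ∃ k : ℤ, θ' = θ + k * Real.pi := by
  rw [pt_eq_iff (stripVec_ne_zero _) (stripVec_ne_zero _)]
  constructor
  · rintro ⟨c, hc, h⟩
    have h1 : Real.cos θ = c * Real.cos θ' := congrFun h 1
    have h2 : Real.sin θ = c * Real.sin θ' := congrFun h 2
    have h3 : Real.sin (θ' - θ) = 0 := by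
      rw [Real.sin_sub, h1, h2]; ring
    obtain ⟨k, hk⟩ := Real.sin_eq_zero_iff.1 h3
    exact ⟨k, by linarith⟩
  · rintro ⟨k, rfl⟩
    refine ⟨(-1) ^ k, by positivity, ?_⟩
    have hk : ((-1 : ℝ) ^ k) * (-1) ^ k = 1 := by
      rw [← mul_zpow]; simp
    ext i
    fin_cases i
    · simp [stripVec]
    · simp [stripVec, Real.cos_add_int_mul_pi, ← mul_assoc, hk]
    · simp [stripVec, Real.sin_add_int_mul_pi, ← mul_assoc, hk]

lemma exists_pt_stripVec {v : Fin 3 → ℝ} (hv : v ≠ 0) (h0 : v 0 = 0) :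
    ∃ θ, pt (stripVec (θ, 0)) = pt v := by
  set z : ℂ := ⟨v 1, v 2⟩ with hz
  have hz0 : z ≠ 0 := by
    intro h
    apply hv
    ext i
    fin_cases i
    · exact h0
    · exact congrArg Complex.re h
    · exact congrArg Complex.im h
  have hn : ‖z‖ ≠ 0 := by simpa using hz0
  refine ⟨z.arg, ?_⟩
  rw [← pt_smul hn]
  congr 1
  ext i
  fin_cases i
  · simp [stripVec, h0]
  · simp [stripVec, Complex.norm_mul_cos_arg, hz]
  · simp [stripVec, Complex.norm_mul_sin_arg, hz]

lemma isStripParam {A : Set RP2} {h : RP2 ≃ₜ RP2}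
    (hA : ∀ v, v ≠ 0 → (h.symm (pt v) ∈ A ↔ v 0 = 0)) :
    IsStripParam A fun q => h.symm (pt (stripVec q)) where
  continuous := h.symm.continuous.comp continuous_pt_stripVec
  isOpenMap := h.symm.isOpenMap.comp isOpenMap_pt_stripVec
  mem_iff θ t := by rw [hA _ (stripVec_ne_zero _)]; rfl
  shift θ t := by rw [pt_stripVec_add_pi]
  eq_iff θ θ' := by rw [h.symm.injective.eq_iff, pt_stripVec_eq_iff]
  surj p hp := by
    obtain ⟨v, hv, hvp⟩ := exists_pt (h p)
    have h1 : h.symm (pt v) = p := by rw [hvp, h.symm_apply_apply]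
    have h0 : v 0 = 0 := by rw [← hA v hv, h1]; exact hp
    obtain ⟨θ, hθ⟩ := exists_pt_stripVec hv h0
    exact ⟨θ, by rw [hθ, h1]⟩

/-! ### The covering by the sphere and the two sides of a pair of pseudo-lines -/

/-- The affine plane in the projective plane. -/
def affineVec (q : ℝ × ℝ) : Fin 3 → ℝ := ![1, q.1, q.2]

lemma affineVec_ne_zero (q : ℝ × ℝ) : affineVec q ≠ 0 := fun h => one_ne_zero (congrFun h 0)

lemma continuous_affineVec : Continuous affineVec := by
  unfold affineVec
  refine continuous_pi fun i => ?_
  fin_cases i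
  · exact continuous_const
  · exact continuous_fst
  · exact continuous_snd

/-- The affine coordinates of a point that is not at infinity. -/
noncomputable def affineCoord (p : RP2) : ℝ × ℝ := (p.rep 1 / p.rep 0, p.rep 2 / p.rep 0)

lemma affineCoord_pt {v : Fin 3 → ℝ} (hv : v ≠ 0) : affineCoord (pt v) = (v 1 / v 0, v 2 / v 0) := by
  obtain ⟨c, hc, h⟩ := exists_rep_pt hv
  simp only [affineCoord, h, Pi.smul_apply, smul_eq_mul]
  rw [mul_div_mul_left _ _ hc, mul_div_mul_left _ _ hc]

lemma pt_affineVec_affineCoord {v : Fin 3 → ℝ} (hv : v ≠ 0) (h0 : v 0 ≠ 0) :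
    pt (affineVec (affineCoord (pt v))) = pt v := by
  rw [affineCoord_pt hv, ← pt_smul h0]
  congr 1
  ext i
  fin_cases i
  · simp [affineVec]
  · simp [affineVec]; field_simp
  · simp [affineVec]; field_simp

lemma continuousAt_affineCoord {v : Fin 3 → ℝ} (hv : v ≠ 0) (h0 : v 0 ≠ 0) :
    ContinuousAt affineCoord (pt v) := by
  rw [ContinuousAt, ← map_pt_nhds hv, tendsto_map'_iff]
  have h1 : ContinuousAt (fun w : Fin 3 → ℝ => (w 1 / w 0, w 2 / w 0)) v :=
    ((continuous_apply 1).continuousAt.div (continuous_apply 0).continuousAt h0).prodMk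
      ((continuous_apply 2).continuousAt.div (continuous_apply 0).continuousAt h0)
  rw [affineCoord_pt hv]
  refine Tendsto.congr' ?_ h1
  filter_upwards [isOpen_ne_zero.mem_nhds hv] with w hw
  exact (affineCoord_pt hw).symm

/-- The group of signs acts on the sphere. -/
instance instSignAction : MulAction ℤˣ (Metric.sphere (0 : Fin 3 → ℝ) 1) where
  smul g x := ⟨(g : ℤ) • x.1, by
    rcases Int.units_eq_one_or g with rfl | rfl <;> simp⟩
  one_smul x := by
    ext1
    show ((1 : ℤˣ) : ℤ) • x.1 = x.1
    simp
  mul_smul g h x := by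
    ext1
    show ((g * h : ℤˣ) : ℤ) • x.1 = (g : ℤ) • (h : ℤ) • x.1
    rw [Units.val_mul, mul_smul]

lemma sphere_ne_zero (x : Metric.sphere (0 : Fin 3 → ℝ) 1) : x.1 ≠ 0 :=
  ne_zero_of_mem_unit_sphere x

/-- Antipodal points are at distance 2, so a ball of radius 1 never meets its antipode. The norm is
the sup norm, which is harmless here. -/
lemma isQuotientCoveringMap_pt : IsQuotientCoveringMap
    (fun x : Metric.sphere (0 : Fin 3 → ℝ) 1 => pt x.1) ℤˣ where
  toIsQuotientMap := by
    have hsurj : Function.Surjective fun x : Metric.sphere (0 : Fin 3 → ℝ) 1 => pt x.1 := by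
      intro p
      obtain ⟨v, hv, rfl⟩ := exists_pt p
      have hn : ‖v‖ ≠ 0 := by simpa using hv
      exact ⟨⟨‖v‖⁻¹ • v, by simp [norm_smul, hn]⟩, pt_smul (inv_ne_zero hn) v⟩
    have hcont : Continuous fun x : Metric.sphere (0 : Fin 3 → ℝ) 1 => pt x.1 :=
      continuous_iff_continuousAt.2 fun x =>
        ContinuousAt.comp (continuousAt_pt (sphere_ne_zero x)) continuous_subtype_val.continuousAt
    exact IsQuotientMap.of_surjective_continuous hsurj hcont
  continuous_const_smul g := by
    refine Continuous.subtype_mk ?_ _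
    exact (continuous_const_smul (g : ℤ)).comp continuous_subtype_val
  apply_eq_iff_mem_orbit {x y} := by
    rw [pt_eq_iff (sphere_ne_zero x) (sphere_ne_zero y)]
    constructor
    · rintro ⟨c, hc, h⟩
      have h1 : ‖x.1‖ = 1 := by simp
      have h2 : ‖y.1‖ = 1 := by simp
      rw [h, norm_smul, h2, mul_one, Real.norm_eq_abs] at h1
      rcases eq_or_eq_neg_of_abs_eq h1 with rfl | rfl
      · exact ⟨1, by ext1; rw [h]; show ((1 : ℤˣ) : ℤ) • y.1 = _; simp⟩
      · exact ⟨-1, by ext1; rw [h]; show ((-1 : ℤˣ) : ℤ) • y.1 = _; simp⟩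
    · rintro ⟨g, rfl⟩
      rcases Int.units_eq_one_or g with rfl | rfl
      · exact ⟨1, by norm_num, by show ((1 : ℤˣ) : ℤ) • y.1 = _; simp⟩
      · exact ⟨-1, by norm_num, by show ((-1 : ℤˣ) : ℤ) • y.1 = _; simp⟩
  disjoint x := by
    refine ⟨Metric.ball x 1, Metric.ball_mem_nhds x one_pos, ?_⟩
    rintro g ⟨_, ⟨y, hy, rfl⟩, hy'⟩
    rcases Int.units_eq_one_or g with rfl | rfl
    · rfl
    · exfalso
      rw [Metric.mem_ball, Subtype.dist_eq, dist_eq_norm] at hy hy'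
      have e : ((-1 : ℤˣ) • y).1 = -y.1 := by
        show ((-1 : ℤˣ) : ℤ) • y.1 = _; simp
      have hy' : ‖-y.1 - x.1‖ < 1 := by
        have := hy'
        dsimp only at this
        rwa [e] at this
      have h1 : ‖x.1‖ = 1 := by simp
      have h2 : ‖(2 : ℝ) • x.1‖ ≤ ‖y.1 - x.1‖ + ‖-y.1 - x.1‖ := by
        have := norm_add_le (y.1 - x.1) (-y.1 - x.1)
        rw [show y.1 - x.1 + (-y.1 - x.1) = -((2 : ℝ) • x.1) by rw [two_smul]; abel, norm_neg] at this
        exact this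
      rw [norm_smul, h1] at h2
      norm_num at h2
      linarith

/-- Two pseudo-lines divide the projective plane in two parts. -/
lemma exists_sign {A B : Set RP2} {a b : RP2 ≃ₜ RP2}
    (hA : ∀ v, v ≠ 0 → (a.symm (pt v) ∈ A ↔ v 0 = 0))
    (hB : ∀ v, v ≠ 0 → (b.symm (pt v) ∈ B ↔ v 0 = 0)) :
    ∃ σ : RP2 → ZMod 2, (∀ p, p ∉ A → p ∉ B → ∀ᶠ q in 𝓝 p, σ q = σ p) ∧
      ∀ θ, b.symm (pt (stripVec (θ, 0))) ∉ A → ∀ᶠ t in 𝓝[>] (0 : ℝ),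
        σ (b.symm (pt (stripVec (θ, -t)))) = σ (b.symm (pt (stripVec (θ, t)))) + 1 := by
  -- In the coordinates `a`, the complement of `A` is the affine plane, which is simply connected,
  -- so `b` lifts to the sphere there. Thus `γ p` is a choice of homogeneous coordinates of `b p`,
  -- continuous off `A`, and the sign of its entry 0 distinguishes the sides of `B`.
  let f : C(ℝ × ℝ, RP2) := ⟨fun q => b (a.symm (pt (affineVec q))),
    b.continuous.comp (a.symm.continuous.comp (continuous_iff_continuousAt.2 fun q =>
      ContinuousAt.comp (continuousAt_pt (affineVec_ne_zero q))
        continuous_affineVec.continuousAt))⟩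
  obtain ⟨e₀, he₀⟩ := isQuotientCoveringMap_pt.surjective (f (0, 0))
  obtain ⟨G, ⟨-, hG⟩, -⟩ :=
    isQuotientCoveringMap_pt.isCoveringMap.existsUnique_continuousMap_lifts f (0, 0) e₀ he₀
  have hG' : ∀ q, pt (G q).1 = b (a.symm (pt (affineVec q))) := fun q => congrFun hG q
  have hcoord : ∀ p, p ∉ A → ∃ v, v ≠ 0 ∧ v 0 ≠ 0 ∧ pt v = a p := by
    intro p hp
    obtain ⟨v, hv, hvp⟩ := exists_pt (a p)
    refine ⟨v, hv, ?_, hvp⟩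
    rwa [Ne, ← hA v hv, hvp, a.symm_apply_apply]
  obtain ⟨γ, hγ⟩ : ∃ γ : RP2 → Fin 3 → ℝ, ∀ p, γ p = (G (affineCoord (a p))).1 :=
    ⟨_, fun _ => rfl⟩
  have hγ0 : ∀ p, γ p ≠ 0 := fun p => by rw [hγ]; exact sphere_ne_zero _
  have hγpt : ∀ p, p ∉ A → pt (γ p) = b p := by
    intro p hp
    obtain ⟨v, hv, hv0, hvp⟩ := hcoord p hp
    rw [hγ, hG', ← hvp, pt_affineVec_affineCoord hv hv0, hvp, a.symm_apply_apply]
  have hγc : ∀ p, p ∉ A → ContinuousAt γ p := by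
    intro p hp
    obtain ⟨v, hv, hv0, hvp⟩ := hcoord p hp
    have h1 : ContinuousAt (fun p => affineCoord (a p)) p :=
      ContinuousAt.comp (g := affineCoord) (f := a)
        (by rw [← hvp]; exact continuousAt_affineCoord hv hv0)
        a.continuous.continuousAt
    have h2 := (continuous_subtype_val.comp G.continuous).continuousAt.comp h1
    exact h2.congr (Eventually.of_forall fun q => (hγ q).symm)
  have hγB : ∀ p, p ∉ A → (p ∈ B ↔ γ p 0 = 0) := by
    intro p hp
    rw [← hB _ (hγ0 p), hγpt p hp, b.symm_apply_apply]
  have hAo : ∀ p, p ∉ A → ∀ᶠ q in 𝓝 p, q ∉ A := by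
    intro p hp
    obtain ⟨v, hv, hv0, hvp⟩ := hcoord p hp
    have h1 : ∀ᶠ q in 𝓝 (a p), a.symm q ∉ A := by
      rw [← hvp, ← map_pt_nhds hv, eventually_map]
      filter_upwards [isOpen_ne_zero.mem_nhds hv,
        (continuous_apply (0 : Fin 3)).continuousAt.eventually_ne hv0] with w hw hw0
      rwa [hA w hw]
    have h2 := a.continuous.continuousAt.eventually h1
    filter_upwards [h2] with q hq
    rwa [a.symm_apply_apply] at hq
  refine ⟨fun p => if 0 < γ p 0 then 1 else 0, ?_, ?_⟩
  · intro p hpA hpB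
    have hc : ContinuousAt (fun q => γ q 0) p :=
      (continuous_apply (0 : Fin 3)).continuousAt.comp (hγc p hpA)
    rw [hγB p hpA] at hpB
    rcases lt_or_gt_of_ne hpB with h | h
    · filter_upwards [hc.eventually (gt_mem_nhds h)] with q hq
      rw [if_neg (not_lt.2 hq.le), if_neg (not_lt.2 h.le)]
    · filter_upwards [hc.eventually (lt_mem_nhds h)] with q hq
      rw [if_pos hq, if_pos h]
  · intro θ hθ
    -- `c t` is the factor between the lift and `stripVec (θ, t)`. It keeps a constant sign near `t
    -- = 0`, so the entry `c t * t` changes sign with `t`.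
    obtain ⟨c, hc⟩ : ∃ c : ℝ → ℝ, ∀ t, c t = γ (b.symm (pt (stripVec (θ, t)))) 1 * Real.cos θ +
        γ (b.symm (pt (stripVec (θ, t)))) 2 * Real.sin θ := ⟨_, fun _ => rfl⟩
    have hcont : Continuous fun t => b.symm (pt (stripVec (θ, t))) :=
      b.symm.continuous.comp (continuous_pt_stripVec.comp (by fun_prop))
    have hcs := Real.cos_sq_add_sin_sq θ
    have key : ∀ t, b.symm (pt (stripVec (θ, t))) ∉ A → c t ≠ 0 ∧
        γ (b.symm (pt (stripVec (θ, t)))) 0 = c t * t := by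
      intro t ht
      have h1 := hγpt _ ht
      rw [b.apply_symm_apply, pt_eq_iff (hγ0 _) (stripVec_ne_zero _)] at h1
      obtain ⟨r, hr, h2⟩ := h1
      have h3 : c t = r := by
        rw [hc, h2]
        simp only [stripVec, Pi.smul_apply, Matrix.cons_val, smul_eq_mul]
        linear_combination r * hcs
      rw [h3, h2]
      exact ⟨hr, by simp [stripVec]⟩
    have hc0 : ContinuousAt c 0 := by
      have h1 : ContinuousAt (fun t => γ (b.symm (pt (stripVec (θ, t))))) 0 :=
        ContinuousAt.comp (hγc _ hθ) hcont.continuousAt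
      have h2 : ContinuousAt (fun t => γ (b.symm (pt (stripVec (θ, t)))) 1 * Real.cos θ +
          γ (b.symm (pt (stripVec (θ, t)))) 2 * Real.sin θ) 0 :=
        (((continuous_apply (1 : Fin 3)).continuousAt.comp h1).mul continuousAt_const).add
          (((continuous_apply (2 : Fin 3)).continuousAt.comp h1).mul continuousAt_const)
      exact h2.congr (Eventually.of_forall fun t => (hc t).symm)
    have hev : ∀ᶠ t in 𝓝 (0 : ℝ), b.symm (pt (stripVec (θ, t))) ∉ A ∧ 0 < c t * c 0 := by
      refine (hcont.continuousAt.eventually (hAo _ hθ)).and ?_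
      have : ContinuousAt (fun t => c t * c 0) 0 := hc0.mul continuousAt_const
      exact this.eventually (lt_mem_nhds (mul_self_pos.2 (key 0 hθ).1))
    have hneg : ∀ᶠ t in 𝓝 (0 : ℝ), b.symm (pt (stripVec (θ, -t))) ∉ A ∧ 0 < c (-t) * c 0 := by
      have : Tendsto (fun t : ℝ => -t) (𝓝 0) (𝓝 0) := by
        simpa using (continuous_neg (G := ℝ)).tendsto 0
      exact this.eventually hev
    filter_upwards [nhdsWithin_le_nhds hev, nhdsWithin_le_nhds hneg, self_mem_nhdsWithin]
      with t h1 h2 ht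
    have ht : 0 < t := ht
    rw [(key t h1.1).2, (key (-t) h2.1).2]
    rcases lt_or_gt_of_ne (key 0 hθ).1 with h0 | h0
    · have e1 : c t < 0 := by nlinarith [h1.2]
      have e2 : c (-t) < 0 := by nlinarith [h2.2]
      rw [if_pos (by nlinarith), if_neg (by nlinarith)]
      rfl
    · have e1 : 0 < c t := by nlinarith [h1.2]
      have e2 : 0 < c (-t) := by nlinarith [h2.2]
      rw [if_neg (by nlinarith), if_pos (by nlinarith)]
      rfl

end RP2

end

/-! ### Crossings enumerated along the double covers -/

section

open Topology Filter

/-- A finite subset of `[0, c)` and its translates by multiples of `c` can be enumerated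
increasingly by the integers. -/
lemma exists_periodic_enum {c : ℝ} {N : ℕ} (hN : 0 < N) (T : Finset ℝ) (hT : T.card = N)
    (hTc : ∀ x ∈ T, 0 ≤ x ∧ x < c) : ∃ θ : ℤ → ℝ, StrictMono θ ∧ (∀ k, θ (k + N) = θ k + c) ∧
      ∀ x, (∃ k, x = θ k) ↔ ∃ t ∈ T, ∃ z : ℤ, x = t + z * c := by
  have hNz : (0 : ℤ) < N := by exact_mod_cast hN
  have hlt : ∀ k : ℤ, (k % N).toNat < N := fun k => by
    have h1 := Int.emod_nonneg k hNz.ne'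
    have h2 := Int.emod_lt_of_pos k hNz
    omega
  set e := T.orderEmbOfFin hT
  have he : ∀ i, 0 ≤ e i ∧ e i < c := fun i => hTc _ (T.orderEmbOfFin_mem hT i)
  refine ⟨fun k => e ⟨(k % N).toNat, hlt k⟩ + (k / N : ℤ) * c, ?_, ?_, ?_⟩
  · refine strictMono_int_of_lt_succ fun k => ?_
    have h1 := Int.emod_nonneg k hNz.ne'
    have h2 := Int.emod_lt_of_pos k hNz
    have h3 := Int.mul_ediv_add_emod k N
    by_cases h : k % N + 1 < N
    · have h4 : (k + 1) % N = k % N + 1 ∧ (k + 1) / N = k / N := by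
        rw [and_comm, Int.ediv_emod_unique hNz]
        exact ⟨by linarith, by omega, h⟩
      have h5 : (⟨(k % N).toNat, hlt k⟩ : Fin N) < ⟨((k + 1) % N).toNat, hlt (k + 1)⟩ := by
        rw [Fin.mk_lt_mk, h4.1]; omega
      have := e.strictMono h5
      simp only [h4.2]
      linarith
    · have h4 : (k + 1) % N = 0 ∧ (k + 1) / N = k / N + 1 := by
        rw [and_comm, Int.ediv_emod_unique hNz]
        refine ⟨?_, le_rfl, hNz⟩
        have : k % N = N - 1 := by omega
        rw [this] at h3
        linarith
      have h5 := (he ⟨(k % N).toNat, hlt k⟩).2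
      have h6 := (he ⟨((k + 1) % N).toNat, hlt (k + 1)⟩).1
      simp only [h4.2]
      push_cast
      linarith
  · intro k
    have h1 : (k + N) % N = k % N := Int.add_emod_right k N
    have h2 : (k + N) / N = k / N + 1 := Int.add_ediv_of_dvd_right (dvd_refl _) |>.trans (by
      rw [Int.ediv_self hNz.ne'])
    simp only [h1, h2]
    push_cast
    ring
  · intro x
    constructor
    · rintro ⟨k, rfl⟩
      exact ⟨_, T.orderEmbOfFin_mem hT _, k / N, rfl⟩
    · rintro ⟨t, ht, z, rfl⟩
      have : t ∈ Set.range e := by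
        rw [Finset.range_orderEmbOfFin]; exact ht
      obtain ⟨i, rfl⟩ := this
      refine ⟨i + N * z, ?_⟩
      have hi : (0 : ℤ) ≤ i ∧ ((i : ℕ) : ℤ) < N := ⟨by positivity, by exact_mod_cast i.2⟩
      have h4 : ((i : ℤ) + N * z) % N = i ∧ ((i : ℤ) + N * z) / N = z := by
        rw [and_comm, Int.ediv_emod_unique hNz]
        exact ⟨rfl, hi.1, hi.2⟩
      simp only [h4.1, h4.2, Int.toNat_natCast]

namespace Arrangement

/-- Coordinates for a simple arrangement: strips around the curves, and the positions of the
crossings on the double covers of the curves. -/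
structure Coords {n : ℕ} (N : ℕ) (A : Fin n → Set RP2) where
  /-- The strip around a curve. -/
  Φ : Fin n → ℝ × ℝ → RP2
  /-- The positions of the crossings. -/
  θ : Fin n → ℤ → ℝ
  /-- The curves that are crossed. -/
  lab : Fin n → ℤ → Fin n
  isStripParam : ∀ i, IsStripParam (A i) (Φ i)
  pos : 0 < N
  strictMono : ∀ i, StrictMono (θ i)
  period : ∀ i k, θ i (k + N) = θ i k + Real.pi
  mem_iff : ∀ i j x, j ≠ i → (Φ i (x, 0) ∈ A j ↔ ∃ k, x = θ i k ∧ lab i k = j)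
  lab_eq_iff : ∀ i k l, lab i k = lab i l ↔ (N : ℤ) ∣ k - l
  lab_ne : ∀ i k, lab i k ≠ i
  lab_surj : ∀ i j, j ≠ i → ∃ k, lab i k = j
  cross : ∀ i k, CrossAt (A i) (A (lab i k)) (Φ i (θ i k, 0))

/-- A curve meets the `N` others at distinct angles in `[0, π)`, since no point lies on three
curves; `θ` enumerates the translates of these angles by multiples of `π`. -/
lemma exists_coords {n N : ℕ} (hn : n = N + 1) (hN : 0 < N) {A : Fin n → Set RP2}
    (hA : IsSimpleArrangement A) {Φ : Fin n → ℝ × ℝ → RP2}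
    (hΦ : ∀ i, IsStripParam (A i) (Φ i)) : ∃ c : Coords N A, c.Φ = Φ := by
  classical
  have hα : ∀ i j, ∃ α : ℝ, j ≠ i → (0 ≤ α ∧ α < Real.pi) ∧ A i ∩ A j = {Φ i (α, 0)} ∧
      CrossAt (A i) (A j) (Φ i (α, 0)) ∧ ∀ k, k ≠ i → k ≠ j → Φ i (α, 0) ∉ A k := by
    intro i j
    by_cases hij : j = i
    · exact ⟨0, fun h => absurd hij h⟩
    obtain ⟨p, hp, hc, hk⟩ := hA.cross i j (Ne.symm hij)
    have hpi : p ∈ A i := (hp.symm ▸ Set.mem_singleton p : p ∈ A i ∩ A j).1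
    obtain ⟨x, rfl⟩ := (hΦ i).surj p hpi
    have h1 : Φ i (toIcoMod Real.pi_pos 0 x, 0) = Φ i (x, 0) := by
      rw [(hΦ i).eq_iff]
      exact ⟨toIcoDiv Real.pi_pos 0 x, by
        have := toIcoMod_add_toIcoDiv_zsmul Real.pi_pos 0 x
        rw [zsmul_eq_mul] at this
        exact this.symm⟩
    refine ⟨toIcoMod Real.pi_pos 0 x, fun _ => ?_⟩
    rw [h1]
    have := toIcoMod_mem_Ico' Real.pi_pos x
    exact ⟨⟨this.1, this.2⟩, hp, hc, hk⟩
  choose α hα using hα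
  have hαmem : ∀ i j, j ≠ i → ∀ x, Φ i (x, 0) ∈ A j ↔ ∃ z : ℤ, x = α i j + z * Real.pi := by
    intro i j hij x
    have h := (hα i j hij).2.1
    rw [← (hΦ i).eq_iff]
    have hx : Φ i (x, 0) ∈ A i := ((hΦ i).mem_iff x 0).2 rfl
    constructor
    · intro hj
      have : Φ i (x, 0) ∈ A i ∩ A j := ⟨hx, hj⟩
      rw [h] at this
      exact this.symm
    · intro he
      rw [← he]
      exact (h.symm ▸ Set.mem_singleton _ : Φ i (α i j, 0) ∈ A i ∩ A j).2
  have hinj : ∀ i, Set.InjOn (α i) {j | j ≠ i} := by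
    intro i j hj k hk hjk
    by_contra hne
    have h1 : Φ i (α i k, 0) ∈ A k := (hαmem i k hk _).2 ⟨0, by simp⟩
    rw [← hjk] at h1
    exact (hα i j hj).2.2.2 k hk (Ne.symm hne) h1
  have hθ : ∀ i, ∃ θ : ℤ → ℝ, StrictMono θ ∧ (∀ k, θ (k + N) = θ k + Real.pi) ∧
      ∀ x, (∃ k, x = θ k) ↔ ∃ t ∈ (Finset.univ.erase i).image (α i), ∃ z : ℤ,
        x = t + z * Real.pi := by
    intro i
    apply exists_periodic_enum hN
    · rw [Finset.card_image_of_injOn, Finset.card_erase_of_mem (Finset.mem_univ _),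
        Finset.card_univ, Fintype.card_fin]
      · omega
      · intro j hj k hk
        exact hinj i (by simpa using hj) (by simpa using hk)
    · intro x hx
      simp only [Finset.mem_image, Finset.mem_erase, Finset.mem_univ, and_true] at hx
      obtain ⟨j, hj, rfl⟩ := hx
      exact (hα i j hj).1
  choose θ hmono hper hθ using hθ
  have hlab : ∀ i k, ∃ j, j ≠ i ∧ ∃ z : ℤ, θ i k = α i j + z * Real.pi := by
    intro i k
    obtain ⟨t, ht, h⟩ := (hθ i _).1 ⟨k, rfl⟩
    simp only [Finset.mem_image, Finset.mem_erase, Finset.mem_univ, and_true] at ht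
    obtain ⟨j, hj, rfl⟩ := ht
    exact ⟨j, hj, h⟩
  choose lab hlab_ne hlab using hlab
  have hper' : ∀ i k (z : ℤ), θ i (k + N * z) = θ i k + z * Real.pi := by
    intro i k z
    induction z using Int.induction_on with
    | zero => simp
    | succ z ih =>
      rw [show k + N * ((z : ℤ) + 1) = k + N * z + N by ring, hper, ih]; push_cast; ring
    | pred z ih =>
      have := hper i (k + N * (-(z : ℤ) - 1))
      rw [show k + N * (-(z : ℤ) - 1) + N = k + N * -(z : ℤ) by ring, ih] at this
      push_cast at this ⊢
      linarith
  have hmem : ∀ i k, Φ i (θ i k, 0) ∈ A (lab i k) := fun i k =>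
    (hαmem i _ (hlab_ne i k) _).2 (hlab i k)
  have huniq : ∀ i k j, j ≠ i → Φ i (θ i k, 0) ∈ A j → lab i k = j := by
    intro i k j hj h
    by_contra hne
    obtain ⟨z, hz⟩ := (hαmem i j hj _).1 h
    have h2 : Φ i (α i j, 0) ∈ A (lab i k) := by
      rw [((hΦ i).eq_iff (α i j) (θ i k)).2 ⟨z, hz⟩]; exact hmem i k
    exact (hα i j hj).2.2.2 _ (hlab_ne i k) hne h2
  refine ⟨⟨Φ, θ, lab, hΦ, hN, hmono, hper, ?_, ?_, hlab_ne, ?_, ?_⟩, rfl⟩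
  · intro i j x hij
    constructor
    · intro h
      obtain ⟨k, rfl⟩ := (hθ i x).2 ⟨α i j, by simpa using ⟨j, hij, rfl⟩, (hαmem i j hij x).1 h⟩
      exact ⟨k, rfl, huniq i k j hij h⟩
    · rintro ⟨k, rfl, rfl⟩
      exact hmem i k
  · intro i k l
    constructor
    · intro h
      obtain ⟨z, hz⟩ := hlab i k
      obtain ⟨w, hw⟩ := hlab i l
      rw [h] at hz
      have h1 : θ i k = θ i (l + N * (z - w)) := by
        rw [hper', hz, hw]; push_cast; ring
      have h2 := (hmono i).injective h1
      exact ⟨z - w, by rw [h2]; ring⟩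
    · rintro ⟨z, hz⟩
      have h1 : k = l + N * z := by linarith
      have h2 : Φ i (θ i l, 0) = Φ i (θ i k, 0) := by
        rw [(hΦ i).eq_iff, h1, hper']; exact ⟨z, rfl⟩
      exact huniq i k _ (hlab_ne i l) (h2 ▸ hmem i l)
  · intro i j hij
    obtain ⟨k, hk⟩ := (hθ i (α i j)).2 ⟨α i j, by simpa using ⟨j, hij, rfl⟩, 0, by simp⟩
    refine ⟨k, huniq i k j hij ?_⟩
    rw [← hk]
    exact (hαmem i j hij _).2 ⟨0, by simp⟩
  · intro i k
    have h1 := (hα i _ (hlab_ne i k)).2.2.1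
    rwa [((hΦ i).eq_iff (α i (lab i k)) (θ i k)).2 (hlab i k)] at h1

end Arrangement

end

/-! ### Segments and polygons in coordinates -/

section

open Topology Filter Set

lemma IsStripParam.isClosed {A : Set RP2} {Φ : ℝ × ℝ → RP2} (h : IsStripParam A Φ) :
    IsClosed A := by
  have : A = (fun x => Φ (x, 0)) '' Icc 0 Real.pi := by
    apply Subset.antisymm
    · intro p hp
      obtain ⟨x, rfl⟩ := h.surj p hp
      have hm := toIcoMod_mem_Ico' Real.pi_pos x
      refine ⟨toIcoMod Real.pi_pos 0 x, ⟨hm.1, hm.2.le⟩, ?_⟩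
      refine (h.eq_iff _ _).2 ⟨toIcoDiv Real.pi_pos 0 x, ?_⟩
      have := toIcoMod_add_toIcoDiv_zsmul Real.pi_pos 0 x
      rw [zsmul_eq_mul] at this
      exact this.symm
    · rintro _ ⟨x, -, rfl⟩
      exact (h.mem_iff x 0).2 rfl
  rw [this]
  exact (isCompact_Icc.image (h.continuous.comp (by fun_prop))).isClosed

namespace Arrangement

variable {n N : ℕ} {A : Fin n → Set RP2}

lemma eq_connectedComponentIn_of_mem {P : Set RP2} (hP : P ∈ polygons A) {q : RP2} (hq : q ∈ P) :
    P = connectedComponentIn (⋃ i, A i)ᶜ q := by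
  obtain ⟨x, -, rfl⟩ := hP
  exact connectedComponentIn_eq hq

lemma subset_compl_of_mem_polygons {P : Set RP2} (hP : P ∈ polygons A) : P ⊆ (⋃ i, A i)ᶜ := by
  obtain ⟨x, -, rfl⟩ := hP
  exact connectedComponentIn_subset _ _

lemma notMem_of_mem_polygons {P : Set RP2} (hP : P ∈ polygons A) {q : RP2} (hq : q ∈ P)
    (i : Fin n) : q ∉ A i := fun h => subset_compl_of_mem_polygons hP hq (mem_iUnion.2 ⟨i, h⟩)

lemma eq_of_mem_polygons {P P' : Set RP2} (hP : P ∈ polygons A) (hP' : P' ∈ polygons A) {q : RP2}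
    (hq : q ∈ P) (hq' : q ∈ P') : P = P' :=
  (eq_connectedComponentIn_of_mem hP hq).trans (eq_connectedComponentIn_of_mem hP' hq').symm

lemma subset_of_isPreconnected {P K : Set RP2} (hP : P ∈ polygons A) (hK : IsPreconnected K)
    (hKA : ∀ q ∈ K, ∀ i, q ∉ A i) {q : RP2} (hq : q ∈ P) (hqK : q ∈ K) : K ⊆ P := by
  rw [eq_connectedComponentIn_of_mem hP hq]
  apply hK.subset_connectedComponentIn hqK
  intro x hx
  simpa using hKA x hx

lemma exists_polygon_of_isPreconnected {K : Set RP2} (hK : IsPreconnected K) (hne : K.Nonempty)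
    (hKA : ∀ q ∈ K, ∀ i, q ∉ A i) : ∃ P ∈ polygons A, K ⊆ P := by
  obtain ⟨q, hq⟩ := hne
  have h : q ∈ (⋃ i, A i)ᶜ := by simpa using hKA q hq
  have hP : connectedComponentIn (⋃ i, A i)ᶜ q ∈ polygons A := ⟨q, h, rfl⟩
  exact ⟨_, hP, subset_of_isPreconnected hP hK hKA (mem_connectedComponentIn h) hq⟩

namespace Coords

lemma isClosed (c : Coords N A) (i : Fin n) : IsClosed (A i) := (c.isStripParam i).isClosed

lemma isOpen_compl (c : Coords N A) : IsOpen (⋃ i, A i)ᶜ := by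
  rw [isOpen_compl_iff]
  exact isClosed_iUnion_of_finite fun i => c.isClosed i

lemma isOpen_polygon (c : Coords N A) {P : Set RP2} (hP : P ∈ polygons A) : IsOpen P := by
  obtain ⟨x, -, rfl⟩ := hP
  exact c.isOpen_compl.connectedComponentIn

variable (c : Coords N A)

lemma period_mul (i : Fin n) (k z : ℤ) : c.θ i (k + N * z) = c.θ i k + z * Real.pi := by
  induction z using Int.induction_on with
  | zero => simp
  | succ z ih =>
    rw [show k + N * ((z : ℤ) + 1) = k + N * z + N by ring, c.period, ih]; push_cast; ring
  | pred z ih =>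
    have := c.period i (k + N * (-(z : ℤ) - 1))
    rw [show k + N * (-(z : ℤ) - 1) + N = k + N * -(z : ℤ) by ring, ih] at this
    push_cast at this ⊢
    linarith

lemma exists_index (i : Fin n) (x : ℝ) : ∃ k, c.θ i k ≤ x ∧ x < c.θ i (k + 1) := by
  have hpi := Real.pi_pos
  have hN := c.pos
  obtain ⟨k, hk, hmax⟩ := Int.exists_greatest_of_bdd (P := fun k => c.θ i k ≤ x) (by
    obtain ⟨z, hz⟩ := exists_int_gt ((x - c.θ i 0) / Real.pi)
    refine ⟨N * z, fun k hk => ?_⟩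
    rw [div_lt_iff₀ hpi] at hz
    have := c.period_mul i 0 z
    rw [zero_add] at this
    exact (c.strictMono i).le_iff_le.1 (by linarith)) (by
    obtain ⟨z, hz⟩ := exists_int_lt ((x - c.θ i 0) / Real.pi)
    refine ⟨0 + N * z, ?_⟩
    rw [lt_div_iff₀ hpi] at hz
    rw [c.period_mul]
    linarith)
  refine ⟨k, hk, ?_⟩
  by_contra! h
  have := hmax (k + 1) h
  omega

lemma index_unique {i : Fin n} {k l : ℤ} {x : ℝ} (h : x ∈ Ioo (c.θ i k) (c.θ i (k + 1)))
    (h' : x ∈ Icc (c.θ i l) (c.θ i (l + 1))) : k = l := by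
  have h1 := (c.strictMono i).lt_iff_lt.1 (h.1.trans_le h'.2)
  have h2 := (c.strictMono i).lt_iff_lt.1 (h'.1.trans_lt h.2)
  omega

lemma notMem_of_mem_Ioo {i j : Fin n} (hij : j ≠ i) {k : ℤ} {x : ℝ}
    (h : x ∈ Ioo (c.θ i k) (c.θ i (k + 1))) : c.Φ i (x, 0) ∉ A j := by
  rw [c.mem_iff i j x hij]
  rintro ⟨l, rfl, -⟩
  have h1 := (c.strictMono i).lt_iff_lt.1 h.1
  have h2 := (c.strictMono i).lt_iff_lt.1 h.2
  omega

lemma mem_Ioo_shift {i : Fin n} {k z : ℤ} {x : ℝ} (h : x ∈ Ioo (c.θ i k) (c.θ i (k + 1))) :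
    x + z * Real.pi ∈ Ioo (c.θ i (k + N * z)) (c.θ i (k + N * z + 1)) := by
  rw [show k + N * z + 1 = k + 1 + N * z by ring, c.period_mul, c.period_mul]
  exact ⟨by linarith [h.1], by linarith [h.2]⟩

lemma mem_openPart_iff {i : Fin n} {x : ℝ} :
    c.Φ i (x, 0) ∈ openPart A i ↔ ∃ k, x ∈ Ioo (c.θ i k) (c.θ i (k + 1)) := by
  have hmem : c.Φ i (x, 0) ∈ A i := ((c.isStripParam i).mem_iff x 0).2 rfl
  simp only [openPart, Set.mem_sdiff, hmem, true_and, mem_iUnion, exists_prop, not_exists, not_and]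
  constructor
  · intro h
    obtain ⟨k, hk, hk'⟩ := c.exists_index i x
    refine ⟨k, lt_of_le_of_ne hk ?_, hk'⟩
    rintro rfl
    exact h (c.lab i k) (c.lab_ne i k) ((c.mem_iff i _ _ (c.lab_ne i k)).2 ⟨k, rfl, rfl⟩)
  · rintro ⟨k, hk⟩ j hj
    exact c.notMem_of_mem_Ioo hj hk

/-- The open segments of the arrangement. -/
def arc (i : Fin n) (k : ℤ) : Set RP2 :=
  (fun x => c.Φ i (x, 0)) '' Ioo (c.θ i k) (c.θ i (k + 1))

/-- The closed segments of the arrangement. -/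
def seg (i : Fin n) (k : ℤ) : Set RP2 :=
  (fun x => c.Φ i (x, 0)) '' Icc (c.θ i k) (c.θ i (k + 1))

lemma continuous_axis (i : Fin n) : Continuous fun x : ℝ => c.Φ i (x, 0) :=
  (c.isStripParam i).continuous.comp (by fun_prop)

lemma lt_succ (i : Fin n) (k : ℤ) : c.θ i k < c.θ i (k + 1) := c.strictMono i (by omega)

lemma closure_arc (i : Fin n) (k : ℤ) : closure (c.arc i k) = c.seg i k := by
  apply Subset.antisymm
  · apply closure_minimal (image_mono Ioo_subset_Icc_self)
    exact (isCompact_Icc.image (c.continuous_axis i)).isClosed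
  · rw [seg, ← closure_Ioo (c.lt_succ i k).ne]
    exact image_closure_subset_closure_image (c.continuous_axis i)

lemma connectedComponentIn_openPart {i : Fin n} {k : ℤ} {x : ℝ}
    (hx : x ∈ Ioo (c.θ i k) (c.θ i (k + 1))) :
    connectedComponentIn (openPart A i) (c.Φ i (x, 0)) = c.arc i k := by
  have hxo : c.Φ i (x, 0) ∈ openPart A i := c.mem_openPart_iff.2 ⟨k, hx⟩
  apply Subset.antisymm
  · have hpre := isPreconnected_connectedComponentIn (F := openPart A i) (x := c.Φ i (x, 0))
    have hsub := connectedComponentIn_subset (openPart A i) (c.Φ i (x, 0))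
    have hself := mem_connectedComponentIn hxo
    set K := connectedComponentIn (openPart A i) (c.Φ i (x, 0))
    rw [isPreconnected_iff_subset_of_disjoint] at hpre
    -- The images of the strips above segment `k` and above the other segments are open, cover `K`
    -- and are disjoint on `K`, so the connected set `K` lies in one of them.
    have hO1 : IsOpen (c.Φ i '' (Ioo (c.θ i k) (c.θ i (k + 1)) ×ˢ univ)) :=
      (c.isStripParam i).isOpenMap _ (isOpen_Ioo.prod isOpen_univ)
    have hO2 : IsOpen (c.Φ i '' ((⋃ l ∈ {l : ℤ | ¬ (N : ℤ) ∣ l - k},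
        Ioo (c.θ i l) (c.θ i (l + 1))) ×ˢ univ)) :=
      (c.isStripParam i).isOpenMap _ ((isOpen_biUnion fun _ _ => isOpen_Ioo).prod isOpen_univ)
    have hrep : ∀ q ∈ K, ∃ l, ∃ y ∈ Ioo (c.θ i l) (c.θ i (l + 1)), q = c.Φ i (y, 0) := by
      intro q hq
      have hq' := hsub hq
      obtain ⟨y, rfl⟩ := (c.isStripParam i).surj q hq'.1
      obtain ⟨l, hl⟩ := c.mem_openPart_iff.1 hq'
      exact ⟨l, y, hl, rfl⟩
    have hA : ∀ q ∈ K, q ∈ A i := fun q hq => (hsub hq).1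
    have key : ∀ l y l' y', y ∈ Ioo (c.θ i l) (c.θ i (l + 1)) →
        y' ∈ Ioo (c.θ i l') (c.θ i (l' + 1)) → c.Φ i (y, 0) = c.Φ i (y', 0) →
        (N : ℤ) ∣ l' - l := by
      intro l y l' y' hy hy' h
      obtain ⟨z, rfl⟩ := ((c.isStripParam i).eq_iff _ _).1 h
      have := c.index_unique (c.mem_Ioo_shift hy (z := z)) (Ioo_subset_Icc_self hy')
      exact ⟨z, by rw [← this]; ring⟩
    have hor := hpre _ _ hO1 hO2 (by
      intro q hq
      obtain ⟨l, y, hy, rfl⟩ := hrep q hq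
      by_cases hl : (N : ℤ) ∣ l - k
      · left
        obtain ⟨z, hz⟩ := hl
        have h1 := c.mem_Ioo_shift hy (z := -z)
        rw [show l + N * -z = k by linarith] at h1
        exact ⟨(y + (-z : ℤ) * Real.pi, 0), ⟨h1, trivial⟩,
          (((c.isStripParam i).eq_iff _ _).2 ⟨-z, rfl⟩).symm⟩
      · right
        exact ⟨(y, 0), ⟨mem_biUnion hl hy, trivial⟩, rfl⟩) (by
      rw [eq_empty_iff_forall_notMem]
      rintro q ⟨hq, ⟨⟨y, t⟩, ⟨hy, -⟩, rfl⟩, ⟨⟨y', t'⟩, ⟨hy', -⟩, h⟩⟩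
      have ht : t = 0 := ((c.isStripParam i).mem_iff y t).1 (hA _ hq)
      have ht' : t' = 0 := ((c.isStripParam i).mem_iff y' t').1 (h ▸ hA _ hq)
      subst ht ht'
      simp only [mem_iUnion, exists_prop] at hy'
      obtain ⟨l, hl, hy'⟩ := hy'
      exact hl (key _ _ _ _ hy hy' h.symm))
    rcases hor with h | h
    · intro q hq
      obtain ⟨⟨y, t⟩, ⟨hy, -⟩, rfl⟩ := h hq
      have ht : t = 0 := ((c.isStripParam i).mem_iff y t).1 (hA _ hq)
      subst ht
      exact ⟨y, hy, rfl⟩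
    · exfalso
      obtain ⟨⟨y, t⟩, ⟨hy, -⟩, hyx⟩ := h hself
      have ht : t = 0 := ((c.isStripParam i).mem_iff y t).1 (hyx ▸ hA _ hself)
      subst ht
      simp only [mem_iUnion, exists_prop] at hy
      obtain ⟨l, hl, hy⟩ := hy
      exact hl (key _ _ _ _ hx hy hyx.symm)
  · apply IsPreconnected.subset_connectedComponentIn
    · exact isPreconnected_Ioo.image _ (c.continuous_axis i).continuousOn
    · exact ⟨x, hx, rfl⟩
    · rintro _ ⟨y, hy, rfl⟩
      exact c.mem_openPart_iff.2 ⟨k, hy⟩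

lemma mem_segments_iff (c : Coords N A) {s : Set RP2} : s ∈ segments A ↔ ∃ i k, s = c.seg i k := by
  constructor
  · rintro ⟨i, p, hp, rfl⟩
    obtain ⟨x, rfl⟩ := (c.isStripParam i).surj p hp.1
    obtain ⟨k, hk⟩ := c.mem_openPart_iff.1 hp
    exact ⟨i, k, by rw [c.connectedComponentIn_openPart hk, c.closure_arc]⟩
  · rintro ⟨i, k, rfl⟩
    obtain ⟨x, hx⟩ := nonempty_Ioo.2 (c.lt_succ i k)
    exact ⟨i, c.Φ i (x, 0), c.mem_openPart_iff.2 ⟨k, hx⟩, by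
      rw [c.connectedComponentIn_openPart hx, c.closure_arc]⟩

lemma eq_of_mem_seg {i j : Fin n} {k l : ℤ} {x : ℝ} (hx : x ∈ Ioo (c.θ i k) (c.θ i (k + 1)))
    (h : c.Φ i (x, 0) ∈ c.seg j l) : i = j ∧ (N : ℤ) ∣ k - l := by
  obtain ⟨y, hy, hyx⟩ := h
  dsimp only at hyx
  have hij : i = j := by
    by_contra hij
    apply c.notMem_of_mem_Ioo (Ne.symm hij) hx
    rw [← hyx]
    exact ((c.isStripParam j).mem_iff y 0).2 rfl
  subst hij
  obtain ⟨z, rfl⟩ := ((c.isStripParam i).eq_iff _ _).1 hyx.symm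
  have := c.index_unique (c.mem_Ioo_shift hx (z := z)) hy
  exact ⟨rfl, -z, by rw [← this]; ring⟩

lemma seg_congr {i : Fin n} {k l : ℤ} (h : (N : ℤ) ∣ k - l) : c.seg i k = c.seg i l := by
  have key : ∀ k z : ℤ, c.seg i (k + N * z) ⊆ c.seg i k := by
    rintro k z _ ⟨y, hy, rfl⟩
    rw [show k + N * z + 1 = k + 1 + N * z by ring, c.period_mul, c.period_mul] at hy
    refine ⟨y - z * Real.pi, ⟨by linarith [hy.1], by linarith [hy.2]⟩, ?_⟩
    exact ((c.isStripParam i).eq_iff _ _).2 ⟨z, by ring⟩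
  obtain ⟨z, hz⟩ := h
  apply Subset.antisymm
  · have := key l z
    rwa [show l + N * z = k by linarith] at this
  · have := key k (-z)
    rwa [show k + N * -z = l by linarith] at this

/-- The segments, indexed modulo `N`. -/
noncomputable def segOf (e : Fin n × ZMod N) : Set RP2 := c.seg e.1 (e.2.cast : ℤ)

lemma segOf_mk (i : Fin n) (k : ℤ) : c.segOf (i, (k : ZMod N)) = c.seg i k := by
  have : NeZero N := ⟨c.pos.ne'⟩
  apply c.seg_congr
  rw [← SideSystem.cast_eq_iff]
  simp

lemma seg_subset_sUnion_iff {i : Fin n} {k : ℤ} {T : Set (Fin n × ZMod N)} :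
    c.seg i k ⊆ ⋃₀ (c.segOf '' T) ↔ (i, (k : ZMod N)) ∈ T := by
  constructor
  · intro h
    obtain ⟨x, hx⟩ := nonempty_Ioo.2 (c.lt_succ i k)
    obtain ⟨_, ⟨⟨j, a⟩, ha, rfl⟩, hxa⟩ := h ⟨x, Ioo_subset_Icc_self hx, rfl⟩
    obtain ⟨l, rfl⟩ := ZMod.intCast_surjective a
    rw [c.segOf_mk] at hxa
    obtain ⟨rfl, hkl⟩ := c.eq_of_mem_seg hx hxa
    rwa [SideSystem.cast_eq_iff.2 hkl]
  · intro h
    exact subset_sUnion_of_mem ⟨_, h, c.segOf_mk i k⟩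

lemma segOf_injective : Function.Injective c.segOf := by
  rintro ⟨i, a⟩ e h
  obtain ⟨k, rfl⟩ := ZMod.intCast_surjective a
  rw [c.segOf_mk] at h
  have := (c.seg_subset_sUnion_iff (i := i) (k := k) (T := {e})).1 (by simp [h])
  simpa using this

lemma range_segOf : range c.segOf = segments A := by
  ext s
  rw [c.mem_segments_iff]
  constructor
  · rintro ⟨⟨i, a⟩, rfl⟩
    obtain ⟨k, rfl⟩ := ZMod.intCast_surjective a
    exact ⟨i, k, c.segOf_mk i k⟩
  · rintro ⟨i, k, rfl⟩
    exact ⟨_, c.segOf_mk i k⟩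

/-! ### Faces -/

lemma exists_box {i : Fin n} {k : ℤ} {x : ℝ} (hx : x ∈ Ioo (c.θ i k) (c.θ i (k + 1))) :
    ∃ δ > 0, ∀ y t, |y - x| < δ → |t| < δ →
      y ∈ Ioo (c.θ i k) (c.θ i (k + 1)) ∧ ∀ j, j ≠ i → c.Φ i (y, t) ∉ A j := by
  have h1 : IsOpen (⋂ j ∈ {j : Fin n | j ≠ i}, (A j)ᶜ) :=
    (Set.toFinite _).isOpen_biInter fun j _ => (c.isClosed j).isOpen_compl
  have h2 : IsOpen (c.Φ i ⁻¹' (⋂ j ∈ {j : Fin n | j ≠ i}, (A j)ᶜ) ∩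
      (Ioo (c.θ i k) (c.θ i (k + 1)) ×ˢ univ)) :=
    (h1.preimage (c.isStripParam i).continuous).inter (isOpen_Ioo.prod isOpen_univ)
  obtain ⟨δ, hδ, hball⟩ := Metric.isOpen_iff.1 h2 (x, 0) ⟨by
    simp only [mem_preimage, mem_iInter, mem_compl_iff]
    intro j hj
    exact c.notMem_of_mem_Ioo hj hx, hx, trivial⟩
  refine ⟨δ, hδ, fun y t hy ht => ?_⟩
  have hm : (y, t) ∈ Metric.ball (x, (0 : ℝ)) δ := by
    rw [Metric.mem_ball, Prod.dist_eq, max_lt_iff]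
    simpa [Real.dist_eq] using ⟨hy, ht⟩
  have := hball hm
  refine ⟨this.2.1, ?_⟩
  have h3 := this.1
  simpa using h3

/-- Small half-boxes over nearby points overlap, so the polygon just above the curve is locally
constant along the connected segment. -/
lemma exists_face (i : Fin n) (k : ℤ) : ∃ P ∈ polygons A,
    ∀ x ∈ Ioo (c.θ i k) (c.θ i (k + 1)), ∃ δ > 0, ∀ y t, |y - x| < δ → 0 < t → t < δ →
      c.Φ i (y, t) ∈ P := by
  have hloc : ∀ x ∈ Ioo (c.θ i k) (c.θ i (k + 1)), ∃ P ∈ polygons A, ∃ δ > 0,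
      ∀ y t, |y - x| < δ → 0 < t → t < δ → c.Φ i (y, t) ∈ P := by
    intro x hx
    obtain ⟨δ, hδ, hbox⟩ := c.exists_box hx
    obtain ⟨P, hP, hsub⟩ := exists_polygon_of_isPreconnected (A := A)
      (K := c.Φ i '' (Ioo (x - δ) (x + δ) ×ˢ Ioo 0 δ))
      ((isPreconnected_Ioo.prod isPreconnected_Ioo).image _
        (c.isStripParam i).continuous.continuousOn)
      (((nonempty_Ioo.2 (by linarith)).prod (nonempty_Ioo.2 hδ)).image _) (by
        rintro _ ⟨⟨y, t⟩, ⟨hy, ht⟩, rfl⟩ j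
        by_cases hj : j = i
        · subst hj
          rw [(c.isStripParam j).mem_iff]
          exact ht.1.ne'
        · exact (hbox y t (abs_lt.2 ⟨by linarith [hy.1], by linarith [hy.2]⟩)
            (by rw [abs_of_pos ht.1]; exact ht.2)).2 j hj)
    refine ⟨P, hP, δ, hδ, fun y t hy ht ht' => hsub ⟨(y, t), ⟨?_, ht, ht'⟩, rfl⟩⟩
    rw [abs_lt] at hy
    exact ⟨by linarith, by linarith⟩
  choose! P hP δ hδ hmem using hloc
  obtain ⟨x₀, hx₀⟩ := nonempty_Ioo.2 (c.lt_succ i k)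
  have hconst : ∀ x ∈ Ioo (c.θ i k) (c.θ i (k + 1)), P x = P x₀ := by
    intro x hx
    refine isPreconnected_Ioo.induction₂ (fun x y => P x = P y) ?_ ?_ ?_ hx hx₀
    · intro x hx
      have h1 : ∀ᶠ y in 𝓝[Ioo (c.θ i k) (c.θ i (k + 1))] x, |y - x| < δ x := by
        apply nhdsWithin_le_nhds
        have := Metric.ball_mem_nhds x (hδ x hx)
        filter_upwards [this] with y hy
        rwa [Metric.mem_ball, Real.dist_eq] at hy
      filter_upwards [h1, self_mem_nhdsWithin] with y hy hyI
      have ht : 0 < min (δ x) (δ y) / 2 := by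
        have := hδ x hx
        have := hδ y hyI
        positivity
      exact eq_of_mem_polygons (hP x hx) (hP y hyI)
        (hmem x hx y (min (δ x) (δ y) / 2) hy ht (by
          have := min_le_left (δ x) (δ y); linarith))
        (hmem y hyI y (min (δ x) (δ y) / 2) (by simpa using hδ y hyI) ht (by
          have := min_le_right (δ x) (δ y); linarith))
    · intro x y z _ _ _ h1 h2
      exact h1.trans h2
    · intro x y _ _ h
      exact h.symm
  refine ⟨P x₀, hP x₀ hx₀, fun x hx => ⟨δ x, hδ x hx, ?_⟩⟩
  rw [← hconst x hx]
  exact hmem x hx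

/-- The face on the positive side of a segment. -/
noncomputable def face (i : Fin n) (k : ℤ) : Set RP2 := (c.exists_face i k).choose

lemma face_mem (i : Fin n) (k : ℤ) : c.face i k ∈ polygons A := (c.exists_face i k).choose_spec.1

lemma exists_mem_face {i : Fin n} {k : ℤ} {x : ℝ} (hx : x ∈ Ioo (c.θ i k) (c.θ i (k + 1))) :
    ∃ δ > 0, ∀ y t, |y - x| < δ → 0 < t → t < δ → c.Φ i (y, t) ∈ c.face i k :=
  (c.exists_face i k).choose_spec.2 x hx

lemma exists_mem_face_neg {i : Fin n} {k : ℤ} {x : ℝ}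
    (hx : x ∈ Ioo (c.θ i k) (c.θ i (k + 1))) :
    ∃ δ > 0, ∀ y t, |y - x| < δ → 0 < t → t < δ → c.Φ i (y, -t) ∈ c.face i (k + N) := by
  have h1 := c.mem_Ioo_shift hx (z := 1)
  rw [mul_one, Int.cast_one, one_mul] at h1
  obtain ⟨δ, hδ, h⟩ := c.exists_mem_face h1
  refine ⟨δ, hδ, fun y t hy ht ht' => ?_⟩
  rw [← (c.isStripParam i).shift]
  exact h _ _ (by rwa [add_sub_add_right_eq_sub]) ht ht'

lemma face_period (i : Fin n) (k : ℤ) : c.face i (k + 2 * N) = c.face i k := by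
  obtain ⟨x, hx⟩ := nonempty_Ioo.2 (c.lt_succ i k)
  have h1 := c.mem_Ioo_shift hx (z := 1)
  rw [mul_one, Int.cast_one, one_mul] at h1
  obtain ⟨δ, hδ, h⟩ := c.exists_mem_face_neg h1
  obtain ⟨δ', hδ', h'⟩ := c.exists_mem_face hx
  have ht : 0 < min δ δ' / 2 := by positivity
  have e1 := h (x + Real.pi) (min δ δ' / 2) (by simpa using hδ) ht (by
    have := min_le_left δ δ'; linarith)
  have e2 := h' x (min δ δ' / 2) (by simpa using hδ') ht (by
    have := min_le_right δ δ'; linarith)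
  rw [(c.isStripParam i).shift, neg_neg] at e1
  rw [show k + 2 * N = k + N + N by ring]
  exact eq_of_mem_polygons (c.face_mem _ _) (c.face_mem _ _) e1 e2

lemma eq_face_of_mem_closure {i : Fin n} {k : ℤ} {x : ℝ}
    (hx : x ∈ Ioo (c.θ i k) (c.θ i (k + 1))) {P : Set RP2} (hP : P ∈ polygons A)
    (h : c.Φ i (x, 0) ∈ closure P) : c.face i k = P ∨ c.face i (k + N) = P := by
  obtain ⟨δ, hδ, h1⟩ := c.exists_mem_face hx
  obtain ⟨δ', hδ', h2⟩ := c.exists_mem_face_neg hx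
  set ε := min δ δ' with hε
  have hε0 : 0 < ε := lt_min hδ hδ'
  have hO : IsOpen (c.Φ i '' (Ioo (x - ε) (x + ε) ×ˢ Ioo (-ε) ε)) :=
    (c.isStripParam i).isOpenMap _ (isOpen_Ioo.prod isOpen_Ioo)
  obtain ⟨_, ⟨⟨y, t⟩, ⟨hy, ht⟩, rfl⟩, hq⟩ := mem_closure_iff.1 h _ hO
    ⟨(x, 0), ⟨⟨by linarith, by linarith⟩, ⟨by linarith, by linarith⟩⟩, rfl⟩
  have hyx : |y - x| < ε := abs_lt.2 ⟨by linarith [hy.1], by linarith [hy.2]⟩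
  have ht0 : t ≠ 0 := by
    rintro rfl
    exact notMem_of_mem_polygons hP hq i (((c.isStripParam i).mem_iff y 0).2 rfl)
  rcases lt_or_gt_of_ne ht0 with h0 | h0
  · right
    have := h2 y (-t) (hyx.trans_le (min_le_right _ _)) (by linarith)
      (lt_of_lt_of_le (by linarith [ht.1]) (min_le_right δ δ'))
    rw [neg_neg] at this
    exact eq_of_mem_polygons (c.face_mem _ _) hP this hq
  · left
    have := h1 y t (hyx.trans_le (min_le_left _ _)) h0 (ht.2.trans_le (min_le_left _ _))
    exact eq_of_mem_polygons (c.face_mem _ _) hP this hq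

lemma seg_subset_frontier (i : Fin n) (k : ℤ) : c.seg i k ⊆ frontier (c.face i k) := by
  rw [← c.closure_arc]
  apply closure_minimal _ isClosed_frontier
  rintro _ ⟨x, hx, rfl⟩
  rw [(c.isOpen_polygon (c.face_mem i k)).frontier_eq]
  refine ⟨?_, fun h => notMem_of_mem_polygons (c.face_mem i k) h i
    (((c.isStripParam i).mem_iff x 0).2 rfl)⟩
  obtain ⟨δ, hδ, h⟩ := c.exists_mem_face hx
  have hc : Continuous fun t : ℝ => c.Φ i (x, t) :=
    (c.isStripParam i).continuous.comp (by fun_prop)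
  refine mem_closure_of_tendsto (b := 𝓝[>] (0 : ℝ)) (f := fun t => c.Φ i (x, t))
    (hc.tendsto' 0 _ rfl |>.mono_left nhdsWithin_le_nhds) ?_
  filter_upwards [Ioo_mem_nhdsGT hδ] with t ht
  exact h x t (by simpa using hδ) ht.1 ht.2

end Coords

end Arrangement

end

/-! ### The four quadrants at a crossing -/

section

open Topology Filter Set

lemma exists_sign_of_ne_zero {X : Type*} [TopologicalSpace X] {K : Set X} (hK : IsPreconnected K)
    {f : X → ℝ} (hf : ContinuousOn f K) (h0 : ∀ x ∈ K, f x ≠ 0) :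
    ∃ a : ℝ, (a = 1 ∨ a = -1) ∧ ∀ x ∈ K, 0 < a * f x := by
  by_cases h : ∃ x ∈ K, 0 < f x
  · obtain ⟨x, hx, hfx⟩ := h
    refine ⟨1, Or.inl rfl, fun y hy => ?_⟩
    rw [one_mul]
    by_contra! hy0
    obtain ⟨z, hz, hz0⟩ := hK.intermediate_value hy hx hf ⟨hy0, hfx.le⟩
    exact h0 z hz hz0
  · push Not at h
    refine ⟨-1, Or.inr rfl, fun y hy => ?_⟩
    have := lt_of_le_of_ne (h y hy) (h0 y hy)
    linarith

namespace Arrangement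

variable {n N : ℕ} {A : Fin n → Set RP2}

/-- A chart around the crossing of two curves of an arrangement, with values in a square. -/
structure IsQuadChart (A : Fin n → Set RP2) (i j : Fin n) (p : RP2)
    (φ : OpenPartialHomeomorph RP2 (ℝ × ℝ)) (r : ℝ) : Prop where
  r_pos : 0 < r
  mem : p ∈ φ.source
  zero : φ p = (0, 0)
  target : φ.target = Ioo (-r) r ×ˢ Ioo (-r) r
  left : ∀ q ∈ φ.source, q ∈ A i ↔ (φ q).2 = 0
  right : ∀ q ∈ φ.source, q ∈ A j ↔ (φ q).1 = 0
  other : ∀ q ∈ φ.source, ∀ m, m ≠ i → m ≠ j → q ∉ A m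

lemma IsQuadChart.swap {i j : Fin n} {p : RP2} {φ : OpenPartialHomeomorph RP2 (ℝ × ℝ)} {r : ℝ}
    (h : IsQuadChart A i j p φ r) :
    IsQuadChart A j i p (φ.transHomeomorph (Homeomorph.prodComm ℝ ℝ)) r where
  r_pos := h.r_pos
  mem := h.mem
  zero := by simp [h.zero]
  target := by
    ext ⟨x, y⟩
    simp [h.target, and_comm]
  left q hq := h.right q hq
  right q hq := h.left q hq
  other q hq m hi hj := h.other q hq m hj hi

lemma IsQuadChart.exists_quadrants {i j : Fin n} {p : RP2}
    {φ : OpenPartialHomeomorph RP2 (ℝ × ℝ)} {r : ℝ} (h : IsQuadChart A i j p φ r) :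
    ∃ G : ℝ → ℝ → Set RP2, ∀ a b, (a = 1 ∨ a = -1) → (b = 1 ∨ b = -1) → G a b ∈ polygons A ∧
      ∀ q ∈ φ.source, 0 < a * (φ q).1 → 0 < b * (φ q).2 → q ∈ G a b := by
  have key : ∀ a b : ℝ, ∃ P, (a = 1 ∨ a = -1) → (b = 1 ∨ b = -1) → P ∈ polygons A ∧
      ∀ q ∈ φ.source, 0 < a * (φ q).1 → 0 < b * (φ q).2 → q ∈ P := by
    intro a b
    by_cases hab : (a = 1 ∨ a = -1) ∧ (b = 1 ∨ b = -1)
    swap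
    · exact ⟨∅, fun h1 h2 => absurd ⟨h1, h2⟩ hab⟩
    obtain ⟨ha, hb⟩ := hab
    have hr := h.r_pos
    have hconv : ∀ s : ℝ, Convex ℝ (Ioo (-r) r ∩ {x : ℝ | 0 < s * x}) := fun s =>
      (convex_Ioo _ _).inter (convex_halfSpace_gt (f := fun x : ℝ => s * x)
        ⟨fun x y => mul_add _ _ _, fun c x => by simp; ring⟩ 0)
    have hne : ∀ s : ℝ, (s = 1 ∨ s = -1) → (Ioo (-r) r ∩ {x : ℝ | 0 < s * x}).Nonempty := by
      rintro s (rfl | rfl)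
      · exact ⟨r / 2, ⟨by linarith, by linarith⟩, by simpa using hr⟩
      · exact ⟨-(r / 2), ⟨by linarith, by linarith⟩, by simpa using hr⟩
    set K := (Ioo (-r) r ∩ {x : ℝ | 0 < a * x}) ×ˢ (Ioo (-r) r ∩ {x : ℝ | 0 < b * x}) with hKdef
    have hKt : K ⊆ φ.target := by
      rw [h.target]
      exact prod_mono inter_subset_left inter_subset_left
    obtain ⟨P, hP, hsub⟩ := exists_polygon_of_isPreconnected (A := A) (K := φ.symm '' K)
      (((hconv a).prod (hconv b)).isPreconnected.image _ (φ.continuousOn_symm.mono hKt))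
      (((hne a ha).prod (hne b hb)).image _) (by
        rintro _ ⟨z, hz, rfl⟩ m hm
        have hs := φ.map_target (hKt hz)
        have e := φ.right_inv (hKt hz)
        by_cases hmi : m = i
        · subst hmi
          rw [h.left _ hs, e] at hm
          have := hz.2.2
          simp [hm] at this
        by_cases hmj : m = j
        · subst hmj
          rw [h.right _ hs, e] at hm
          have := hz.1.2
          simp [hm] at this
        exact h.other _ hs m hmi hmj hm)
    refine ⟨P, fun _ _ => ⟨hP, fun q hq h1 h2 => hsub ⟨φ q, ?_, φ.left_inv hq⟩⟩⟩
    have := φ.map_source hq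
    rw [h.target] at this
    exact ⟨⟨this.1, h1⟩, ⟨this.2, h2⟩⟩
  choose G hG using key
  exact ⟨G, hG⟩

namespace Coords

variable (c : Coords N A)

lemma exists_isQuadChart (i : Fin n) (k : ℤ) :
    ∃ φ r, IsQuadChart A i (c.lab i k) (c.Φ i (c.θ i k, 0)) φ r := by
  obtain ⟨φ, hp, h0, hφ⟩ := c.cross i k
  set p := c.Φ i (c.θ i k, 0) with hpdef
  set j := c.lab i k with hj
  have hpm : ∀ m, m ≠ i → m ≠ j → p ∉ A m := by
    intro m hmi hmj hm
    rw [hpdef, c.mem_iff i m _ hmi] at hm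
    obtain ⟨l, hl, hlm⟩ := hm
    rw [← (c.strictMono i).injective hl] at hlm
    exact hmj (hj ▸ hlm.symm)
  have hO : IsOpen (⋂ m ∈ {m : Fin n | m ≠ i ∧ m ≠ j}, (A m)ᶜ) :=
    (Set.toFinite _).isOpen_biInter fun m _ => (c.isClosed m).isOpen_compl
  have hV : IsOpen (φ.target ∩ φ.symm ⁻¹' (⋂ m ∈ {m : Fin n | m ≠ i ∧ m ≠ j}, (A m)ᶜ)) :=
    φ.symm.isOpen_inter_preimage hO
  obtain ⟨r, hr, hball⟩ := Metric.isOpen_iff.1 hV (0, 0) ⟨h0 ▸ φ.map_source hp, by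
    rw [mem_preimage, ← h0, φ.left_inv hp]
    simpa using fun m h1 h2 => hpm m h1 h2⟩
  have hbox : Ioo (-r) r ×ˢ Ioo (-r) r ⊆
      φ.target ∩ φ.symm ⁻¹' (⋂ m ∈ {m : Fin n | m ≠ i ∧ m ≠ j}, (A m)ᶜ) := by
    rintro ⟨x, y⟩ ⟨hx, hy⟩
    apply hball
    rw [Metric.mem_ball, Prod.dist_eq, max_lt_iff, Real.dist_eq, Real.dist_eq, sub_zero, sub_zero,
      abs_lt, abs_lt]
    exact ⟨hx, hy⟩
  have hbo : IsOpen (Ioo (-r) r ×ˢ Ioo (-r) r : Set (ℝ × ℝ)) := isOpen_Ioo.prod isOpen_Ioo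
  set ψ := (φ.symm.restrOpen _ hbo).symm with hψ
  have hsrc : ∀ q, q ∈ ψ.source ↔ q ∈ φ.source ∧ φ q ∈ Ioo (-r) r ×ˢ Ioo (-r) r := by
    intro q
    simp [hψ, OpenPartialHomeomorph.restrOpen_toPartialEquiv]
  have hcoe : ∀ q, ψ q = φ q := fun q => rfl
  refine ⟨ψ, r, hr, ?_, ?_, ?_, ?_, ?_, ?_⟩
  · rw [hsrc, h0]
    exact ⟨hp, ⟨by linarith, by linarith⟩, ⟨by linarith, by linarith⟩⟩
  · rw [hcoe, h0]
  · show φ.target ∩ _ = _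
    exact inter_eq_right.2 fun z hz => (hbox hz).1
  · intro q hq
    rw [hcoe]; exact (hφ q ((hsrc q).1 hq).1).1
  · intro q hq
    rw [hcoe]; exact (hφ q ((hsrc q).1 hq).1).2
  · intro q hq m hmi hmj
    have h1 := (hsrc q).1 hq
    have h2 := (hbox h1.2).2
    rw [mem_preimage, φ.left_inv h1.1] at h2
    simp only [mem_iInter, mem_compl_iff] at h2
    exact h2 m ⟨hmi, hmj⟩

/-- The four faces around a vertex are the quadrants of a chart. -/
lemma exists_face_eq_quadrant {i j : Fin n} {k : ℤ} (hj : c.lab i k = j)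
    {φ : OpenPartialHomeomorph RP2 (ℝ × ℝ)} {r : ℝ}
    (h : IsQuadChart A i j (c.Φ i (c.θ i k, 0)) φ r) {G : ℝ → ℝ → Set RP2}
    (hG : ∀ a b, (a = 1 ∨ a = -1) → (b = 1 ∨ b = -1) → G a b ∈ polygons A ∧
      ∀ q ∈ φ.source, 0 < a * (φ q).1 → 0 < b * (φ q).2 → q ∈ G a b) :
    ∃ a b, (a = 1 ∨ a = -1) ∧ (b = 1 ∨ b = -1) ∧ c.face i k = G a b ∧
      c.face i (k - 1) = G (-a) b ∧ c.face i (k + N) = G a (-b) ∧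
      c.face i (k - 1 + N) = G (-a) (-b) := by
  have hcont := (c.isStripParam i).continuous
  have hji : j ≠ i := hj ▸ c.lab_ne i k
  set x := c.θ i k with hx
  obtain ⟨δ₀, hδ₀, hball⟩ := Metric.isOpen_iff.1 (φ.open_source.preimage hcont) (x, 0) h.mem
  have hlt := c.lt_succ i k
  have hlt' : c.θ i (k - 1) < x := c.strictMono i (by omega)
  obtain ⟨δ, hδ, hδ1, hδ2, hδ3⟩ : ∃ δ > 0, δ ≤ δ₀ ∧ x + δ ≤ c.θ i (k + 1) ∧
      c.θ i (k - 1) ≤ x - δ := by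
    refine ⟨min δ₀ (min (c.θ i (k + 1) - x) (x - c.θ i (k - 1))), ?_, min_le_left _ _, ?_, ?_⟩
    · exact lt_min hδ₀ (lt_min (by linarith) (by linarith))
    · have := (min_le_right δ₀ _).trans (min_le_left (c.θ i (k + 1) - x) (x - c.θ i (k - 1)))
      linarith
    · have := (min_le_right δ₀ _).trans (min_le_right (c.θ i (k + 1) - x) (x - c.θ i (k - 1)))
      linarith
  have hsrc : ∀ y ∈ Ioo (x - δ) (x + δ), ∀ t ∈ Ioo (-δ) δ, c.Φ i (y, t) ∈ φ.source := by
    intro y hy t ht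
    apply hball
    rw [Metric.mem_ball, Prod.dist_eq, max_lt_iff, Real.dist_eq, Real.dist_eq, sub_zero, abs_lt,
      abs_lt]
    exact ⟨⟨by linarith [hy.1], by linarith [hy.2]⟩, by linarith [ht.1], by linarith [ht.2]⟩
  have hψ : ContinuousOn (fun z => φ (c.Φ i z)) (Ioo (x - δ) (x + δ) ×ˢ Ioo (-δ) δ) :=
    φ.continuousOn.comp hcont.continuousOn fun z hz => hsrc z.1 hz.1 z.2 hz.2
  have h0mem : (0 : ℝ) ∈ Ioo (-δ) δ := ⟨by linarith, by linarith⟩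
  -- the first coordinate on the axis
  have haxis : ContinuousOn (fun y => (φ (c.Φ i (y, 0))).1) (Ioo (x - δ) (x + δ)) :=
    continuous_fst.comp_continuousOn (hψ.comp (f := fun y : ℝ => (y, (0 : ℝ))) (by fun_prop)
      fun y hy => ⟨hy, h0mem⟩)
  have haxis0 : ∀ y ∈ Ioo (x - δ) (x + δ), y ≠ x → (φ (c.Φ i (y, 0))).1 ≠ 0 := by
    intro y hy hyx h0
    rw [← h.right _ (hsrc y hy 0 h0mem), c.mem_iff i j y hji] at h0
    obtain ⟨l, rfl, -⟩ := h0
    have h1 := (c.strictMono i).lt_iff_lt.1 (hδ3.trans_lt hy.1)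
    have h2 := (c.strictMono i).lt_iff_lt.1 (hy.2.trans_le hδ2)
    exact hyx (by rw [hx]; congr 1; omega)
  have hR : Ioo x (x + δ) ⊆ Ioo (x - δ) (x + δ) := Ioo_subset_Ioo_left (by linarith)
  have hL : Ioo (x - δ) x ⊆ Ioo (x - δ) (x + δ) := Ioo_subset_Ioo_right (by linarith)
  obtain ⟨a, ha, haR⟩ := exists_sign_of_ne_zero isPreconnected_Ioo (haxis.mono hR)
    fun y hy => haxis0 y (hR hy) hy.1.ne'
  obtain ⟨a', ha', haL⟩ := exists_sign_of_ne_zero isPreconnected_Ioo (haxis.mono hL)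
    fun y hy => haxis0 y (hL hy) hy.2.ne
  -- the second coordinate off the axis
  have hU : Ioo (x - δ) (x + δ) ×ˢ Ioo 0 δ ⊆ Ioo (x - δ) (x + δ) ×ˢ Ioo (-δ) δ :=
    prod_mono Subset.rfl (Ioo_subset_Ioo_left (by linarith))
  have hD : Ioo (x - δ) (x + δ) ×ˢ Ioo (-δ) 0 ⊆ Ioo (x - δ) (x + δ) ×ˢ Ioo (-δ) δ :=
    prod_mono Subset.rfl (Ioo_subset_Ioo_right (by linarith))
  have hsnd : ∀ y ∈ Ioo (x - δ) (x + δ), ∀ t ∈ Ioo (-δ) δ, t ≠ 0 →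
      (φ (c.Φ i (y, t))).2 ≠ 0 := by
    intro y hy t ht ht0 h0
    rw [← h.left _ (hsrc y hy t ht), (c.isStripParam i).mem_iff] at h0
    exact ht0 h0
  obtain ⟨b, hb, hbU⟩ := exists_sign_of_ne_zero (isPreconnected_Ioo.prod isPreconnected_Ioo)
    (continuous_snd.comp_continuousOn (hψ.mono hU))
    fun z hz => hsnd z.1 hz.1 z.2 (hU hz).2 hz.2.1.ne'
  obtain ⟨b', hb', hbD⟩ := exists_sign_of_ne_zero (isPreconnected_Ioo.prod isPreconnected_Ioo)
    (continuous_snd.comp_continuousOn (hψ.mono hD))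
    fun z hz => hsnd z.1 hz.1 z.2 (hD hz).2 hz.2.2.ne
  -- the image of the box is a neighbourhood
  have hnear : ∀ u v : ℝ, ∃ ε > 0, ∃ y ∈ Ioo (x - δ) (x + δ), ∃ t ∈ Ioo (-δ) δ,
      φ (c.Φ i (y, t)) = (u * ε, v * ε) := by
    intro u v
    have hO : IsOpen (c.Φ i '' (Ioo (x - δ) (x + δ) ×ˢ Ioo (-δ) δ)) :=
      (c.isStripParam i).isOpenMap _ (isOpen_Ioo.prod isOpen_Ioo)
    have hV := φ.symm.isOpen_inter_preimage hO
    have h0V : ((0 : ℝ), (0 : ℝ)) ∈ φ.symm.source ∩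
        φ.symm ⁻¹' (c.Φ i '' (Ioo (x - δ) (x + δ) ×ˢ Ioo (-δ) δ)) := by
      refine ⟨h.zero ▸ φ.map_source h.mem, ?_⟩
      rw [mem_preimage, ← h.zero, φ.left_inv h.mem]
      exact ⟨(x, 0), ⟨⟨by linarith, by linarith⟩, h0mem⟩, rfl⟩
    have htend : Tendsto (fun ε : ℝ => (u * ε, v * ε)) (𝓝[>] 0) (𝓝 (0, 0)) := by
      have : Continuous fun ε : ℝ => (u * ε, v * ε) := by fun_prop
      exact (this.tendsto' 0 _ (by simp)).mono_left nhdsWithin_le_nhds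
    obtain ⟨ε, ⟨hε1, hε2⟩, hε⟩ :=
      ((htend.eventually (hV.mem_nhds h0V)).and self_mem_nhdsWithin).exists
    obtain ⟨⟨y, t⟩, ⟨hy, ht⟩, hyt⟩ := hε2
    exact ⟨ε, hε, y, hy, t, ht, by rw [hyt]; exact φ.right_inv hε1⟩
  -- The image of the box is a neighbourhood of the origin, so it contains a point of the half-axis
  -- opposite to `a`. That point comes from the curve `i`, but not from the right of the vertex,
  -- hence from the left.
  have haa : a' = -a := by
    obtain ⟨ε, hε, y, hy, t, ht, he⟩ := hnear (-a) 0
    have ht0 : t = 0 := by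
      by_contra ht0
      exact hsnd y hy t ht ht0 (by rw [he]; simp)
    subst ht0
    rcases lt_trichotomy y x with hyx | rfl | hyx
    · have := haL y ⟨hy.1, hyx⟩
      rw [he] at this
      rcases ha with rfl | rfl <;> rcases ha' with rfl | rfl <;> simp at this ⊢ <;> linarith
    · have h1 := h.zero
      rw [he] at h1
      have := congrArg Prod.fst h1
      rcases ha with rfl | rfl <;> simp at this <;> linarith
    · have := haR y ⟨hyx, hy.2⟩
      rw [he] at this
      rcases ha with rfl | rfl <;> simp at this <;> linarith
  have hbb : b' = -b := by
    obtain ⟨ε, hε, y, hy, t, ht, he⟩ := hnear 0 (-b)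
    rcases lt_trichotomy t 0 with ht0 | rfl | ht0
    · have := hbD (y, t) ⟨hy, ht.1, ht0⟩
      simp only [Function.comp, he] at this
      rcases hb with rfl | rfl <;> rcases hb' with rfl | rfl <;> simp at this ⊢ <;> linarith
    · have h1 : c.Φ i (y, 0) ∈ A i := ((c.isStripParam i).mem_iff y 0).2 rfl
      rw [h.left _ (hsrc y hy 0 ht), he] at h1
      rcases hb with rfl | rfl <;> simp at h1 <;> linarith
    · have := hbU (y, t) ⟨hy, ht0, ht.2⟩
      simp only [Function.comp, he] at this
      rcases hb with rfl | rfl <;> simp at this <;> linarith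
  subst haa hbb
  -- A point close enough to the axis lies both in the face and in the quadrant, and polygons with a
  -- common point are equal.
  have hconcl : ∀ (l : ℤ) (s y a₀ b₀ : ℝ), (s = 1 ∨ s = -1) → y ∈ Ioo (x - δ) (x + δ) →
      (a₀ = 1 ∨ a₀ = -1) → (b₀ = 1 ∨ b₀ = -1) → 0 < a₀ * (φ (c.Φ i (y, 0))).1 →
      (∀ t, 0 < t → t < δ → 0 < b₀ * (φ (c.Φ i (y, s * t))).2) →
      (∃ η > 0, ∀ t, 0 < t → t < η → c.Φ i (y, s * t) ∈ c.face i l) →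
      c.face i l = G a₀ b₀ := by
    rintro l s y a₀ b₀ hs hy ha₀ hb₀ h1 h2 ⟨η, hη, h3⟩
    have hst : ∀ t, 0 < t → t < δ → s * t ∈ Ioo (-δ) δ := by
      intro t ht ht'
      rcases hs with rfl | rfl
      · exact ⟨by linarith, by linarith⟩
      · exact ⟨by linarith, by linarith⟩
    have hcs : ContinuousAt (fun t => a₀ * (φ (c.Φ i (y, s * t))).1) 0 := by
      have e1 : ContinuousAt (fun z => φ (c.Φ i z)) (y, s * 0) := by
        rw [mul_zero]
        exact hψ.continuousAt ((isOpen_Ioo.prod isOpen_Ioo).mem_nhds ⟨hy, h0mem⟩)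
      have e2 : ContinuousAt (fun t : ℝ => (y, s * t)) 0 := by fun_prop
      exact continuousAt_const.mul (continuous_fst.continuousAt.comp
        (ContinuousAt.comp (f := fun t : ℝ => (y, s * t)) e1 e2))
    have hev := hcs.eventually (lt_mem_nhds (a := 0) (by simpa using h1))
    have hev' : ∀ᶠ t in 𝓝[>] (0 : ℝ), 0 < a₀ * (φ (c.Φ i (y, s * t))).1 := nhdsWithin_le_nhds hev
    obtain ⟨t, ht1, ht2⟩ := (hev'.and (Ioo_mem_nhdsGT (lt_min hδ hη))).exists
    have hq := h3 t ht2.1 (ht2.2.trans_le (min_le_right _ _))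
    have htδ := ht2.2.trans_le (min_le_left δ η)
    exact eq_of_mem_polygons (c.face_mem i l) (hG a₀ b₀ ha₀ hb₀).1 hq
      ((hG a₀ b₀ ha₀ hb₀).2 _ (hsrc y hy _ (hst t ht2.1 htδ)) ht1 (h2 t ht2.1 htδ))
  have hyR : x + δ / 2 ∈ Ioo x (x + δ) := ⟨by linarith, by linarith⟩
  have hyL : x - δ / 2 ∈ Ioo (x - δ) x := ⟨by linarith, by linarith⟩
  have hyR' : x + δ / 2 ∈ Ioo (c.θ i k) (c.θ i (k + 1)) := ⟨hyR.1, hyR.2.trans_le hδ2⟩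
  have hyL' : x - δ / 2 ∈ Ioo (c.θ i (k - 1)) (c.θ i (k - 1 + 1)) := by
    rw [sub_add_cancel]
    exact ⟨hδ3.trans_lt hyL.1, hyL.2⟩
  have hna : -a = 1 ∨ -a = -1 := by rcases ha with rfl | rfl <;> simp
  have hnb : -b = 1 ∨ -b = -1 := by rcases hb with rfl | rfl <;> simp
  refine ⟨a, b, ha, hb, ?_, ?_, ?_, ?_⟩
  · obtain ⟨η, hη, h1⟩ := c.exists_mem_face hyR'
    refine hconcl k 1 _ a b (Or.inl rfl) (hR hyR) ha hb (haR _ hyR)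
      (fun t ht ht' => ?_) ⟨η, hη, fun t ht ht' => ?_⟩
    · rw [one_mul]; exact hbU (_, t) ⟨hR hyR, ht, ht'⟩
    · rw [one_mul]; exact h1 _ t (by simpa using hη) ht ht'
  · obtain ⟨η, hη, h1⟩ := c.exists_mem_face hyL'
    refine hconcl (k - 1) 1 _ (-a) b (Or.inl rfl) (hL hyL) hna hb (haL _ hyL)
      (fun t ht ht' => ?_) ⟨η, hη, fun t ht ht' => ?_⟩
    · rw [one_mul]; exact hbU (_, t) ⟨hL hyL, ht, ht'⟩
    · rw [one_mul]; exact h1 _ t (by simpa using hη) ht ht'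
  · obtain ⟨η, hη, h1⟩ := c.exists_mem_face_neg hyR'
    refine hconcl (k + N) (-1) _ a (-b) (Or.inr rfl) (hR hyR) ha hnb (haR _ hyR)
      (fun t ht ht' => ?_) ⟨η, hη, fun t ht ht' => ?_⟩
    · rw [neg_one_mul]; exact hbD (_, -t) ⟨hR hyR, by dsimp only; linarith, by dsimp only; linarith⟩
    · rw [neg_one_mul]; exact h1 _ t (by simpa using hη) ht ht'
  · obtain ⟨η, hη, h1⟩ := c.exists_mem_face_neg hyL'
    refine hconcl (k - 1 + N) (-1) _ (-a) (-b) (Or.inr rfl) (hL hyL) hna hnb (haL _ hyL)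
      (fun t ht ht' => ?_) ⟨η, hη, fun t ht ht' => ?_⟩
    · rw [neg_one_mul]; exact hbD (_, -t) ⟨hL hyL, by dsimp only; linarith, by dsimp only; linarith⟩
    · rw [neg_one_mul]; exact h1 _ t (by simpa using hη) ht ht'

end Coords

end Arrangement

end

/-! ### The side system of an arrangement -/

section

open Topology Filter Set

namespace Arrangement

variable {n N : ℕ} {A : Fin n → Set RP2}

namespace Coords

variable (c : Coords N A)

lemma face_add_add (i : Fin n) (k : ℤ) : c.face i (k + N + N) = c.face i k := by
  rw [← c.face_period i k]; congr 1; ring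

lemma face_vertex (i : Fin n) (k : ℤ) : ∃ b d : ℤ,
    ((d = 1 ∧ c.lab (c.lab i k) b = i) ∨ (d = -1 ∧ c.lab (c.lab i k) (b + 1) = i)) ∧
    c.face (c.lab i k) b = c.face i k ∧ c.face (c.lab i k) (b + N) = c.face i (k - 1) ∧
    c.face (c.lab i k) (b - d) = c.face i (k + N) ∧
    c.face (c.lab i k) (b - d + N) = c.face i (k - 1 + N) := by
  obtain ⟨φ, r, h⟩ := c.exists_isQuadChart i k
  obtain ⟨G, hG⟩ := h.exists_quadrants
  obtain ⟨a, b, ha, hb, e1, e2, e3, e4⟩ := c.exists_face_eq_quadrant rfl h hG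
  set j := c.lab i k with hj
  have hji : j ≠ i := c.lab_ne i k
  obtain ⟨y, hy⟩ := (c.isStripParam j).surj (c.Φ i (c.θ i k, 0))
    ((c.mem_iff i j _ hji).2 ⟨k, rfl, rfl⟩)
  obtain ⟨l, rfl, hl⟩ := (c.mem_iff j i y hji.symm).1
    (hy ▸ ((c.isStripParam i).mem_iff (c.θ i k) 0).2 rfl)
  have hswap := h.swap
  rw [← hy] at hswap
  obtain ⟨a', b', ha', hb', f1, f2, f3, f4⟩ := c.exists_face_eq_quadrant hl hswap
    (G := fun u v => G v u) (fun u v hu hv => ⟨(hG v u hv hu).1, fun q hq h1 h2 =>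
      (hG v u hv hu).2 q hq h2 h1⟩)
  -- The two strips are oriented independently; replacing `l` by `l + N` makes the positive side of
  -- `j` the side where `i` continues after the vertex.
  obtain ⟨l₀, hl₀, g1, g2, g3, g4⟩ : ∃ l₀, c.lab j l₀ = i ∧ c.face j l₀ = G a a' ∧
      c.face j (l₀ - 1) = G a (-a') ∧ c.face j (l₀ + N) = G (-a) a' ∧
      c.face j (l₀ - 1 + N) = G (-a) (-a') := by
    have hcases : b' = a ∨ b' = -a := by
      rcases ha with rfl | rfl <;> rcases hb' with rfl | rfl <;> simp
    rcases hcases with rfl | rfl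
    · exact ⟨l, hl, f1, f2, f3, f4⟩
    · rw [neg_neg] at f3 f4
      refine ⟨l + N, by rw [← hl, c.lab_eq_iff]; simp, f3, ?_, ?_, ?_⟩
      · rw [← f4]; congr 1; ring
      · rw [c.face_add_add, f1]
      · rw [← f2, ← c.face_add_add j (l - 1)]; congr 1; ring
  -- The direction of `j` is now compared with the positive side of `i`; this decides the sign `d`.
  have hcases : a' = b ∨ a' = -b := by
    rcases ha' with rfl | rfl <;> rcases hb with rfl | rfl <;> simp
  rcases hcases with rfl | rfl
  · exact ⟨l₀, 1, Or.inl ⟨rfl, hl₀⟩, g1.trans e1.symm, g3.trans e2.symm, g2.trans e3.symm,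
      g4.trans e4.symm⟩
  · rw [neg_neg] at g2 g4
    refine ⟨l₀ - 1, -1, Or.inr ⟨rfl, by rwa [sub_add_cancel]⟩, g2.trans e1.symm, g4.trans e2.symm,
      ?_, ?_⟩
    · rw [e3, ← g1]; congr 1; ring
    · rw [e4, ← g3]; congr 1; ring

/-- The side system of a simple arrangement. -/
noncomputable def sideSystem : SideSystem n N (Set RP2) where
  lab := c.lab
  face := c.face
  lab_eq_iff := c.lab_eq_iff
  lab_ne := c.lab_ne
  lab_surj := c.lab_surj
  face_period := c.face_period
  vertex := c.face_vertex

lemma eq_face_of_vertex_mem_closure {i : Fin n} {k : ℤ} {P : Set RP2} (hP : P ∈ polygons A)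
    (h : c.Φ i (c.θ i k, 0) ∈ closure P) : (c.face i k = P ∨ c.face i (k + N) = P) ∨
      (c.face i (k - 1) = P ∨ c.face i (k - 1 + N) = P) := by
  obtain ⟨φ, r, hφ⟩ := c.exists_isQuadChart i k
  obtain ⟨G, hG⟩ := hφ.exists_quadrants
  obtain ⟨a, b, ha, hb, e1, e2, e3, e4⟩ := c.exists_face_eq_quadrant rfl hφ hG
  obtain ⟨q, hq, hqP⟩ := mem_closure_iff.1 h _ φ.open_source hφ.mem
  have hsign : ∀ x : ℝ, x ≠ 0 → ∃ s : ℝ, (s = 1 ∨ s = -1) ∧ 0 < s * x := by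
    intro x hx
    rcases lt_or_gt_of_ne hx with hx | hx
    · exact ⟨-1, Or.inr rfl, by linarith⟩
    · exact ⟨1, Or.inl rfl, by linarith⟩
  obtain ⟨u, hu, hu'⟩ := hsign (φ q).1 fun h0 =>
    notMem_of_mem_polygons hP hqP _ ((hφ.right q hq).2 h0)
  obtain ⟨v, hv, hv'⟩ := hsign (φ q).2 fun h0 =>
    notMem_of_mem_polygons hP hqP _ ((hφ.left q hq).2 h0)
  have hGP := eq_of_mem_polygons (hG u v hu hv).1 hP ((hG u v hu hv).2 q hq hu' hv') hqP
  have hu2 : u = a ∨ u = -a := by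
    rcases ha with rfl | rfl <;> rcases hu with rfl | rfl <;> simp
  have hv2 : v = b ∨ v = -b := by
    rcases hb with rfl | rfl <;> rcases hv with rfl | rfl <;> simp
  rw [e1, e2, e3, e4, ← hGP]
  rcases hu2 with rfl | rfl <;> rcases hv2 with rfl | rfl <;> simp

lemma seg_subset_frontier_of_mem_edges {e : Fin n × ZMod N} {P : Set RP2}
    (he : e ∈ c.sideSystem.edges P) : c.segOf e ⊆ frontier P := by
  obtain ⟨i, a⟩ := e
  obtain ⟨k, hk, rfl⟩ := he
  rw [c.segOf_mk, ← hk]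
  exact c.seg_subset_frontier i k

/-- A boundary point lies on some curve, since otherwise its own polygon would be an open set
meeting `P`. Inside a segment only two polygons are near, and at a vertex only four. -/
lemma frontier_eq {P : Set RP2} (hP : P ∈ polygons A) :
    frontier P = ⋃₀ (c.segOf '' c.sideSystem.edges P) := by
  apply Subset.antisymm
  · intro q hq
    rw [(c.isOpen_polygon hP).frontier_eq] at hq
    obtain ⟨i, hi⟩ : ∃ i, q ∈ A i := by
      by_contra! hne
      have hqc : q ∈ (⋃ i, A i)ᶜ := by simpa using hne
      have hP' : connectedComponentIn (⋃ i, A i)ᶜ q ∈ polygons A := ⟨q, hqc, rfl⟩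
      obtain ⟨q', h1, h2⟩ := mem_closure_iff.1 hq.1 _ (c.isOpen_polygon hP')
        (mem_connectedComponentIn hqc)
      exact hq.2 (eq_of_mem_polygons hP' hP h1 h2 ▸ mem_connectedComponentIn hqc)
    obtain ⟨x, rfl⟩ := (c.isStripParam i).surj q hi
    have key : ∀ k, (c.face i k = P ∨ c.face i (k + N) = P) →
        x ∈ Icc (c.θ i k) (c.θ i (k + 1)) →
        c.Φ i (x, 0) ∈ ⋃₀ (c.segOf '' c.sideSystem.edges P) := fun k h1 h2 =>
      ⟨_, ⟨_, c.sideSystem.mem_edges_iff.2 h1, c.segOf_mk i k⟩, x, h2, rfl⟩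
    obtain ⟨k, hk, hk'⟩ := c.exists_index i x
    rcases hk.lt_or_eq with hlt | rfl
    · exact key k (c.eq_face_of_mem_closure ⟨hlt, hk'⟩ hP hq.1) ⟨hk, hk'.le⟩
    · rcases c.eq_face_of_vertex_mem_closure hP hq.1 with h | h
      · exact key k h ⟨le_rfl, hk'.le⟩
      · refine key (k - 1) h ?_
        rw [sub_add_cancel]
        exact ⟨(c.strictMono i (by omega)).le, le_rfl⟩
  · rintro q ⟨_, ⟨e, he, rfl⟩, hq⟩
    exact c.seg_subset_frontier_of_mem_edges he hq

lemma segOf_subset_frontier_iff {e : Fin n × ZMod N} {P : Set RP2} (hP : P ∈ polygons A) :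
    c.segOf e ⊆ frontier P ↔ e ∈ c.sideSystem.edges P := by
  obtain ⟨i, a⟩ := e
  obtain ⟨k, rfl⟩ := ZMod.intCast_surjective a
  rw [c.frontier_eq hP, c.segOf_mk, c.seg_subset_sUnion_iff]

lemma isGon_iff {m : ℕ} {P : Set RP2} :
    IsGon A m P ↔ P ∈ polygons A ∧ (c.sideSystem.edges P).ncard = m := by
  refine and_congr_right fun hP => ?_
  constructor
  · rintro ⟨S, hS, rfl, -, hd⟩
    rw [← c.range_segOf] at hS
    obtain ⟨T, rfl⟩ := subset_range_iff_exists_image_eq.1 hS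
    rw [ncard_image_of_injective _ c.segOf_injective]
    congr 1
    ext ⟨i, a⟩
    obtain ⟨k, rfl⟩ := ZMod.intCast_surjective a
    rw [← c.segOf_subset_frontier_iff hP, hd, c.segOf_mk, c.seg_subset_sUnion_iff]
  · intro h
    have : NeZero N := ⟨c.pos.ne'⟩
    refine ⟨_, ?_, ?_, (toFinite _).image _, c.frontier_eq hP⟩
    · rw [← c.range_segOf]
      exact image_subset_range _ _
    · rw [ncard_image_of_injective _ c.segOf_injective, h]

lemma triangles_eq : triangles A = {P | c.sideSystem.IsTri P} := by
  ext P
  refine (c.isGon_iff (m := 3)).trans ⟨And.right, fun h => ⟨?_, h⟩⟩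
  obtain ⟨⟨i, a⟩, k, rfl, -⟩ := nonempty_of_ncard_ne_zero (s := c.sideSystem.edges P) (by
    have : (c.sideSystem.edges P).ncard = 3 := h
    omega)
  exact c.face_mem i k

lemma unused_eq : unused A = c.segOf '' c.sideSystem.unusedEdges := by
  have key : ∀ e, (∃ T ∈ triangles A, c.segOf e ⊆ frontier T) ↔
      ∃ X, c.sideSystem.IsTri X ∧ e ∈ c.sideSystem.edges X := by
    intro e
    refine exists_congr fun T => ?_
    constructor
    · rintro ⟨h1, h2⟩
      exact ⟨c.triangles_eq.subset h1, (c.segOf_subset_frontier_iff h1.1).1 h2⟩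
    · rintro ⟨h1, h2⟩
      have h3 : T ∈ triangles A := c.triangles_eq.superset h1
      exact ⟨h3, (c.segOf_subset_frontier_iff h3.1).2 h2⟩
  ext s
  constructor
  · rintro ⟨h1, h2⟩
    rw [← c.range_segOf] at h1
    obtain ⟨e, rfl⟩ := h1
    rw [key] at h2
    exact ⟨e, h2, rfl⟩
  · rintro ⟨e, he, rfl⟩
    refine ⟨c.range_segOf ▸ mem_range_self e, ?_⟩
    rw [key]
    exact he

/-- Two curves are separated by a sign that is locally constant off these curves. -/
lemma separating {h : Fin n → RP2 ≃ₜ RP2}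
    (hh : ∀ i v, v ≠ 0 → ((h i).symm (RP2.pt v) ∈ A i ↔ v 0 = 0))
    (hc : c.Φ = fun i q => (h i).symm (RP2.pt (RP2.stripVec q))) : c.sideSystem.Separating := by
  intro o i hoi
  obtain ⟨σ, h1, h2⟩ := RP2.exists_sign (hh o) (hh i)
  have hconst : ∀ P ∈ polygons A, ∀ p ∈ P, ∀ q ∈ P, σ p = σ q := by
    intro P hP p hp q hq
    have hpre : IsPreconnected P := by
      obtain ⟨x, -, rfl⟩ := hP
      exact isPreconnected_connectedComponentIn
    refine hpre.induction₂ (fun p q => σ p = σ q) ?_ ?_ ?_ hp hq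
    · intro x hx
      filter_upwards [nhdsWithin_le_nhds (h1 x (notMem_of_mem_polygons hP hx o)
        (notMem_of_mem_polygons hP hx i))] with y hy
      exact hy.symm
    · intro x y z _ _ _ h1 h2
      exact h1.trans h2
    · intro x y _ _ h
      exact h.symm
  have hs : ∀ P : Set RP2, ∃ s : ZMod 2, P ∈ polygons A → ∀ p ∈ P, σ p = s := by
    intro P
    by_cases hP : P ∈ polygons A ∧ P.Nonempty
    · obtain ⟨hP, p, hp⟩ := hP
      exact ⟨σ p, fun _ q hq => hconst P hP q hq p hp⟩
    · exact ⟨0, fun h p hp => absurd ⟨h, p, hp⟩ hP⟩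
  choose s hs using hs
  have hnear : ∀ m k, ∃ x ∈ Ioo (c.θ m k) (c.θ m (k + 1)), ∀ᶠ t in 𝓝[>] (0 : ℝ),
      σ (c.Φ m (x, t)) = s (c.face m k) ∧ σ (c.Φ m (x, -t)) = s (c.face m (k + N)) := by
    intro m k
    obtain ⟨x, hx⟩ := nonempty_Ioo.2 (c.lt_succ m k)
    obtain ⟨δ, hδ, e1⟩ := c.exists_mem_face hx
    obtain ⟨δ', hδ', e2⟩ := c.exists_mem_face_neg hx
    refine ⟨x, hx, ?_⟩
    filter_upwards [Ioo_mem_nhdsGT hδ, Ioo_mem_nhdsGT hδ'] with t ht ht'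
    exact ⟨hs _ (c.face_mem _ _) _ (e1 x t (by simpa using hδ) ht.1 ht.2),
      hs _ (c.face_mem _ _) _ (e2 x t (by simpa using hδ') ht'.1 ht'.2)⟩
  refine ⟨s, fun m k hmo hmi => ?_, fun k => ?_⟩
  · obtain ⟨x, hx, hev⟩ := hnear m k
    have hloc := h1 _ (c.notMem_of_mem_Ioo (Ne.symm hmo) hx) (c.notMem_of_mem_Ioo (Ne.symm hmi) hx)
    have hcont := (c.isStripParam m).continuous
    have t1 : Tendsto (fun t : ℝ => c.Φ m (x, t)) (𝓝[>] 0) (𝓝 (c.Φ m (x, 0))) :=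
      ((hcont.comp (f := fun t : ℝ => (x, t)) (by fun_prop)).tendsto' 0 _ rfl).mono_left
        nhdsWithin_le_nhds
    have t2 : Tendsto (fun t : ℝ => c.Φ m (x, -t)) (𝓝[>] 0) (𝓝 (c.Φ m (x, 0))) :=
      ((hcont.comp (f := fun t : ℝ => (x, -t)) (by fun_prop)).tendsto' 0 _ (by simp)).mono_left
        nhdsWithin_le_nhds
    obtain ⟨t, ⟨h3, h4⟩, h5, h6⟩ := (hev.and ((t1.eventually hloc).and (t2.eventually hloc))).exists
    exact h4.symm.trans (h6.trans (h5.symm.trans h3))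
  · obtain ⟨x, hx, hev⟩ := hnear i k
    have hx' := c.notMem_of_mem_Ioo hoi hx
    rw [hc] at hx' hev
    obtain ⟨t, ⟨h3, h4⟩, h5⟩ := (hev.and (h2 x hx')).exists
    exact h4.symm.trans (h5.trans (congrArg (· + 1) h3))

end Coords

end Arrangement

end

/-! ### Conclusion -/

theorem mainTheorem6 {n : ℕ} (hn : 3 ≤ n) (hmod : n ≡ 2 [MOD 6])
    (A : Fin n → Set RP2) (hA : IsSimpleArrangement A) :
    (Arrangement.triangles A).Finite ∧
    (Arrangement.p₃ A : ℚ) ≤ ((n : ℚ) * ((n : ℚ) - 1) - 5) / 3 ∧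
    ((Arrangement.p₃ A : ℚ) = ((n : ℚ) * ((n : ℚ) - 1) - 5) / 3 →
      (Arrangement.unused A).ncard = 5 ∧
      ∃ P : Set RP2, Arrangement.IsGon A 5 P ∧
        Arrangement.Delimits (Arrangement.unused A) P) := by
  obtain ⟨m, N, hNdef, rfl⟩ : ∃ m N, N = 6 * m + 7 ∧ n = N + 1 := ⟨(n - 8) / 6, n - 1, by
    have : n % 6 = 2 := hmod
    omega, by omega⟩
  have hN3 : 3 ≤ N := by omega
  have : NeZero N := ⟨by omega⟩
  choose h hh using fun i => (hA.pseudoLine i).exists_homeo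
  obtain ⟨c, hc⟩ := Arrangement.exists_coords rfl (by omega) hA fun i => RP2.isStripParam (hh i)
  have hcount := c.sideSystem.count hN3
  have hp : Arrangement.p₃ A = {X | c.sideSystem.IsTri X}.ncard := by
    rw [Arrangement.p₃, c.triangles_eq]
  have hu : (Arrangement.unused A).ncard = c.sideSystem.unusedEdges.ncard := by
    rw [c.unused_eq, Set.ncard_image_of_injective _ c.segOf_injective]
  rw [← hp, ← hu] at hcount
  -- The number of unused segments is therefore 2 modulo 3: it is nonzero, hence at least three,
  -- hence at least five.
  have hmul : (N + 1) * N = 3 * (12 * m ^ 2 + 30 * m + 18) + 2 := by rw [hNdef]; ring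
  have h5 : 5 ≤ (Arrangement.unused A).ncard := by
    have h3 := c.sideSystem.three_le_unused hN3 (Set.nonempty_of_ncard_ne_zero (by
      rw [← hu]
      omega))
    rw [← hu] at h3
    omega
  have hq : ((N + 1 : ℕ) : ℚ) * (((N + 1 : ℕ) : ℚ) - 1) =
      3 * Arrangement.p₃ A + (Arrangement.unused A).ncard := by
    have : ((N + 1 : ℕ) : ℚ) - 1 = N := by push_cast; ring
    rw [this]
    exact_mod_cast hcount.symm
  rw [hq]
  refine ⟨c.triangles_eq ▸ c.sideSystem.finite_isTri, ?_, fun heq => ?_⟩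
  · have : (5 : ℚ) ≤ (Arrangement.unused A).ncard := by exact_mod_cast h5
    linarith
  · have hu5 : (Arrangement.unused A).ncard = 5 := by
      have : ((Arrangement.unused A).ncard : ℚ) = 5 := by linarith
      exact_mod_cast this
    obtain ⟨i, k, hik⟩ := c.sideSystem.exists_pentagon hN3 ⟨3 * m + 3, by omega⟩
      (c.separating hh hc) (hu ▸ hu5)
    have hP : c.face i k ∈ Arrangement.polygons A := c.face_mem i k
    have hE : c.sideSystem.edges (c.face i k) = c.sideSystem.unusedEdges := hik
    refine ⟨hu5, c.face i k, c.isGon_iff.2 ⟨hP, by rw [hE, ← hu, hu5]⟩, ?_⟩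
    rw [Arrangement.Delimits, c.unused_eq, c.frontier_eq hP, hE]
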